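/- \textbf{Theorem (Context-Bounded Reachability).} \emph{Stacks.} For $n\ge 1$ and a finite alphabet $\Sigma$, the order-$1$ annotated stacks are the finite sequences of symbols $a^{s}$ with $a\in\Sigma$, each annotated by an annotated stack $s$ of some order in $\{1,\dots,n\}$; for $2\le k\le n$ the order-$k$ annotated stacks are the finite sequences of order-$(k-1)$ annotated stacks (least such family; empty sequences are allowed; the first element is the top). The order-$n$ stack operations are $\mathrm{rew}_{a\to b}$ (replace the top symbol $a$ by $b$, keeping its annotation), $\mathrm{pop}_k$ and $\mathrm{cpush}_k$ ($1\le k\le n$), and $\mathrm{push}_k$ and $\mathrm{collapse}_k$ ($2\le k\le n$): with $u$ the topmost order-$k$ stack, $\mathrm{pop}_k$ removes the first element of $u$, $\mathrm{push}_k$ duplicates it, $\mathrm{cpush}_k$ puts on top of the stack a copy of its top symbol annotated by $\mathrm{pop}_k(u)$, and $\mathrm{collapse}_k$ replaces $u$ by the annotation of its top symbol if that annotation has order $k$. Operations are partial. \emph{Systems.} Let $P$ be a finite set of control states. An order-$n$ annotated stack tree is a finite ordered tree whose nodes are labelled by order-$n$ stacks and whose leaves also carry a control state from $P$. The tree operations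 are: $p\xrightarrow{o}p'$ (at a leaf with control state $p$, apply the stack operation $o$ and change the control state to $p'$); $p\to(p_1,\dots,p_m)$, $m\ge1$ (a leaf $(p,s)$ becomes an internal node labelled $s$ with $m$ children, the leaves $(p_1,s),\dots,(p_m,s)$); and $(p_1,\dots,p_m)\to p$, $m\ge1$ (a node labelled $s$ whose children are exactly $m$ leaves with control states $p_1,\dots,p_m$ in this order becomes the leaf $(p,s)$). A ground annotated stack tree rewrite system (GASTRS) with global state consists of $n$, $\Sigma$, $P$, a finite set $\mathcal G$ of global states, and a finite set of rules $(g,r,g')$ with $g,g'\in\mathcal G$ and $r$ a tree operation; there is a transition $(g,t)\to(g',t')$ if, for some rule $(g,r,g')$, applying $r$ at some place of $t$ gives $t'$. \emph{Automata.} An order-$n$ annotated stack tree automaton over $\Sigma,P$ has a finite set $Q\supseteq P$ of tree states, a set $F\subseteq Q$ of final states, finite sets $Q_k\supseteq F_k$ ($1\le k\le n$) of stack states and accepting stack states, and finitely many transitions: tree transitions $(q,i,m,q',x)$ with $1\le i\le m$, $q\in Q$, $q'\in Q\setminus F$, $x\in Q_n$; order-$k$ transitions $(x,x',X)$ with $x\in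 Q_k$, $x'\in Q_{k-1}$, $X\subseteq Q_k$ ($2\le k\le n$); and order-$1$ transitions $(x,a,B,X)$ with $x\in Q_1$, $a\in\Sigma$, $X\subseteq Q_1$ and $B\subseteq Q_k$ for some $1\le k\le n$. Stacks are accepted from stack states in the alternating fashion: $x\in Q_k$ accepts the empty order-$k$ stack iff $x\in F_k$; for $k\ge2$ it accepts the stack with first element $u$ and remainder $s$ iff for some $(x,x',X)$, $u$ is accepted from $x'$ and $s$ from every state in $X$; and for $k=1$ it accepts the stack with first symbol $a^{u}$ and remainder $s$ iff for some $(x,a,B,X)$, $u$ is accepted from every state in $B$ and $s$ from every state in $X$. A run labels each leaf by its control state and labels an internal node with $m$ children by some $q$ only if for each $i$ there is a transition $(q,i,m,q_i,x_i)$ such that the $i$-th child is labelled $q_i$ and its stack is accepted from $x_i$. The tree is accepted if for some run, with $q$ the label of the root, there is a transition $(q_f,1,1,q,x)$ with $q_f\in F$ and the stack of the root accepted from $x$. Write $\mathcal L(A)$ for the set of accepted trees. \emph{Claim.} The global context-bounded backwards reachability problem is decidable: there is an algorithm (a single computable function) which, given $n\ge1$, an order-$n$ GASTRS with global state over $\Sigma,P,\mathcal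 G$, an order-$n$ annotated stack tree automaton $A^0_g$ over $\Sigma,P$ for each $g\in\mathcal G$, and a bound $b\in\mathbb N$, computes for each $g\in\mathcal G$ an order-$n$ annotated stack tree automaton $A_g$ over $\Sigma,P$ such that for every order-$n$ annotated stack tree $t$ over $\Sigma,P$, \[ t\in\mathcal L(A_g)\iff \text{there is a run } (g,t)=(g_0,t_0)\to\cdots\to(g_\ell,t_\ell)=(g',t') \text{ with } t'\in\mathcal L(A^0_{g'}) \text{ and } g_i\ne g_{i+1} \text{ for at most } b \text{ indices } i<\ell . \] -/

import Mathlib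

/-! ### Annotated stacks

Stack symbols, control states, global states and automaton states are natural numbers; a finite
set of such objects is presented by a list (order and repetitions are irrelevant). -/

/-- `AnnStack n k` is the type of order-`k` stacks whose symbols are annotated by stacks of order
between `1` and `n` (there are no stacks of order `0`). An order-`1` stack is a sequence of
annotated symbols, an order-`(k+2)` stack is a sequence of order-`(k+1)` stacks; the first element
of the sequence is the top of the stack. -/
inductive AnnStack (n : ℕ) : ℕ → Type
  | empty (k : ℕ) : AnnStack n (k + 1)
  | sym (a : ℕ) {j : ℕ} (hj : j ≤ n) (ann : AnnStack n j) (s : AnnStack n 1) : AnnStack n 1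
  | cons {k : ℕ} (top : AnnStack n (k + 1)) (s : AnnStack n (k + 2)) : AnnStack n (k + 2)

namespace AnnStack

variable {n : ℕ}

/-- All symbols, also those inside annotations, belong to the alphabet. -/
def Over (alphabet : List ℕ) : {k : ℕ} → AnnStack n k → Prop
  | _, empty _ => True
  | _, sym a _ ann s => a ∈ alphabet ∧ Over alphabet ann ∧ Over alphabet s
  | _, cons top s => Over alphabet top ∧ Over alphabet s

/-- `TopSym a u s`: the topmost symbol of `s` is `a`, annotated by the stack `u`. -/
inductive TopSym (a : ℕ) {j : ℕ} (u : AnnStack n j) : {k : ℕ} → AnnStack n k → Prop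
  | sym (hj : j ≤ n) (s : AnnStack n 1) : TopSym a u (sym a hj u s)
  | cons {k : ℕ} {top : AnnStack n (k + 1)} (s : AnnStack n (k + 2)) (h : TopSym a u top) :
      TopSym a u (cons top s)

/-- `OnTop R s t`: `t` is obtained from `s` by replacing the topmost order-`k` stack `u` of `s` by
some `v` with `R u v`. -/
inductive OnTop {k : ℕ} (R : AnnStack n k → AnnStack n k → Prop) :
    {m : ℕ} → AnnStack n m → AnnStack n m → Prop
  | here {s t : AnnStack n k} (h : R s t) : OnTop R s t
  | cons {m : ℕ} {top top' : AnnStack n (m + 1)} (s : AnnStack n (m + 2))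
      (h : OnTop R top top') : OnTop R (cons top s) (cons top' s)

/-- Removing the first element of an order-`k` sequence. -/
inductive PopTop : {k : ℕ} → AnnStack n k → AnnStack n k → Prop
  | sym (a : ℕ) {j : ℕ} (hj : j ≤ n) (ann : AnnStack n j) (s : AnnStack n 1) :
      PopTop (sym a hj ann s) s
  | cons {k : ℕ} (top : AnnStack n (k + 1)) (s : AnnStack n (k + 2)) : PopTop (cons top s) s

/-- Duplicating the first element of a sequence of order at least `2`. -/
inductive PushTop : {k : ℕ} → AnnStack n k → AnnStack n k → Prop
  | cons {k : ℕ} (top : AnnStack n (k + 1)) (s : AnnStack n (k + 2)) :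
      PushTop (cons top s) (cons top (cons top s))

/-- Replacing the first symbol `a` of an order-`1` stack by `b`, keeping its annotation. -/
inductive RewTop (a b : ℕ) : AnnStack n 1 → AnnStack n 1 → Prop
  | sym {j : ℕ} (hj : j ≤ n) (ann : AnnStack n j) (s : AnnStack n 1) :
      RewTop a b (sym a hj ann s) (sym b hj ann s)

/-- Placing a given symbol `a` with annotation `u` on an order-`1` stack. -/
inductive PlaceSym (a : ℕ) {j : ℕ} (u : AnnStack n j) : AnnStack n 1 → AnnStack n 1 → Prop
  | place (hj : j ≤ n) (s : AnnStack n 1) : PlaceSym a u s (sym a hj u s)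

/-- Copying the top symbol `a` of the order-`k` stack `s`; the copy is annotated by the stack
obtained from `s` by popping its first element. -/
def CpushTop {k : ℕ} (s t : AnnStack n k) : Prop :=
  ∃ (a j : ℕ) (u : AnnStack n j) (v : AnnStack n k),
    TopSym a u s ∧ PopTop s v ∧ OnTop (PlaceSym a v) s t

/-- Replacing an order-`k` stack by the annotation of its topmost symbol, provided that this
annotation is of order `k`. -/
def CollapseTop {k : ℕ} (s t : AnnStack n k) : Prop :=
  ∃ a : ℕ, TopSym a t s

end AnnStack

/-! ### Operations on stacks and on stack trees -/

inductive StackOp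
  | rew (a b : ℕ)
  | cpush (k : ℕ)
  | push (k : ℕ)
  | pop (k : ℕ)
  | collapse (k : ℕ)

namespace StackOp

/-- Membership in the set of order-`n` stack operations over the alphabet. -/
def Valid (n : ℕ) (alphabet : List ℕ) : StackOp → Prop
  | rew a b => a ∈ alphabet ∧ b ∈ alphabet
  | cpush k => 1 ≤ k ∧ k ≤ n
  | push k => 2 ≤ k ∧ k ≤ n
  | pop k => 1 ≤ k ∧ k ≤ n
  | collapse k => 2 ≤ k ∧ k ≤ n

/-- `o.Step s t`: the operation `o` is defined on the order-`n` stack `s`, with value `t`. -/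
def Step {n : ℕ} : StackOp → AnnStack n n → AnnStack n n → Prop
  | rew a b => AnnStack.OnTop (k := 1) (AnnStack.RewTop a b)
  | cpush k => AnnStack.OnTop (k := k) AnnStack.CpushTop
  | push k => AnnStack.OnTop (k := k) AnnStack.PushTop
  | pop k => AnnStack.OnTop (k := k) AnnStack.PopTop
  | collapse k => AnnStack.OnTop (k := k) AnnStack.CollapseTop

def equivSum : StackOp ≃ (ℕ × ℕ) ⊕ ℕ ⊕ ℕ ⊕ ℕ ⊕ ℕ where
  toFun
    | rew a b => .inl (a, b)
    | cpush k => .inr (.inl k)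
    | push k => .inr (.inr (.inl k))
    | pop k => .inr (.inr (.inr (.inl k)))
    | collapse k => .inr (.inr (.inr (.inr k)))
  invFun
    | .inl (a, b) => rew a b
    | .inr (.inl k) => cpush k
    | .inr (.inr (.inl k)) => push k
    | .inr (.inr (.inr (.inl k))) => pop k
    | .inr (.inr (.inr (.inr k))) => collapse k
  left_inv x := by cases x <;> rfl
  right_inv x := by rcases x with ⟨a, b⟩ | k | k | k | k <;> rfl

instance : Primcodable StackOp := Primcodable.ofEquiv _ equivSum

end StackOp

/-- `sop p o p'` applies the stack operation `o` at a leaf, changing its control state from `p` to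
`p'`; `push p ps` creates children of a leaf; `pop ps p` removes all children of a node, which
have to be leaves. -/
inductive TreeOp
  | sop (p : ℕ) (o : StackOp) (p' : ℕ)
  | push (p : ℕ) (ps : List ℕ)
  | pop (ps : List ℕ) (p : ℕ)

namespace TreeOp

/-- Membership in the set of order-`n` stack tree operations. -/
def Valid (n : ℕ) (alphabet controls : List ℕ) : TreeOp → Prop
  | sop p o p' => p ∈ controls ∧ o.Valid n alphabet ∧ p' ∈ controls
  | push p ps => p ∈ controls ∧ ps ≠ [] ∧ ∀ r ∈ ps, r ∈ controls
  | pop ps p => ps ≠ [] ∧ (∀ r ∈ ps, r ∈ controls) ∧ p ∈ controls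

def equivSum : TreeOp ≃ (ℕ × StackOp × ℕ) ⊕ (ℕ × List ℕ) ⊕ (List ℕ × ℕ) where
  toFun
    | sop p o p' => .inl (p, o, p')
    | push p ps => .inr (.inl (p, ps))
    | pop ps p => .inr (.inr (ps, p))
  invFun
    | .inl (p, o, p') => sop p o p'
    | .inr (.inl (p, ps)) => push p ps
    | .inr (.inr (ps, p)) => pop ps p
  left_inv x := by cases x <;> rfl
  right_inv x := by rcases x with ⟨p, o, q⟩ | ⟨p, ps⟩ | ⟨ps, p⟩ <;> rfl

instance : Primcodable TreeOp := Primcodable.ofEquiv _ equivSum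

end TreeOp

/-! ### Annotated stack trees -/

/-- Order-`n` annotated stack trees: finite ordered trees of arbitrary finite arity whose nodes are
labelled by order-`n` stacks and whose leaves also carry a control state. An internal node has
`m + 1` children, the child with index `i : Fin (m + 1)` being its `(i + 1)`-st child. -/
inductive StackTree (n : ℕ) : Type
  | leaf (p : ℕ) (s : AnnStack n n) : StackTree n
  | node (s : AnnStack n n) (m : ℕ) (ts : Fin (m + 1) → StackTree n) : StackTree n

namespace StackTree

variable {n : ℕ}

/-- The stack labelling the root. -/
def stack : StackTree n → AnnStack n n
  | leaf _ s => s
  | node s _ _ => s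

/-- The tree is over the given stack alphabet and set of control states. -/
def Over (alphabet controls : List ℕ) : StackTree n → Prop
  | leaf p s => p ∈ controls ∧ s.Over alphabet
  | node s _ ts => s.Over alphabet ∧ ∀ i, Over alphabet controls (ts i)

/-- `Step r t t'`: the tree `t'` results from applying `r` somewhere in `t`. -/
inductive Step : TreeOp → StackTree n → StackTree n → Prop
  | sop (p : ℕ) (o : StackOp) (p' : ℕ) {s s' : AnnStack n n} (h : o.Step s s') :
      Step (.sop p o p') (leaf p s) (leaf p' s')
  | push (p m : ℕ) (ps : Fin (m + 1) → ℕ) (s : AnnStack n n) :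
      Step (.push p (List.ofFn ps)) (leaf p s) (node s m fun i => leaf (ps i) s)
  | pop (m : ℕ) (ps : Fin (m + 1) → ℕ) (p : ℕ) (s : AnnStack n n)
      (ss : Fin (m + 1) → AnnStack n n) :
      Step (.pop (List.ofFn ps) p) (node s m fun i => leaf (ps i) (ss i)) (leaf p s)
  | child {r : TreeOp} (s : AnnStack n n) (m : ℕ) (ts : Fin (m + 1) → StackTree n)
      (i : Fin (m + 1)) {t' : StackTree n} (h : Step r (ts i) t') :
      Step r (node s m ts) (node s m (Function.update ts i t'))

end StackTree

/-! ### Annotated stack tree automata -/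

/-- An annotated stack tree automaton.
* `treeStates` is the set `Q` of tree states and `treeFinals` the set of final tree states.
* `(q, i, m, q', x) ∈ treeTrans`: the `i`-th of `m` children, labelled by `q'` and carrying a stack
  accepted from the stack state `x`, gives its parent the label `q`.
* `(k, x) ∈ stackStates`: `x` is an order-`k` stack state; similarly for `stackFinals`. States of
  different orders are distinct objects, even if they have the same number.
* `(k, x, x', X) ∈ stackTrans` is an order-`k` transition, `k ≥ 2`, with `x`, `X` of order `k` and
  `x'` of order `k - 1`.
* `(x, a, (k, B), X) ∈ symTrans` is an order-`1` transition on `a`, where `B` is a set of order-`k`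
  states for the annotation and `X` a set of order-`1` states. -/
structure StackTreeAutomaton where
  treeStates : List ℕ
  treeTrans : List (ℕ × ℕ × ℕ × ℕ × ℕ)
  treeFinals : List ℕ
  stackStates : List (ℕ × ℕ)
  stackTrans : List (ℕ × ℕ × ℕ × List ℕ)
  symTrans : List (ℕ × ℕ × (ℕ × List ℕ) × List ℕ)
  stackFinals : List (ℕ × ℕ)

namespace StackTreeAutomaton

/-- `A` is an order-`n` annotated stack tree automaton over the given alphabet and control
states. -/
structure Valid (n : ℕ) (alphabet controls : List ℕ) (A : StackTreeAutomaton) : Prop where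
  controls_subset : ∀ p ∈ controls, p ∈ A.treeStates
  treeFinals_subset : ∀ q ∈ A.treeFinals, q ∈ A.treeStates
  treeTrans_mem : ∀ q i m q' x, (q, i, m, q', x) ∈ A.treeTrans →
    q ∈ A.treeStates ∧ 1 ≤ i ∧ i ≤ m ∧ q' ∈ A.treeStates ∧ q' ∉ A.treeFinals ∧
      (n, x) ∈ A.stackStates
  stackStates_order : ∀ k x, (k, x) ∈ A.stackStates → 1 ≤ k ∧ k ≤ n
  stackFinals_subset : ∀ y ∈ A.stackFinals, y ∈ A.stackStates
  stackTrans_mem : ∀ k x x' X, (k, x, x', X) ∈ A.stackTrans →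
    2 ≤ k ∧ k ≤ n ∧ (k, x) ∈ A.stackStates ∧ (k - 1, x') ∈ A.stackStates ∧
      ∀ y ∈ X, (k, y) ∈ A.stackStates
  symTrans_mem : ∀ x a k B X, (x, a, (k, B), X) ∈ A.symTrans →
    (1, x) ∈ A.stackStates ∧ a ∈ alphabet ∧ 1 ≤ k ∧ k ≤ n ∧
      (∀ y ∈ B, (k, y) ∈ A.stackStates) ∧ ∀ y ∈ X, (1, y) ∈ A.stackStates

variable {n : ℕ}

/-- `A.AcceptsStack s x`: the order-`k` stack `s` is accepted from the order-`k` state `x`.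
A set of states accepts a stack if each of its elements does. -/
def AcceptsStack (A : StackTreeAutomaton) : {k : ℕ} → AnnStack n k → ℕ → Prop
  | _, .empty k, x => (k + 1, x) ∈ A.stackFinals
  | _, .sym (j := j) a _ ann s, x => ∃ k B X, (x, a, (k, B), X) ∈ A.symTrans ∧
      (∀ y ∈ B, j = k ∧ A.AcceptsStack ann y) ∧ ∀ y ∈ X, A.AcceptsStack s y
  | _, .cons (k := k) top s, x => ∃ x' X, (k + 2, x, x', X) ∈ A.stackTrans ∧
      A.AcceptsStack top x' ∧ ∀ y ∈ X, A.AcceptsStack s y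

/-- `A.Labels t q`: some run of `A` on the tree `t` labels the root by `q`, where leaves are
labelled by their control states. -/
def Labels (A : StackTreeAutomaton) : StackTree n → ℕ → Prop
  | .leaf p _, q => q = p
  | .node _ m ts, q => ∀ i : Fin (m + 1), ∃ q' x, (q, i.val + 1, m + 1, q', x) ∈ A.treeTrans ∧
      A.Labels (ts i) q' ∧ A.AcceptsStack (ts i).stack x

/-- The set of stack trees over the given alphabet and control states accepted by `A`. -/
def lang (A : StackTreeAutomaton) (alphabet controls : List ℕ) : Set (StackTree n) :=
  {t | t.Over alphabet controls ∧ ∃ qf q x, qf ∈ A.treeFinals ∧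
    (qf, 1, 1, q, x) ∈ A.treeTrans ∧ A.Labels t q ∧ A.AcceptsStack t.stack x}

def equivProd : StackTreeAutomaton ≃
    List ℕ × List (ℕ × ℕ × ℕ × ℕ × ℕ) × List ℕ × List (ℕ × ℕ) × List (ℕ × ℕ × ℕ × List ℕ) ×
      List (ℕ × ℕ × (ℕ × List ℕ) × List ℕ) × List (ℕ × ℕ) where
  toFun A := (A.treeStates, A.treeTrans, A.treeFinals, A.stackStates, A.stackTrans, A.symTrans,
    A.stackFinals)
  invFun x := ⟨x.1, x.2.1, x.2.2.1, x.2.2.2.1, x.2.2.2.2.1, x.2.2.2.2.2.1, x.2.2.2.2.2.2⟩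
  left_inv _ := rfl
  right_inv _ := rfl

instance : Primcodable StackTreeAutomaton := Primcodable.ofEquiv _ equivProd

end StackTreeAutomaton

/-! ### Ground annotated stack tree rewrite systems with global state -/

/-- An order-`order` system; `(g, r, g') ∈ rules` applies the tree operation `r` and changes the
global state from `g` to `g'`. -/
structure GASTRS where
  order : ℕ
  alphabet : List ℕ
  controls : List ℕ
  globals : List ℕ
  rules : List (ℕ × TreeOp × ℕ)

namespace GASTRS

structure Valid (S : GASTRS) : Prop where
  one_le_order : 1 ≤ S.order
  rules_mem : ∀ g r g', (g, r, g') ∈ S.rules →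
    g ∈ S.globals ∧ r.Valid S.order S.alphabet S.controls ∧ g' ∈ S.globals

def equivProd : GASTRS ≃ ℕ × List ℕ × List ℕ × List ℕ × List (ℕ × TreeOp × ℕ) where
  toFun S := (S.order, S.alphabet, S.controls, S.globals, S.rules)
  invFun x := ⟨x.1, x.2.1, x.2.2.1, x.2.2.2.1, x.2.2.2.2⟩
  left_inv _ := rfl
  right_inv _ := rfl

instance : Primcodable GASTRS := Primcodable.ofEquiv _ equivProd

/-- One transition between configurations, a configuration being a global state with a tree. -/
def Tran (S : GASTRS) (c c' : ℕ × StackTree S.order) : Prop :=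
  ∃ r, (c.1, r, c'.1) ∈ S.rules ∧ StackTree.Step r c.2 c'.2

/-- `S.Run m c c'`: there is a run from `c` to `c'` with exactly `m` transitions that change the
global state. -/
inductive Run (S : GASTRS) : ℕ → ℕ × StackTree S.order → ℕ × StackTree S.order → Prop
  | refl (c : ℕ × StackTree S.order) : Run S 0 c c
  | step {m : ℕ} {c c' c'' : ℕ × StackTree S.order} (h : S.Tran c c') (hr : Run S m c' c'') :
      Run S (if c.1 = c'.1 then m else m + 1) c c''

/-- `targets` lists exactly one target automaton for each global state. -/
structure IsTargetFamily (S : GASTRS) (targets : List (ℕ × StackTreeAutomaton)) : Prop where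
  nodup : (targets.map Prod.fst).Nodup
  mem_iff : ∀ g, g ∈ targets.map Prod.fst ↔ g ∈ S.globals
  valid : ∀ g A, (g, A) ∈ targets → A.Valid S.order S.alphabet S.controls

/-- The trees `t` such that a run from `(g, t)` with at most `b` changes of global state reaches a
configuration `(g', t')` whose tree is accepted by the target automaton of `g'`. -/
def contextBoundedPre (S : GASTRS) (targets : List (ℕ × StackTreeAutomaton)) (b g : ℕ) :
    Set (StackTree S.order) :=
  {t | t.Over S.alphabet S.controls ∧ ∃ m g' t' A', m ≤ b ∧ S.Run m (g, t) (g', t') ∧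
    (g', A') ∈ targets ∧ t' ∈ A'.lang S.alphabet S.controls}

end GASTRS

/-!
The algorithm computes, for `k = 1, …, b + 1`, an automaton for each global state `g` that accepts
the trees from which a run with fewer than `k` changes of global state reaches a target. Such a run
stays in `g` for a while and then either stops or changes to some `g'` by one rule and goes on with
one change fewer (`GASTRS.run_iff`). So it suffices to treat one round: given tree operations
`locals`, an automaton `target` and finitely many pairs `(r, W)` of a tree operation and an
automaton, find an automaton for the trees from which local operations lead into `target`, or into
a tree that `r` turns into a tree accepted by `W` (`Round.mem_lang_automaton`).

*Trees.* Local operations in different subtrees are independent, and a subtree interacts with the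
rest of the tree only when it has shrunk to a leaf. A tree state of the new automaton therefore
records what local operations, together with at most one application of `r` inside a prescribed
child, should make of a tree (`Label`). What is left is a question about the stack at a leaf with
control state `p` in a given context. These questions become additional stack states of order `n`,
one for each context and control state, and the tree operations become rules between them:
applying a stack operation is an edge, creating children is an alternating rule asking for all the
children to be accepted, and removing children is a transition to a node labelled by the required
control states, whose stack has to satisfy the question for the resulting leaf. The soundness of
these rules is `Round.stateSem_of_acc` and `Round.ctxSem_node`; their completeness is
`Round.fitsCtx_of_local` for local operations and `Round.fitsCtx_of_shots` for the final one.

*Stacks.* It remains to turn an alternating annotated pushdown system into a plain alternating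
automaton (`AltSystem.saturate`). For a state `x` of order `k + 1` and a set `X` of such states, let
the quotient `x / X` be a state of order `k` that holds of `u` if `x` holds of `u : s` whenever all
of `X` hold of `s`. There are finitely many quotients, and the transition `(x, x / X, X)` is
obviously sound. Each rule for stacks of order `k + 1` translates into rules of the same kind for
stacks of order `k` (`Layer.next`), with two new kinds for `collapse` and `cpush`, which refer to
the annotation of the top symbol. At order `1` there are finitely many candidates for transitions,
and the valid ones are derived by a least fixed point, as are the accepting states. The rules are
true of the intended meaning of the quotients (`AltSystem.layerSound`), which gives soundness
(`AltSystem.sem_of_accepts`). For completeness, the transition to use at `u : s` is the one whose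
set `X` consists of all states that accept `s` (`AltSystem.accepts_cons_iff`); with this choice the
accepted stacks are closed under all the rules (`AltSystem.accepts_of_acc`).

The whole construction consists of bounded list comprehensions and iterations, so that it is even
primitive recursive.
-/

open Encodable

/-! ### Primitive recursive list comprehensions -/

-- The composition lemmas below are stated for pointwise applications, so that `fun_prop` can prove
-- that an explicit list comprehension is primitive recursive by following its syntax.
attribute [fun_prop] Primrec Primrec.id Primrec.const Primrec.comp

namespace Primrec

variable {α β γ : Type*} [Primcodable α] [Primcodable β] [Primcodable γ]

@[fun_prop]
theorem fst_fun : Primrec fun p : α × β => p.1 := Primrec.fst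

@[fun_prop]
theorem snd_fun : Primrec fun p : α × β => p.2 := Primrec.snd

@[fun_prop]
theorem pair_fun {f : α → β} {g : α → γ} (hf : Primrec f) (hg : Primrec g) :
    Primrec fun a => (f a, g a) := hf.pair hg

@[fun_prop]
theorem inl_fun {f : α → β} (hf : Primrec f) : Primrec fun a => (Sum.inl (f a) : β ⊕ γ) :=
  Primrec.sumInl.comp hf

@[fun_prop]
theorem inr_fun {f : α → γ} (hf : Primrec f) : Primrec fun a => (Sum.inr (f a) : β ⊕ γ) :=
  Primrec.sumInr.comp hf

@[fun_prop]
theorem encode_fun {f : α → β} (hf : Primrec f) : Primrec fun a => encode (f a) :=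
  Primrec.encode.comp hf

@[fun_prop]
theorem add_fun {f g : α → ℕ} (hf : Primrec f) (hg : Primrec g) : Primrec fun a => f a + g a :=
  Primrec.nat_add.comp hf hg

@[fun_prop]
theorem sub_fun {f g : α → ℕ} (hf : Primrec f) (hg : Primrec g) : Primrec fun a => f a - g a :=
  Primrec.nat_sub.comp hf hg

@[fun_prop]
theorem and_fun {f g : α → Bool} (hf : Primrec f) (hg : Primrec g) :
    Primrec fun a => f a && g a := Primrec.and.comp hf hg

@[fun_prop]
theorem or_fun {f g : α → Bool} (hf : Primrec f) (hg : Primrec g) :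
    Primrec fun a => f a || g a := Primrec.or.comp hf hg

@[fun_prop]
theorem not_fun {f : α → Bool} (hf : Primrec f) : Primrec fun a => !f a := Primrec.not.comp hf

@[fun_prop]
theorem beq_fun [BEq β] [LawfulBEq β] {f g : α → β} (hf : Primrec f) (hg : Primrec g) :
    Primrec fun a => f a == g a :=
  (Primrec.beq.comp (Primrec.encode.comp hf) (Primrec.encode.comp hg)).of_eq fun a => by
    rw [Bool.eq_iff_iff]; simp [Encodable.encode_inj]

@[fun_prop]
theorem blt_fun {f g : α → ℕ} (hf : Primrec f) (hg : Primrec g) :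
    Primrec fun a => decide (f a < g a) :=
  (primrecRel_iff_primrec_decide.1 Primrec.nat_lt).comp hf hg

@[fun_prop]
theorem cons_fun {f : α → β} {g : α → List β} (hf : Primrec f) (hg : Primrec g) :
    Primrec fun a => f a :: g a := Primrec.list_cons.comp hf hg

@[fun_prop]
theorem append_fun {f g : α → List β} (hf : Primrec f) (hg : Primrec g) :
    Primrec fun a => f a ++ g a := Primrec.list_append.comp hf hg

@[fun_prop]
theorem range_fun {f : α → ℕ} (hf : Primrec f) : Primrec fun a => List.range (f a) :=
  Primrec.list_range.comp hf

@[fun_prop]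
theorem length_fun {f : α → List β} (hf : Primrec f) : Primrec fun a => (f a).length :=
  Primrec.list_length.comp hf

@[fun_prop]
theorem headI_fun [Inhabited β] {f : α → List β} (hf : Primrec f) :
    Primrec fun a => (f a).headI :=
  Primrec.list_headI.comp hf

@[fun_prop]
theorem getI_fun [Inhabited β] {f : α → List β} {g : α → ℕ} (hf : Primrec f) (hg : Primrec g) :
    Primrec fun a => (f a).getI (g a) :=
  Primrec.list_getI.comp hf hg

@[fun_prop]
theorem map_fun {f : α → List β} {g : α → β → γ} (hf : Primrec f)
    (hg : Primrec fun p : α × β => g p.1 p.2) : Primrec fun a => (f a).map (g a) :=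
  Primrec.list_map hf hg

@[fun_prop]
theorem flatMap_fun {f : α → List β} {g : α → β → List γ} (hf : Primrec f)
    (hg : Primrec fun p : α × β => g p.1 p.2) : Primrec fun a => (f a).flatMap (g a) :=
  Primrec.list_flatMap hf hg

@[fun_prop]
theorem foldr_fun {f : α → List β} {g : α → γ} {h : α → β → γ → γ} (hf : Primrec f)
    (hg : Primrec g) (hh : Primrec fun p : α × β × γ => h p.1 p.2.1 p.2.2) :
    Primrec fun a => (f a).foldr (h a) (g a) :=
  Primrec.list_foldr (h := fun a p => h a p.1 p.2) hf hg hh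

@[fun_prop]
theorem iterate_fun {f : α → ℕ} {g : α → β} {h : α → β → β} (hf : Primrec f) (hg : Primrec g)
    (hh : Primrec fun p : α × β => h p.1 p.2) : Primrec fun a => (h a)^[f a] (g a) :=
  Primrec.nat_iterate hf hg hh

@[fun_prop]
theorem natRec_fun {f : α → ℕ} {g : α → β} {h : α → ℕ → β → β} (hf : Primrec f) (hg : Primrec g)
    (hh : Primrec fun p : α × ℕ × β => h p.1 p.2.1 p.2.2) :
    Primrec fun a => (Nat.rec (g a) (h a) (f a) : β) :=
  Primrec.nat_rec' (h := fun a p => h a p.1 p.2) hf hg hh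

@[fun_prop]
theorem any_fun {f : α → List β} {g : α → β → Bool} (hf : Primrec f)
    (hg : Primrec fun p : α × β => g p.1 p.2) : Primrec fun a => (f a).any (g a) := by
  have : Primrec fun a => (f a).foldr (fun b s => g a b || s) false :=
    foldr_fun hf (Primrec.const _) (Primrec.or.comp
      (hg.comp (Primrec.fst.pair (Primrec.fst.comp Primrec.snd))) (Primrec.snd.comp Primrec.snd))
  refine this.of_eq fun a => ?_
  induction f a <;> simp_all

@[fun_prop]
theorem all_fun {f : α → List β} {g : α → β → Bool} (hf : Primrec f)
    (hg : Primrec fun p : α × β => g p.1 p.2) : Primrec fun a => (f a).all (g a) := by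
  have : Primrec fun a => (f a).foldr (fun b s => g a b && s) true :=
    foldr_fun hf (Primrec.const _) (Primrec.and.comp
      (hg.comp (Primrec.fst.pair (Primrec.fst.comp Primrec.snd))) (Primrec.snd.comp Primrec.snd))
  refine this.of_eq fun a => ?_
  induction f a <;> simp_all

@[fun_prop]
theorem filter_fun {f : α → List β} {g : α → β → Bool} (hf : Primrec f)
    (hg : Primrec fun p : α × β => g p.1 p.2) : Primrec fun a => (f a).filter (g a) := by
  have : Primrec fun a => (f a).flatMap fun b => bif g a b then [b] else [] :=
    Primrec.list_flatMap hf (Primrec.cond hg (by fun_prop) (by fun_prop))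
  refine this.of_eq fun a => ?_
  induction f a with
  | nil => rfl
  | cons b l ih => by_cases h : g a b <;> simp [h, ih]

@[fun_prop]
theorem isEmpty_fun {f : α → List β} (hf : Primrec f) : Primrec fun a => (f a).isEmpty := by
  refine (all_fun (g := fun _ _ => false) hf (by fun_prop)).of_eq fun a => ?_
  cases f a <;> simp

@[fun_prop]
theorem contains_fun [BEq β] [LawfulBEq β] {f : α → List β} {g : α → β} (hf : Primrec f)
    (hg : Primrec g) : Primrec fun a => (f a).contains (g a) := by
  refine (any_fun (g := fun a b => g a == b) hf (by fun_prop)).of_eq fun a => ?_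
  rw [List.contains_eq_any_beq]

end Primrec

/-! ### Subsets and least fixed points of lists -/

section ListFixpoint

/-- Boolean test for inclusion of lists. -/
def subsetB (X Y : List ℕ) : Bool := X.all fun x => Y.contains x

@[simp]
theorem subsetB_iff {X Y : List ℕ} : subsetB X Y = true ↔ X ⊆ Y := by
  simp [subsetB, List.subset_def]

/-- The sublists of a list, in a form for which primitive recursiveness is immediate. -/
def subs (l : List ℕ) : List (List ℕ) := l.foldr (fun a P => P ++ P.map fun X => a :: X) [[]]

theorem subset_of_mem_subs {l X : List ℕ} (h : X ∈ subs l) : X ⊆ l := by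
  induction l generalizing X with
  | nil => simp_all [subs]
  | cons a l ih =>
    simp only [subs, List.foldr_cons, List.mem_append, List.mem_map] at h
    rcases h with h | ⟨Y, h, rfl⟩
    · exact fun x hx => List.mem_cons_of_mem _ (ih h hx)
    · exact List.cons_subset_cons _ (ih h)

theorem filter_mem_subs (l : List ℕ) (p : ℕ → Bool) : l.filter p ∈ subs l := by
  induction l with
  | nil => simp [subs]
  | cons a l ih =>
    simp only [subs, List.foldr_cons, List.mem_append, List.mem_map]
    by_cases h : p a
    · exact .inr ⟨_, ih, by simp [h]⟩
    · exact .inl (by simpa [subs, h] using ih)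

variable {δ : Type*}

/-- The least subset of the candidates `D` that contains each candidate `t` with `Φ T t` for some
set `T` of its elements: iterating as often as there are candidates suffices. -/
def lfp (D : List δ) (Φ : List δ → δ → Bool) : List δ := (fun T => D.filter (Φ T))^[D.length] []

theorem lfp_induction {D : List δ} {Φ : List δ → δ → Bool} {P : δ → Prop}
    (h : ∀ T, T ⊆ D → ∀ t ∈ D, (∀ t' ∈ T, P t') → Φ T t = true → P t) : ∀ t ∈ lfp D Φ, P t := by
  have (i : ℕ) : (fun T => D.filter (Φ T))^[i] [] ⊆ D ∧
      ∀ t ∈ (fun T => D.filter (Φ T))^[i] [], P t := by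
    induction i with
    | zero => simp
    | succ i ih =>
      rw [Function.iterate_succ_apply']
      refine ⟨List.filter_sublist.subset, fun t ht => ?_⟩
      rw [List.mem_filter] at ht
      exact h _ ih.1 t ht.1 ih.2 ht.2
  exact (this _).2

theorem lfp_subset {D : List δ} {Φ : List δ → δ → Bool} {t : δ} (h : t ∈ lfp D Φ) : t ∈ D :=
  lfp_induction (P := (· ∈ D)) (fun _ _ _ ht _ _ => ht) t h

/-- The iteration has stabilised after `D.length` steps, since each step before stabilisation
makes the list of derived candidates longer. -/
theorem mem_lfp {D : List δ} {Φ : List δ → δ → Bool}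
    (mono : ∀ T T' t, T ⊆ T' → Φ T t = true → Φ T' t = true) {t : δ} (ht : t ∈ D)
    (h : Φ (lfp D Φ) t = true) : t ∈ lfp D Φ := by
  set G : List δ → List δ := fun T => D.filter (Φ T) with hG
  have hmono : ∀ T T', T ⊆ T' → (G T).Sublist (G T') := fun T T' h =>
    List.monotone_filter_right _ fun x hx => mono _ _ _ h hx
  have hstep (i : ℕ) : (G^[i] []).Sublist (G^[i + 1] []) := by
    induction i with
    | zero => simp
    | succ i ih =>
      rw [Function.iterate_succ_apply', Function.iterate_succ_apply' G (i + 1)]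
      exact hmono _ _ ih.subset
  have hlen (i : ℕ) : i ≤ (G^[i] []).length ∨ G^[i + 1] [] = G^[i] [] := by
    induction i with
    | zero => simp
    | succ i ih =>
      by_cases heq : G^[i + 1] [] = G^[i] []
      · exact .inr (by rw [Function.iterate_succ_apply', heq, ← Function.iterate_succ_apply' G, heq])
      · left
        have h1 := ih.resolve_right heq
        have h2 := (hstep i).length_le
        have h3 : (G^[i] []).length ≠ (G^[i + 1] []).length := fun e =>
          heq ((hstep i).eq_of_length e).symm
        omega
  have hfix : G^[D.length + 1] [] = G^[D.length] [] := by
    rcases hlen D.length with h | h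
    · refine ((hstep _).eq_of_length (le_antisymm (hstep _).length_le ?_)).symm
      refine le_trans ?_ h
      rw [Function.iterate_succ_apply']
      exact List.length_filter_le _ _
    · exact h
  rw [lfp, ← hG] at h ⊢
  rw [← hfix, Function.iterate_succ_apply']
  exact List.mem_filter.2 ⟨ht, h⟩

variable {α : Type*} [Primcodable α] [Primcodable δ]

@[fun_prop]
theorem primrec_subsetB {f g : α → List ℕ} (hf : Primrec f) (hg : Primrec g) :
    Primrec fun a => subsetB (f a) (g a) := by
  unfold subsetB; fun_prop

@[fun_prop]
theorem primrec_subs {f : α → List ℕ} (hf : Primrec f) : Primrec fun a => subs (f a) := by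
  unfold subs; fun_prop

@[fun_prop]
theorem primrec_lfp {f : α → List δ} {g : α → List δ → δ → Bool} (hf : Primrec f)
    (hg : Primrec fun p : α × List δ × δ => g p.1 p.2.1 p.2.2) :
    Primrec fun a => lfp (f a) (g a) := by
  have hg' : Primrec fun p : (α × List δ) × δ => g p.1.1 p.1.2 p.2 :=
    hg.comp (f := fun p : α × List δ × δ => g p.1 p.2.1 p.2.2)
      (g := fun p : (α × List δ) × δ => (p.1.1, p.1.2, p.2)) (by fun_prop)
  unfold lfp; fun_prop

end ListFixpoint

/-! ### Primitive recursive access to operations, automata and systems -/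

namespace StackOp

instance : DecidableEq StackOp := equivSum.injective.decidableEq

/-- The order of the topmost stack that the operation modifies. -/
def level : StackOp → ℕ
  | rew _ _ => 1
  | cpush k => k
  | push k => k
  | pop k => k
  | collapse k => k

variable {α : Type*} [Primcodable α]

@[fun_prop]
theorem primrec_rew {f g : α → ℕ} (hf : Primrec f) (hg : Primrec g) :
    Primrec fun a => rew (f a) (g a) :=
  (Primrec.of_equiv_symm (e := equivSum)).comp (Primrec.sumInl.comp (hf.pair hg))

@[fun_prop]
theorem primrec_cpush {f : α → ℕ} (hf : Primrec f) : Primrec fun a => cpush (f a) :=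
  (Primrec.of_equiv_symm (e := equivSum)).comp (Primrec.sumInr.comp (Primrec.sumInl.comp hf))

@[fun_prop]
theorem primrec_push {f : α → ℕ} (hf : Primrec f) : Primrec fun a => push (f a) :=
  (Primrec.of_equiv_symm (e := equivSum)).comp
    (Primrec.sumInr.comp (Primrec.sumInr.comp (Primrec.sumInl.comp hf)))

@[fun_prop]
theorem primrec_pop {f : α → ℕ} (hf : Primrec f) : Primrec fun a => pop (f a) :=
  (Primrec.of_equiv_symm (e := equivSum)).comp
    (Primrec.sumInr.comp (Primrec.sumInr.comp (Primrec.sumInr.comp (Primrec.sumInl.comp hf))))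

@[fun_prop]
theorem primrec_collapse {f : α → ℕ} (hf : Primrec f) : Primrec fun a => collapse (f a) :=
  (Primrec.of_equiv_symm (e := equivSum)).comp
    (Primrec.sumInr.comp (Primrec.sumInr.comp (Primrec.sumInr.comp (Primrec.sumInr.comp hf))))

@[fun_prop]
theorem primrec_level {f : α → StackOp} (hf : Primrec f) : Primrec fun a => (f a).level := by
  have h : Primrec fun o : StackOp => Sum.casesOn (motive := fun _ => ℕ) (equivSum o)
      (fun _ => 1) fun o => Sum.casesOn (motive := fun _ => ℕ) o id fun o =>
        Sum.casesOn (motive := fun _ => ℕ) o id fun o =>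
          Sum.casesOn (motive := fun _ => ℕ) o id id := by
    refine Primrec.sumCasesOn (Primrec.of_equiv (e := equivSum)) (Primrec.const 1).to₂ ?_
    refine Primrec.sumCasesOn Primrec.snd Primrec.snd.to₂ ?_
    refine Primrec.sumCasesOn Primrec.snd Primrec.snd.to₂ ?_
    exact Primrec.sumCasesOn Primrec.snd Primrec.snd.to₂ Primrec.snd.to₂
  refine (h.comp hf).of_eq fun a => ?_
  cases f a <;> rfl

end StackOp

namespace TreeOp

/-- The data of a stack operation at a leaf, as a list with at most one element. -/
def sopData : TreeOp → List (ℕ × StackOp × ℕ)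
  | sop p o p' => [(p, o, p')]
  | push _ _ => []
  | pop _ _ => []

/-- The data of an operation creating children, as a list with at most one element. -/
def pushData : TreeOp → List (ℕ × List ℕ)
  | sop _ _ _ => []
  | push p ps => [(p, ps)]
  | pop _ _ => []

/-- The data of an operation removing children, as a list with at most one element. -/
def popData : TreeOp → List (List ℕ × ℕ)
  | sop _ _ _ => []
  | push _ _ => []
  | pop ps p => [(ps, p)]

@[simp]
theorem mem_sopData {r : TreeOp} {x : ℕ × StackOp × ℕ} :
    x ∈ r.sopData ↔ r = sop x.1 x.2.1 x.2.2 := by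
  cases r <;> simp [sopData, Prod.ext_iff, eq_comm]

@[simp]
theorem mem_pushData {r : TreeOp} {x : ℕ × List ℕ} : x ∈ r.pushData ↔ r = push x.1 x.2 := by
  cases r <;> simp [pushData, Prod.ext_iff, eq_comm]

@[simp]
theorem mem_popData {r : TreeOp} {x : List ℕ × ℕ} : x ∈ r.popData ↔ r = pop x.1 x.2 := by
  cases r <;> simp [popData, Prod.ext_iff, eq_comm]

variable {α : Type*} [Primcodable α]

@[fun_prop]
theorem primrec_sopData {f : α → TreeOp} (hf : Primrec f) : Primrec fun a => (f a).sopData := by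
  have h : Primrec fun o : TreeOp => Sum.casesOn (motive := fun _ => List (ℕ × StackOp × ℕ))
      (equivSum o) (fun x => [x]) fun _ => [] :=
    Primrec.sumCasesOn (Primrec.of_equiv (e := equivSum))
      (Primrec.list_cons.comp Primrec.snd (Primrec.const [])).to₂ (Primrec.const _).to₂
  refine (h.comp hf).of_eq fun a => ?_
  cases f a <;> rfl

@[fun_prop]
theorem primrec_pushData {f : α → TreeOp} (hf : Primrec f) : Primrec fun a => (f a).pushData := by
  have h : Primrec fun o : TreeOp => Sum.casesOn (motive := fun _ => List (ℕ × List ℕ))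
      (equivSum o) (fun _ => []) fun o => Sum.casesOn (motive := fun _ => List (ℕ × List ℕ)) o
        (fun x => [x]) fun _ => [] :=
    Primrec.sumCasesOn (Primrec.of_equiv (e := equivSum)) (Primrec.const _).to₂
      (Primrec.sumCasesOn Primrec.snd
        (Primrec.list_cons.comp Primrec.snd (Primrec.const [])).to₂ (Primrec.const _).to₂)
  refine (h.comp hf).of_eq fun a => ?_
  cases f a <;> rfl

@[fun_prop]
theorem primrec_popData {f : α → TreeOp} (hf : Primrec f) : Primrec fun a => (f a).popData := by
  have h : Primrec fun o : TreeOp => Sum.casesOn (motive := fun _ => List (List ℕ × ℕ))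
      (equivSum o) (fun _ => []) fun o => Sum.casesOn (motive := fun _ => List (List ℕ × ℕ)) o
        (fun _ => []) fun x => [x] :=
    Primrec.sumCasesOn (Primrec.of_equiv (e := equivSum)) (Primrec.const _).to₂
      (Primrec.sumCasesOn Primrec.snd (Primrec.const _).to₂
        (Primrec.list_cons.comp Primrec.snd (Primrec.const [])).to₂)
  refine (h.comp hf).of_eq fun a => ?_
  cases f a <;> rfl

end TreeOp

namespace StackTreeAutomaton

variable {α : Type*} [Primcodable α] {f : α → StackTreeAutomaton}

theorem primrec_equivProd : Primrec equivProd := Primrec.of_equiv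

@[fun_prop]
theorem primrec_treeStates (hf : Primrec f) : Primrec fun a => (f a).treeStates :=
  (by fun_prop : Primrec fun x : List ℕ × List (ℕ × ℕ × ℕ × ℕ × ℕ) × List ℕ × List (ℕ × ℕ) ×
    List (ℕ × ℕ × ℕ × List ℕ) × List (ℕ × ℕ × (ℕ × List ℕ) × List ℕ) × List (ℕ × ℕ) => x.1).comp
    (primrec_equivProd.comp hf)

@[fun_prop]
theorem primrec_treeTrans (hf : Primrec f) : Primrec fun a => (f a).treeTrans :=
  (by fun_prop : Primrec fun x : List ℕ × List (ℕ × ℕ × ℕ × ℕ × ℕ) × List ℕ × List (ℕ × ℕ) ×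
    List (ℕ × ℕ × ℕ × List ℕ) × List (ℕ × ℕ × (ℕ × List ℕ) × List ℕ) × List (ℕ × ℕ) => x.2.1).comp
    (primrec_equivProd.comp hf)

@[fun_prop]
theorem primrec_treeFinals (hf : Primrec f) : Primrec fun a => (f a).treeFinals :=
  (by fun_prop : Primrec fun x : List ℕ × List (ℕ × ℕ × ℕ × ℕ × ℕ) × List ℕ × List (ℕ × ℕ) ×
    List (ℕ × ℕ × ℕ × List ℕ) × List (ℕ × ℕ × (ℕ × List ℕ) × List ℕ) × List (ℕ × ℕ) =>
      x.2.2.1).comp (primrec_equivProd.comp hf)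

@[fun_prop]
theorem primrec_stackStates (hf : Primrec f) : Primrec fun a => (f a).stackStates :=
  (by fun_prop : Primrec fun x : List ℕ × List (ℕ × ℕ × ℕ × ℕ × ℕ) × List ℕ × List (ℕ × ℕ) ×
    List (ℕ × ℕ × ℕ × List ℕ) × List (ℕ × ℕ × (ℕ × List ℕ) × List ℕ) × List (ℕ × ℕ) =>
      x.2.2.2.1).comp (primrec_equivProd.comp hf)

@[fun_prop]
theorem primrec_stackTrans (hf : Primrec f) : Primrec fun a => (f a).stackTrans :=
  (by fun_prop : Primrec fun x : List ℕ × List (ℕ × ℕ × ℕ × ℕ × ℕ) × List ℕ × List (ℕ × ℕ) ×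
    List (ℕ × ℕ × ℕ × List ℕ) × List (ℕ × ℕ × (ℕ × List ℕ) × List ℕ) × List (ℕ × ℕ) =>
      x.2.2.2.2.1).comp (primrec_equivProd.comp hf)

@[fun_prop]
theorem primrec_symTrans (hf : Primrec f) : Primrec fun a => (f a).symTrans :=
  (by fun_prop : Primrec fun x : List ℕ × List (ℕ × ℕ × ℕ × ℕ × ℕ) × List ℕ × List (ℕ × ℕ) ×
    List (ℕ × ℕ × ℕ × List ℕ) × List (ℕ × ℕ × (ℕ × List ℕ) × List ℕ) × List (ℕ × ℕ) =>
      x.2.2.2.2.2.1).comp (primrec_equivProd.comp hf)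

@[fun_prop]
theorem primrec_stackFinals (hf : Primrec f) : Primrec fun a => (f a).stackFinals :=
  (by fun_prop : Primrec fun x : List ℕ × List (ℕ × ℕ × ℕ × ℕ × ℕ) × List ℕ × List (ℕ × ℕ) ×
    List (ℕ × ℕ × ℕ × List ℕ) × List (ℕ × ℕ × (ℕ × List ℕ) × List ℕ) × List (ℕ × ℕ) =>
      x.2.2.2.2.2.2).comp (primrec_equivProd.comp hf)

@[fun_prop]
theorem primrec_mk {f₁ f₃ : α → List ℕ} {f₂ : α → List (ℕ × ℕ × ℕ × ℕ × ℕ)}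
    {f₄ f₇ : α → List (ℕ × ℕ)} {f₅ : α → List (ℕ × ℕ × ℕ × List ℕ)}
    {f₆ : α → List (ℕ × ℕ × (ℕ × List ℕ) × List ℕ)} (h₁ : Primrec f₁) (h₂ : Primrec f₂)
    (h₃ : Primrec f₃) (h₄ : Primrec f₄) (h₅ : Primrec f₅) (h₆ : Primrec f₆) (h₇ : Primrec f₇) :
    Primrec fun a => StackTreeAutomaton.mk (f₁ a) (f₂ a) (f₃ a) (f₄ a) (f₅ a) (f₆ a) (f₇ a) :=
  (Primrec.of_equiv_symm (e := equivProd)).comp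
    (by fun_prop : Primrec fun a => (f₁ a, f₂ a, f₃ a, f₄ a, f₅ a, f₆ a, f₇ a))

end StackTreeAutomaton

namespace GASTRS

variable {α : Type*} [Primcodable α] {f : α → GASTRS}

theorem primrec_equivProd : Primrec equivProd := Primrec.of_equiv

@[fun_prop]
theorem primrec_order (hf : Primrec f) : Primrec fun a => (f a).order :=
  Primrec.fst.comp (primrec_equivProd.comp hf)

@[fun_prop]
theorem primrec_alphabet (hf : Primrec f) : Primrec fun a => (f a).alphabet :=
  (Primrec.fst.comp Primrec.snd).comp (primrec_equivProd.comp hf)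

@[fun_prop]
theorem primrec_controls (hf : Primrec f) : Primrec fun a => (f a).controls :=
  (Primrec.fst.comp (Primrec.snd.comp Primrec.snd)).comp (primrec_equivProd.comp hf)

@[fun_prop]
theorem primrec_rules (hf : Primrec f) : Primrec fun a => (f a).rules :=
  (Primrec.snd.comp (Primrec.snd.comp (Primrec.snd.comp Primrec.snd))).comp
    (primrec_equivProd.comp hf)

end GASTRS

/-! ### Alternating systems and their layers -/

/-- The state of the constructed automaton that stands for the state `b` of the given one. -/
def baseCode (b : ℕ) : ℕ := encode (Sum.inl b : ℕ ⊕ ℕ × List ℕ)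

/-- The code of the quotient state `x / X`: if `x` has order `k + 1` and `X` is a set of states of
order `k + 1`, then `x / X` has order `k` and stands for the stacks `u` such that `x` holds of
`u : s` whenever all states of `X` hold of `s`. -/
def quotCode (x : ℕ) (X : List ℕ) : ℕ := encode (Sum.inr (x, X) : ℕ ⊕ ℕ × List ℕ)

@[simp]
theorem baseCode_inj {b c : ℕ} : baseCode b = baseCode c ↔ b = c := by
  simp [baseCode]

@[simp]
theorem quotCode_inj {x y : ℕ} {X Y : List ℕ} :
    quotCode x X = quotCode y Y ↔ x = y ∧ X = Y := by
  simp [quotCode, Encodable.encode_inj]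

@[simp]
theorem baseCode_ne_quotCode {b x : ℕ} {X : List ℕ} : baseCode b ≠ quotCode x X := by
  simp only [baseCode, quotCode, ne_eq, Encodable.encode_inj, reduceCtorEq, not_false_eq_true]

@[simp]
theorem quotCode_ne_baseCode {b x : ℕ} {X : List ℕ} : quotCode x X ≠ baseCode b :=
  baseCode_ne_quotCode.symm

/-- An alternating annotated pushdown system on top of an automaton `base`: `(x, Y) ∈ eps` is the
rule that the order-`order` state `x` holds of a stack if all states of `Y` do, and
`(x, o, x') ∈ edges` the rule that `x` holds of a stack if `x'` holds of its image under `o`. -/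
structure AltSystem where
  order : ℕ
  alphabet : List ℕ
  base : StackTreeAutomaton
  eps : List (ℕ × List ℕ)
  edges : List (ℕ × StackOp × ℕ)

/-- The rules that an alternating system induces on stacks of one order.
* `eps` and `edges` are as for alternating systems.
* `(x, k, w) ∈ collapses`: `x` holds of a stack if its topmost annotation has order `k` and
  satisfies `w`.
* `(x, (k, V), x') ∈ cpushes`: `x` holds of a stack if, for each order-`k` stack `v` satisfying
  `V`, the state `x'` holds after placing a copy of the top symbol annotated by `v`. -/
structure Layer where
  states : List ℕ
  eps : List (ℕ × List ℕ)
  edges : List (ℕ × StackOp × ℕ)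
  collapses : List (ℕ × ℕ × ℕ)
  cpushes : List (ℕ × (ℕ × List ℕ) × ℕ)

namespace Layer

/-- The layer for order `k - 1`, given the layer `l` for order `k`. Rules that change only the
first element of an order-`k` stack are passed on to the quotients by a common set; the rules at
order `k` itself (transitions of `base` and the operations of level `k`) become rules on the first
element. -/
def next (base : StackTreeAutomaton) (k : ℕ) (l : Layer) : Layer where
  states := (base.stackStates.filter fun y => y.1 == k - 1).map (fun y => baseCode y.2) ++
    l.states.flatMap fun x => (subs l.states).map fun X => quotCode x X
  eps :=
    (l.eps.flatMap fun e => (subs l.states).map fun X =>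
      (quotCode e.1 X, e.2.map fun y => quotCode y X)) ++
    ((base.stackTrans.filter fun t => t.1 == k).flatMap fun t =>
      ((subs l.states).filter fun X => subsetB (t.2.2.2.map baseCode) X).map fun X =>
        (quotCode (baseCode t.2.1) X, [baseCode t.2.2.1])) ++
    (l.states.flatMap fun x => (subs l.states).flatMap fun X =>
      ((subs l.states).filter fun X' => subsetB X' X).map fun X' =>
        (quotCode x X, [quotCode x X'])) ++
    ((l.edges.filter fun e => e.2.1 == StackOp.pop k).flatMap fun e =>
      ((subs l.states).filter fun X => X.contains e.2.2).map fun X => (quotCode e.1 X, [])) ++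
    ((l.edges.filter fun e => e.2.1 == StackOp.push k).flatMap fun e =>
      (subs l.states).flatMap fun X' => (subs l.states).map fun X =>
        (quotCode e.1 X, quotCode e.2.2 X' :: X'.map fun y => quotCode y X))
  edges := (l.edges.filter fun e => decide (e.2.1.level < k)).flatMap fun e =>
    (subs l.states).map fun X => (quotCode e.1 X, e.2.1, quotCode e.2.2 X)
  collapses :=
    (l.collapses ++ (l.edges.filter fun e => e.2.1 == StackOp.collapse k).map fun e =>
      (e.1, k, e.2.2)).flatMap fun c => (subs l.states).map fun X => (quotCode c.1 X, c.2)
  cpushes :=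
    (l.cpushes.flatMap fun c => (subs l.states).map fun X =>
      (quotCode c.1 X, c.2.1, quotCode c.2.2 X)) ++
    ((l.edges.filter fun e => e.2.1 == StackOp.cpush k).flatMap fun e =>
      (subs l.states).map fun X => (quotCode e.1 X, (k, X), quotCode e.2.2 X))

end Layer

namespace AltSystem

variable (A : AltSystem)

/-- The layer for stacks of order `A.order - d`. -/
def layer (d : ℕ) : Layer :=
  Nat.rec
    { states := (A.base.stackStates.filter fun y => y.1 == A.order).map fun y => baseCode y.2
      eps := A.eps.map fun e => (baseCode e.1, e.2.map baseCode)
      edges := A.edges.map fun e => (baseCode e.1, e.2.1, baseCode e.2.2)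
      collapses := []
      cpushes := [] }
    (fun d l => l.next A.base (A.order - d)) d

/-- The candidates for order-`1` transitions. -/
def symCands : List (ℕ × ℕ × (ℕ × List ℕ) × List ℕ) :=
  (A.layer (A.order - 1)).states.flatMap fun x => A.alphabet.flatMap fun a =>
    (List.range A.order).flatMap fun d => (subs (A.layer d).states).flatMap fun B =>
      (subs (A.layer (A.order - 1)).states).map fun X => (x, a, (A.order - d, B), X)

/-- Whether the order-`1` transition `t` is a weakening of one in `T` or in `base`. The order of the
annotation is irrelevant in a transition that requires nothing of the annotation. -/
def symWeaken (T : List (ℕ × ℕ × (ℕ × List ℕ) × List ℕ)) (t : ℕ × ℕ × (ℕ × List ℕ) × List ℕ) :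
    Bool :=
  ((A.base.symTrans.map fun u =>
    (baseCode u.1, u.2.1, (u.2.2.1.1, u.2.2.1.2.map baseCode), u.2.2.2.map baseCode)) ++ T).any
      (fun u => u.1 == t.1 && u.2.1 == t.2.1 &&
        (u.2.2.1.2.isEmpty || u.2.2.1.1 == t.2.2.1.1) &&
        subsetB u.2.2.1.2 t.2.2.1.2 && subsetB u.2.2.2 t.2.2.2)

/-- Whether the order-`1` transition `t` follows from those in `T` by an `eps` rule, a collapse
rule or a rule of kind `cpushes`. -/
def symLayer (T : List (ℕ × ℕ × (ℕ × List ℕ) × List ℕ)) (t : ℕ × ℕ × (ℕ × List ℕ) × List ℕ) :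
    Bool :=
  (A.layer (A.order - 1)).eps.any (fun e => e.1 == t.1 && e.2.all fun y => T.contains (y, t.2)) ||
  (A.layer (A.order - 1)).collapses.any (fun c => c.1 == t.1 && c.2.1 == t.2.2.1.1 &&
    t.2.2.1.2.contains c.2.2) ||
  (A.layer (A.order - 1)).cpushes.any (fun c => c.1 == t.1 && T.any fun u =>
    u.1 == c.2.2 && u.2.1 == t.2.1 && u.2.2.1 == c.2.1 &&
      u.2.2.2.all fun y => T.contains (y, t.2))

/-- Whether the order-`1` transition `t` follows from those in `T` by an operation of level `1`. -/
def symEdge (T : List (ℕ × ℕ × (ℕ × List ℕ) × List ℕ)) (t : ℕ × ℕ × (ℕ × List ℕ) × List ℕ) :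
    Bool :=
  (A.layer (A.order - 1)).edges.any fun e => e.1 == t.1 &&
    (e.2.1 == StackOp.pop 1 && t.2.2.2.contains e.2.2 ||
    e.2.1 == StackOp.collapse 1 && t.2.2.1.1 == 1 && t.2.2.1.2.contains e.2.2 ||
    (T.any fun u => u.1 == e.2.2 && e.2.1 == StackOp.rew t.2.1 u.2.1 && u.2.2 == t.2.2) ||
    (e.2.1 == StackOp.cpush 1 && T.any fun u => u.1 == e.2.2 && u.2.1 == t.2.1 &&
      u.2.2.1.1 == 1 && subsetB u.2.2.1.2 t.2.2.2 &&
      u.2.2.2.all fun y => T.contains (y, t.2)))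

/-- Whether the order-`1` transition `t` follows in one step from those in `T`. -/
def symStep (T : List (ℕ × ℕ × (ℕ × List ℕ) × List ℕ)) (t : ℕ × ℕ × (ℕ × List ℕ) × List ℕ) :
    Bool :=
  A.symWeaken T t || A.symLayer T t || A.symEdge T t

/-- The stack states of the constructed automaton. -/
def satStates : List (ℕ × ℕ) :=
  (List.range A.order).flatMap fun d => (A.layer d).states.map fun x => (A.order - d, x)

/-- Whether the stack state `t` accepts the empty stack by one rule from those in `T`. -/
def finStep (T : List (ℕ × ℕ)) (t : ℕ × ℕ) : Bool :=
  A.base.stackFinals.any (fun f => t == (f.1, baseCode f.2)) ||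
  (List.range A.order).any fun d => t.1 == A.order - d &&
    (A.layer d).eps.any fun e => e.1 == t.2 && e.2.all fun y => T.contains (t.1, y)

/-- The automaton constructed from an alternating system. Every transition `(x, x / X, X)` is
present from the start; only the order-`1` transitions and the accepting states are saturated. -/
def saturate : StackTreeAutomaton where
  treeStates := A.base.treeStates
  treeTrans := A.base.treeTrans.map fun t => (t.1, t.2.1, t.2.2.1, t.2.2.2.1, baseCode t.2.2.2.2)
  treeFinals := A.base.treeFinals
  stackStates := A.satStates
  stackTrans := (List.range (A.order - 1)).flatMap fun d => (A.layer d).states.flatMap fun x =>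
    (subs (A.layer d).states).map fun X => (A.order - d, x, quotCode x X, X)
  symTrans := lfp A.symCands A.symStep
  stackFinals := lfp A.satStates A.finStep

end AltSystem

/-! ### The construction is primitive recursive -/

section Primrec

variable {α : Type*} [Primcodable α]

@[fun_prop]
theorem primrec_baseCode {f : α → ℕ} (hf : Primrec f) : Primrec fun a => baseCode (f a) := by
  unfold baseCode; fun_prop

@[fun_prop]
theorem primrec_quotCode {f : α → ℕ} {g : α → List ℕ} (hf : Primrec f) (hg : Primrec g) :
    Primrec fun a => quotCode (f a) (g a) := by
  unfold quotCode; fun_prop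

namespace Layer

/-- The layers as tuples, which provides their encoding by numbers. -/
def equivProd : Layer ≃ List ℕ × List (ℕ × List ℕ) × List (ℕ × StackOp × ℕ) ×
    List (ℕ × ℕ × ℕ) × List (ℕ × (ℕ × List ℕ) × ℕ) where
  toFun l := (l.states, l.eps, l.edges, l.collapses, l.cpushes)
  invFun x := ⟨x.1, x.2.1, x.2.2.1, x.2.2.2.1, x.2.2.2.2⟩
  left_inv _ := rfl
  right_inv _ := rfl

instance : Primcodable Layer := Primcodable.ofEquiv _ equivProd

theorem primrec_equivProd : Primrec equivProd := Primrec.of_equiv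

variable {f : α → Layer}

@[fun_prop]
theorem primrec_states (hf : Primrec f) : Primrec fun a => (f a).states :=
  Primrec.fst.comp (primrec_equivProd.comp hf)

@[fun_prop]
theorem primrec_eps (hf : Primrec f) : Primrec fun a => (f a).eps :=
  (Primrec.fst.comp Primrec.snd).comp (primrec_equivProd.comp hf)

@[fun_prop]
theorem primrec_edges (hf : Primrec f) : Primrec fun a => (f a).edges :=
  (Primrec.fst.comp (Primrec.snd.comp Primrec.snd)).comp (primrec_equivProd.comp hf)

@[fun_prop]
theorem primrec_collapses (hf : Primrec f) : Primrec fun a => (f a).collapses :=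
  (Primrec.fst.comp (Primrec.snd.comp (Primrec.snd.comp Primrec.snd))).comp
    (primrec_equivProd.comp hf)

@[fun_prop]
theorem primrec_cpushes (hf : Primrec f) : Primrec fun a => (f a).cpushes :=
  (Primrec.snd.comp (Primrec.snd.comp (Primrec.snd.comp Primrec.snd))).comp
    (primrec_equivProd.comp hf)

@[fun_prop]
theorem primrec_mk {f₁ : α → List ℕ} {f₂ : α → List (ℕ × List ℕ)}
    {f₃ : α → List (ℕ × StackOp × ℕ)} {f₄ : α → List (ℕ × ℕ × ℕ)}
    {f₅ : α → List (ℕ × (ℕ × List ℕ) × ℕ)} (h₁ : Primrec f₁) (h₂ : Primrec f₂)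
    (h₃ : Primrec f₃) (h₄ : Primrec f₄) (h₅ : Primrec f₅) :
    Primrec fun a => Layer.mk (f₁ a) (f₂ a) (f₃ a) (f₄ a) (f₅ a) :=
  (Primrec.of_equiv_symm (e := equivProd)).comp
    (by fun_prop : Primrec fun a => (f₁ a, f₂ a, f₃ a, f₄ a, f₅ a))

@[fun_prop]
theorem primrec_next {b : α → StackTreeAutomaton} {k : α → ℕ} (hb : Primrec b) (hk : Primrec k)
    (hf : Primrec f) : Primrec fun a => (f a).next (b a) (k a) := by
  unfold next; fun_prop

end Layer

namespace AltSystem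

def equivProd : AltSystem ≃ ℕ × List ℕ × StackTreeAutomaton × List (ℕ × List ℕ) ×
    List (ℕ × StackOp × ℕ) where
  toFun A := (A.order, A.alphabet, A.base, A.eps, A.edges)
  invFun x := ⟨x.1, x.2.1, x.2.2.1, x.2.2.2.1, x.2.2.2.2⟩
  left_inv _ := rfl
  right_inv _ := rfl

instance : Primcodable AltSystem := Primcodable.ofEquiv _ equivProd

theorem primrec_equivProd : Primrec equivProd := Primrec.of_equiv

variable {f : α → AltSystem}

@[fun_prop]
theorem primrec_order (hf : Primrec f) : Primrec fun a => (f a).order :=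
  Primrec.fst.comp (primrec_equivProd.comp hf)

@[fun_prop]
theorem primrec_alphabet (hf : Primrec f) : Primrec fun a => (f a).alphabet :=
  (Primrec.fst.comp Primrec.snd).comp (primrec_equivProd.comp hf)

@[fun_prop]
theorem primrec_base (hf : Primrec f) : Primrec fun a => (f a).base :=
  (Primrec.fst.comp (Primrec.snd.comp Primrec.snd)).comp (primrec_equivProd.comp hf)

@[fun_prop]
theorem primrec_eps (hf : Primrec f) : Primrec fun a => (f a).eps :=
  (Primrec.fst.comp (Primrec.snd.comp (Primrec.snd.comp Primrec.snd))).comp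
    (primrec_equivProd.comp hf)

@[fun_prop]
theorem primrec_edges (hf : Primrec f) : Primrec fun a => (f a).edges :=
  (Primrec.snd.comp (Primrec.snd.comp (Primrec.snd.comp Primrec.snd))).comp
    (primrec_equivProd.comp hf)

@[fun_prop]
theorem primrec_mk {f₁ : α → ℕ} {f₂ : α → List ℕ} {f₃ : α → StackTreeAutomaton}
    {f₄ : α → List (ℕ × List ℕ)} {f₅ : α → List (ℕ × StackOp × ℕ)} (h₁ : Primrec f₁)
    (h₂ : Primrec f₂) (h₃ : Primrec f₃) (h₄ : Primrec f₄) (h₅ : Primrec f₅) :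
    Primrec fun a => AltSystem.mk (f₁ a) (f₂ a) (f₃ a) (f₄ a) (f₅ a) :=
  (Primrec.of_equiv_symm (e := equivProd)).comp
    (by fun_prop : Primrec fun a => (f₁ a, f₂ a, f₃ a, f₄ a, f₅ a))

@[fun_prop]
theorem primrec_layer {g : α → ℕ} (hf : Primrec f) (hg : Primrec g) :
    Primrec fun a => (f a).layer (g a) := by
  unfold layer; fun_prop

@[fun_prop]
theorem primrec_symCands (hf : Primrec f) : Primrec fun a => (f a).symCands := by
  unfold symCands; fun_prop

@[fun_prop]
theorem primrec_symWeaken {g : α → List (ℕ × ℕ × (ℕ × List ℕ) × List ℕ)}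
    {h : α → ℕ × ℕ × (ℕ × List ℕ) × List ℕ} (hf : Primrec f) (hg : Primrec g) (hh : Primrec h) :
    Primrec fun a => (f a).symWeaken (g a) (h a) := by
  unfold symWeaken; fun_prop

@[fun_prop]
theorem primrec_symLayer {g : α → List (ℕ × ℕ × (ℕ × List ℕ) × List ℕ)}
    {h : α → ℕ × ℕ × (ℕ × List ℕ) × List ℕ} (hf : Primrec f) (hg : Primrec g) (hh : Primrec h) :
    Primrec fun a => (f a).symLayer (g a) (h a) := by
  unfold symLayer; fun_prop

@[fun_prop]
theorem primrec_symEdge {g : α → List (ℕ × ℕ × (ℕ × List ℕ) × List ℕ)}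
    {h : α → ℕ × ℕ × (ℕ × List ℕ) × List ℕ} (hf : Primrec f) (hg : Primrec g) (hh : Primrec h) :
    Primrec fun a => (f a).symEdge (g a) (h a) := by
  unfold symEdge; fun_prop

@[fun_prop]
theorem primrec_symStep {g : α → List (ℕ × ℕ × (ℕ × List ℕ) × List ℕ)}
    {h : α → ℕ × ℕ × (ℕ × List ℕ) × List ℕ} (hf : Primrec f) (hg : Primrec g) (hh : Primrec h) :
    Primrec fun a => (f a).symStep (g a) (h a) := by
  unfold symStep; fun_prop

@[fun_prop]
theorem primrec_satStates (hf : Primrec f) : Primrec fun a => (f a).satStates := by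
  unfold satStates; fun_prop

@[fun_prop]
theorem primrec_finStep {g : α → List (ℕ × ℕ)} {h : α → ℕ × ℕ} (hf : Primrec f)
    (hg : Primrec g) (hh : Primrec h) : Primrec fun a => (f a).finStep (g a) (h a) := by
  unfold finStep; fun_prop

@[fun_prop]
theorem primrec_saturate (hf : Primrec f) : Primrec fun a => (f a).saturate := by
  unfold saturate; fun_prop

end AltSystem

end Primrec

/-! ### Semantics of alternating systems -/

/-- The operation `o`, applied to a stack of arbitrary order `k`. -/
def StackOp.StepAt {n k : ℕ} : StackOp → AnnStack n k → AnnStack n k → Prop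
  | rew a b => AnnStack.OnTop (k := 1) (AnnStack.RewTop a b)
  | cpush j => AnnStack.OnTop (k := j) AnnStack.CpushTop
  | push j => AnnStack.OnTop (k := j) AnnStack.PushTop
  | pop j => AnnStack.OnTop (k := j) AnnStack.PopTop
  | collapse j => AnnStack.OnTop (k := j) AnnStack.CollapseTop

theorem StackOp.stepAt_iff_step {n : ℕ} {o : StackOp} {s t : AnnStack n n} :
    o.StepAt s t ↔ o.Step s t := by
  cases o <;> rfl

namespace AnnStack

variable {n : ℕ} {Γ : List ℕ}

theorem TopSym.over {a j k : ℕ} {u : AnnStack n j} {s : AnnStack n k} (h : TopSym a u s)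
    (hs : s.Over Γ) : u.Over Γ ∧ a ∈ Γ := by
  induction h with
  | sym hj s => exact ⟨hs.2.1, hs.1⟩
  | cons s h ih => exact ih hs.1

theorem OnTop.over {k m : ℕ} {R : AnnStack n k → AnnStack n k → Prop}
    (hR : ∀ s t, R s t → s.Over Γ → t.Over Γ) {s t : AnnStack n m} (h : OnTop R s t)
    (hs : s.Over Γ) : t.Over Γ := by
  induction h with
  | here h => exact hR _ _ h hs
  | cons s h ih => exact ⟨ih hs.1, hs.2⟩

theorem OnTop.le {k m : ℕ} {R : AnnStack n k → AnnStack n k → Prop} {s t : AnnStack n m}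
    (h : OnTop R s t) : k ≤ m := by
  induction h <;> omega

theorem PopTop.over {k : ℕ} {s t : AnnStack n k} (h : PopTop s t) (hs : s.Over Γ) :
    t.Over Γ := by
  cases h with
  | sym a hj ann s => exact hs.2.2
  | cons top s => exact hs.2

theorem one_le_of_stack : {k : ℕ} → AnnStack n k → 1 ≤ k
  | _, empty k => Nat.le_add_left 1 k
  | _, sym _ _ _ _ => le_rfl
  | _, cons (k := k) _ _ => by omega

theorem StackOp.StepAt.over {o : StackOp} (ho : o.Valid n Γ) {k : ℕ} {s t : AnnStack n k}
    (h : o.StepAt s t) (hs : s.Over Γ) : t.Over Γ := by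
  cases o with
  | rew a b =>
    refine OnTop.over (fun s t h hs => ?_) h hs
    cases h with
    | sym hj ann s => exact ⟨ho.2, hs.2⟩
  | cpush j =>
    refine OnTop.over (fun s t h hs => ?_) h hs
    obtain ⟨a, i, u, v, h1, h2, h3⟩ := h
    refine OnTop.over (fun s t h hs' => ?_) h3 hs
    cases h with
    | place hj s => exact ⟨(h1.over hs).2, h2.over hs, hs'⟩
  | push j =>
    refine OnTop.over (fun s t h hs => ?_) h hs
    cases h with
    | cons top s => exact ⟨hs.1, hs.1, hs.2⟩
  | pop j => exact OnTop.over (fun s t h hs => h.over hs) h hs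
  | collapse j =>
    refine OnTop.over (fun s t h hs => ?_) h hs
    obtain ⟨a, h⟩ := h
    exact (h.over hs).1

end AnnStack

namespace AltSystem

/-- The least family of relations that is closed under the transitions of `A.base` and the rules
of `A`. -/
inductive Acc (A : AltSystem) : {k : ℕ} → AnnStack A.order k → ℕ → Prop
  | empty {k x : ℕ} (h : (k + 1, x) ∈ A.base.stackFinals) : Acc A (.empty k) x
  | cons {k : ℕ} {top : AnnStack A.order (k + 1)} {s : AnnStack A.order (k + 2)} {x x' : ℕ}
      {X : List ℕ} (h : (k + 2, x, x', X) ∈ A.base.stackTrans) (htop : Acc A top x')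
      (hs : ∀ y ∈ X, Acc A s y) : Acc A (.cons top s) x
  | sym {a j k : ℕ} {hj : j ≤ A.order} {ann : AnnStack A.order j} {s : AnnStack A.order 1}
      {x : ℕ} {B X : List ℕ} (h : (x, a, (k, B), X) ∈ A.base.symTrans) (hB : ∀ y ∈ B, j = k)
      (hann : ∀ y ∈ B, Acc A ann y) (hs : ∀ y ∈ X, Acc A s y) : Acc A (.sym a hj ann s) x
  | eps {u : AnnStack A.order A.order} {x : ℕ} {Y : List ℕ} (h : (x, Y) ∈ A.eps)
      (hY : ∀ y ∈ Y, Acc A u y) : Acc A u x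
  | edge {u u' : AnnStack A.order A.order} {x x' : ℕ} {o : StackOp} (h : (x, o, x') ∈ A.edges)
      (ho : o.Step u u') (hu : Acc A u' x') : Acc A u x

/-- The conditions under which the construction is correct. -/
structure WF (A : AltSystem) : Prop where
  one_le_order : 1 ≤ A.order
  valid : ∃ controls, A.base.Valid A.order A.alphabet controls
  eps_mem : ∀ e ∈ A.eps, (A.order, e.1) ∈ A.base.stackStates
  edges_mem : ∀ e ∈ A.edges, (A.order, e.1) ∈ A.base.stackStates
  edges_valid : ∀ e ∈ A.edges, e.2.1.Valid A.order A.alphabet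

variable {A : AltSystem}

/-! ### Structure of the constructed automaton -/

theorem layer_zero : A.layer 0 =
    { states := (A.base.stackStates.filter fun y => y.1 == A.order).map fun y => baseCode y.2
      eps := A.eps.map fun e => (baseCode e.1, e.2.map baseCode)
      edges := A.edges.map fun e => (baseCode e.1, e.2.1, baseCode e.2.2)
      collapses := []
      cpushes := [] } := rfl

theorem layer_succ (d : ℕ) : A.layer (d + 1) = (A.layer d).next A.base (A.order - d) := rfl

theorem baseCode_mem_states {d k b : ℕ} (hd : d + k = A.order)
    (h : (k, b) ∈ A.base.stackStates) : baseCode b ∈ (A.layer d).states := by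
  cases d with
  | zero =>
    obtain rfl : k = A.order := by omega
    simpa [layer_zero] using h
  | succ d =>
    obtain rfl : k = A.order - d - 1 := by omega
    simp [layer_succ, Layer.next, h]

theorem quotCode_mem_states {d x : ℕ} {X : List ℕ} (hx : x ∈ (A.layer d).states)
    (hX : X ∈ subs (A.layer d).states) : quotCode x X ∈ (A.layer (d + 1)).states := by
  simp [layer_succ, Layer.next, hx, hX]

theorem heads_mem (hA : A.WF) (d : ℕ) :
    (∀ e ∈ (A.layer d).eps, e.1 ∈ (A.layer d).states) ∧
    (∀ e ∈ (A.layer d).edges, e.1 ∈ (A.layer d).states) ∧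
    (∀ e ∈ (A.layer d).collapses, e.1 ∈ (A.layer d).states) ∧
    (∀ e ∈ (A.layer d).cpushes, e.1 ∈ (A.layer d).states) := by
  induction d with
  | zero =>
    simp only [layer_zero, List.mem_map, List.mem_filter, beq_iff_eq]
    refine ⟨?_, ?_, by simp, by simp⟩
    · rintro _ ⟨e, he, rfl⟩
      exact ⟨(_, _), ⟨hA.eps_mem e he, rfl⟩, rfl⟩
    · rintro _ ⟨e, he, rfl⟩
      exact ⟨(_, _), ⟨hA.edges_mem e he, rfl⟩, rfl⟩
  | succ d ih =>
    obtain ⟨h1, h2, h3, h4⟩ := ih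
    refine ⟨?_, ?_, ?_, ?_⟩
    · intro e he
      simp only [layer_succ, Layer.next, List.mem_append, List.mem_flatMap, List.mem_map,
        List.mem_filter, beq_iff_eq] at he
      rcases he with (((⟨e, he, X, hX, rfl⟩ | ⟨t, ⟨ht, hk⟩, X, ⟨hX, -⟩, rfl⟩) |
        ⟨x, hx, X, hX, X', -, rfl⟩) | ⟨e, ⟨he, -⟩, X, ⟨hX, -⟩, rfl⟩) |
        ⟨e, ⟨he, -⟩, X', -, X, hX, rfl⟩
      · exact quotCode_mem_states (h1 e he) hX
      · obtain ⟨c, hv⟩ := hA.valid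
        obtain ⟨k, x, x', Y⟩ := t
        obtain rfl : k = A.order - d := hk
        have := hv.stackTrans_mem _ _ _ _ ht
        exact quotCode_mem_states (baseCode_mem_states (by omega) this.2.2.1) hX
      · exact quotCode_mem_states hx hX
      · exact quotCode_mem_states (h2 e he) hX
      · exact quotCode_mem_states (h2 e he) hX
    · intro e he
      simp only [layer_succ, Layer.next, List.mem_flatMap, List.mem_map, List.mem_filter] at he
      obtain ⟨e, ⟨he, -⟩, X, hX, rfl⟩ := he
      exact quotCode_mem_states (h2 e he) hX
    · intro e he
      simp only [layer_succ, Layer.next, List.mem_append, List.mem_flatMap, List.mem_map,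
        List.mem_filter] at he
      rcases he with ⟨c, hc | ⟨e, ⟨he, -⟩, rfl⟩, X, hX, rfl⟩
      · exact quotCode_mem_states (h3 c hc) hX
      · exact quotCode_mem_states (h2 e he) hX
    · intro e he
      simp only [layer_succ, Layer.next, List.mem_append, List.mem_flatMap, List.mem_map,
        List.mem_filter] at he
      rcases he with ⟨e, he, X, hX, rfl⟩ | ⟨e, ⟨he, -⟩, X, hX, rfl⟩
      · exact quotCode_mem_states (h4 e he) hX
      · exact quotCode_mem_states (h2 e he) hX

theorem mem_stackTrans {d x x' : ℕ} {k : ℕ} {X : List ℕ} (hd : d + (k + 2) = A.order) :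
    (k + 2, x, x', X) ∈ A.saturate.stackTrans ↔
      x ∈ (A.layer d).states ∧ X ∈ subs (A.layer d).states ∧ x' = quotCode x X := by
  simp only [saturate, List.mem_flatMap, List.mem_range, List.mem_map, Prod.mk.injEq]
  constructor
  · rintro ⟨d', hd', x, hx, X, hX, h, rfl, rfl, rfl⟩
    obtain rfl : d = d' := by omega
    exact ⟨hx, hX, rfl⟩
  · rintro ⟨hx, hX, rfl⟩
    exact ⟨d, by omega, x, hx, X, hX, by omega, rfl, rfl, rfl⟩

theorem mem_satStates {d k x : ℕ} (hd : d + k = A.order) (hk : 1 ≤ k) :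
    (k, x) ∈ A.satStates ↔ x ∈ (A.layer d).states := by
  simp only [satStates, List.mem_flatMap, List.mem_range, List.mem_map, Prod.mk.injEq]
  constructor
  · rintro ⟨d', hd', x, hx, h, rfl⟩
    obtain rfl : d = d' := by omega
    exact hx
  · intro hx
    exact ⟨d, by omega, x, hx, by omega, rfl⟩

theorem mem_symCands {d a j x : ℕ} {B X : List ℕ} (hd : d + j = A.order) (hj : 1 ≤ j) :
    (x, a, (j, B), X) ∈ A.symCands ↔ x ∈ (A.layer (A.order - 1)).states ∧ a ∈ A.alphabet ∧
      B ∈ subs (A.layer d).states ∧ X ∈ subs (A.layer (A.order - 1)).states := by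
  simp only [symCands, List.mem_flatMap, List.mem_range, List.mem_map, Prod.mk.injEq]
  constructor
  · rintro ⟨x, hx, a, ha, d', hd', B, hB, X, hX, rfl, rfl, ⟨h, rfl⟩, rfl⟩
    obtain rfl : d = d' := by omega
    exact ⟨hx, ha, hB, hX⟩
  · rintro ⟨hx, ha, hB, hX⟩
    exact ⟨x, hx, a, ha, d, by omega, B, hB, X, hX, rfl, rfl, ⟨by omega, rfl⟩, rfl⟩

theorem order_of_mem_symCands {a j x : ℕ} {B X : List ℕ} (h : (x, a, (j, B), X) ∈ A.symCands) :
    1 ≤ j ∧ j ≤ A.order := by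
  simp only [symCands, List.mem_flatMap, List.mem_range, List.mem_map, Prod.mk.injEq] at h
  obtain ⟨x, hx, a, ha, d', hd', B, hB, X, hX, rfl, rfl, ⟨h, rfl⟩, rfl⟩ := h
  omega

theorem symStep_mono {T T' : List (ℕ × ℕ × (ℕ × List ℕ) × List ℕ)}
    {t : ℕ × ℕ × (ℕ × List ℕ) × List ℕ} (h : T ⊆ T') (ht : A.symStep T t = true) :
    A.symStep T' t = true := by
  simp only [symStep, Bool.or_eq_true] at ht ⊢
  rcases ht with (ht | ht) | ht
  · refine .inl (.inl ?_)
    simp only [symWeaken, List.any_append, Bool.or_eq_true, List.any_eq_true] at ht ⊢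
    exact ht.imp_right fun ⟨u, hu, hu'⟩ => ⟨u, h hu, hu'⟩
  · refine .inl (.inr ?_)
    simp only [symLayer, Bool.or_eq_true, List.any_eq_true, Bool.and_eq_true, List.all_eq_true,
      List.contains_iff_mem] at ht ⊢
    refine ht.imp (Or.imp_left fun ⟨e, he, h1, h2⟩ => ⟨e, he, h1, fun y hy => h (h2 y hy)⟩)
      fun ⟨c, hc, h1, u, hu, h2, h3⟩ => ⟨c, hc, h1, u, h hu, h2, fun y hy => h (h3 y hy)⟩
  · refine .inr ?_
    simp only [symEdge, Bool.or_eq_true, List.any_eq_true, Bool.and_eq_true, List.all_eq_true,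
      List.contains_iff_mem] at ht ⊢
    obtain ⟨e, he, h1, h2⟩ := ht
    refine ⟨e, he, h1, h2.imp (Or.imp_right fun ⟨u, hu, h3⟩ => ⟨u, h hu, h3⟩)
      fun ⟨h3, u, hu, h4, h5⟩ => ⟨h3, u, h hu, h4, fun y hy => h (h5 y hy)⟩⟩

theorem finStep_mono {T T' : List (ℕ × ℕ)} {t : ℕ × ℕ} (h : T ⊆ T')
    (ht : A.finStep T t = true) : A.finStep T' t = true := by
  simp only [finStep, Bool.or_eq_true, List.any_eq_true, Bool.and_eq_true, List.all_eq_true,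
    List.contains_iff_mem] at ht ⊢
  exact ht.imp_right fun ⟨d, hd, h1, e, he, h2, h3⟩ =>
    ⟨d, hd, h1, e, he, h2, fun y hy => h (h3 y hy)⟩

theorem mem_symTrans {t : ℕ × ℕ × (ℕ × List ℕ) × List ℕ} (ht : t ∈ A.symCands)
    (h : A.symStep A.saturate.symTrans t = true) : t ∈ A.saturate.symTrans :=
  mem_lfp (D := A.symCands) (Φ := A.symStep) (fun T T' _ => symStep_mono (T := T) (T' := T')) ht h

theorem mem_stackFinals {t : ℕ × ℕ} (ht : t ∈ A.satStates)
    (h : A.finStep A.saturate.stackFinals t = true) : t ∈ A.saturate.stackFinals :=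
  mem_lfp (D := A.satStates) (Φ := A.finStep) (fun T T' _ => finStep_mono (T := T) (T' := T')) ht h

end AltSystem

/-! ### Every consequence of the rules is accepted -/

namespace AltSystem

variable {A : AltSystem}

theorem mem_states_of_accepts {k : ℕ} {u : AnnStack A.order k} {x : ℕ}
    (h : A.saturate.AcceptsStack u x) {d : ℕ} (hd : d + k = A.order) :
    x ∈ (A.layer d).states := by
  cases u with
  | empty k =>
    rw [StackTreeAutomaton.AcceptsStack] at h
    exact (mem_satStates hd (by omega)).1 (lfp_subset h)
  | sym a hj ann s =>
    rw [StackTreeAutomaton.AcceptsStack] at h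
    obtain ⟨k, B, X, h, -, -⟩ := h
    have hc := lfp_subset h
    have ho := order_of_mem_symCands hc
    obtain rfl : d = A.order - 1 := by omega
    exact ((mem_symCands (d := A.order - k) (by omega) ho.1).1 hc).1
  | cons top s =>
    rw [StackTreeAutomaton.AcceptsStack] at h
    obtain ⟨x', X, h, -, -⟩ := h
    exact ((mem_stackTrans hd).1 h).1

/-- The type of a stack `u` of order `A.order - d`: all states from which it is accepted. -/
noncomputable def accStates (A : AltSystem) (d : ℕ) {k : ℕ} (u : AnnStack A.order k) : List ℕ :=
  open Classical in (A.layer d).states.filter fun y => decide (A.saturate.AcceptsStack u y)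

theorem mem_accStates {k d : ℕ} (hd : d + k = A.order) {u : AnnStack A.order k} {x : ℕ} :
    x ∈ A.accStates d u ↔ A.saturate.AcceptsStack u x := by
  simp only [accStates, List.mem_filter, decide_eq_true_eq, and_iff_right_iff_imp]
  exact fun h => mem_states_of_accepts h hd

theorem accStates_mem_subs {k d : ℕ} (u : AnnStack A.order k) :
    A.accStates d u ∈ subs (A.layer d).states :=
  filter_mem_subs _ _

/-- Acceptance is closed under the `eps` rules of the layer for the order of `u`. -/
def EpsClosed (A : AltSystem) {k : ℕ} (u : AnnStack A.order k) : Prop :=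
  ∀ d, d + k = A.order → ∀ x Y, (x, Y) ∈ (A.layer d).eps →
    (∀ y ∈ Y, A.saturate.AcceptsStack u y) → A.saturate.AcceptsStack u x

/-- A transition on `top : s` may be taken to be the one whose set consists of all states that
accept `s`, since the quotients by larger sets are weaker. -/
theorem accepts_cons_iff {k d : ℕ} (hd : d + (k + 2) = A.order) {top : AnnStack A.order (k + 1)}
    (htop : A.EpsClosed top) {s : AnnStack A.order (k + 2)} {x : ℕ} :
    A.saturate.AcceptsStack (.cons top s) x ↔ x ∈ (A.layer d).states ∧
      A.saturate.AcceptsStack top (quotCode x (A.accStates d s)) := by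
  rw [StackTreeAutomaton.AcceptsStack]
  constructor
  · rintro ⟨x', X, h, h1, h2⟩
    obtain ⟨hx, hX, rfl⟩ := (mem_stackTrans hd).1 h
    refine ⟨hx, htop (d + 1) (by omega) _ [quotCode x X] ?_ (by simpa using h1)⟩
    simp only [layer_succ, Layer.next, List.mem_append, List.mem_flatMap, List.mem_map,
      List.mem_filter, subsetB_iff]
    exact .inl (.inl (.inr ⟨x, hx, _, accStates_mem_subs s, X,
      ⟨hX, fun y hy => (mem_accStates hd).2 (h2 y hy)⟩, rfl⟩))
  · rintro ⟨hx, h⟩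
    exact ⟨_, _, (mem_stackTrans hd).2 ⟨hx, accStates_mem_subs s, rfl⟩, h,
      fun y hy => (mem_accStates hd).1 hy⟩

/-- The analogue of `accepts_cons_iff` at order `1`, where the annotation and the remainder both
contribute the sets of all states that accept them. -/
theorem accepts_sym_iff {a j : ℕ} {hj : j ≤ A.order} {ann : AnnStack A.order j}
    {s : AnnStack A.order 1} {x : ℕ} : A.saturate.AcceptsStack (.sym a hj ann s) x ↔
      (x, a, (j, A.accStates (A.order - j) ann), A.accStates (A.order - 1) s) ∈
        A.saturate.symTrans := by
  have hj1 := AnnStack.one_le_of_stack ann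
  rw [StackTreeAutomaton.AcceptsStack]
  constructor
  · rintro ⟨k, B, X, h, hB, hX⟩
    have hc := lfp_subset h
    have ho := order_of_mem_symCands hc
    have hc := (mem_symCands (d := A.order - k) (by omega) ho.1).1 hc
    refine mem_symTrans ((mem_symCands (d := A.order - j) (by omega) hj1).2
      ⟨hc.1, hc.2.1, accStates_mem_subs _, accStates_mem_subs _⟩) ?_
    simp only [symStep, Bool.or_eq_true, symWeaken, List.any_eq_true, List.mem_append,
      Bool.and_eq_true, beq_iff_eq, List.isEmpty_iff, subsetB_iff]
    refine .inl (.inl ⟨_, .inr h, ⟨⟨⟨rfl, rfl⟩, ?_⟩, ?_⟩, ?_⟩)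
    · rcases B with - | ⟨y, B⟩
      · exact .inl rfl
      · exact .inr (hB y (by simp)).1.symm
    · exact fun y hy => (mem_accStates (by omega)).2 (hB y hy).2
    · exact fun y hy => (mem_accStates (by omega)).2 (hX y hy)
  · intro h
    exact ⟨_, _, _, h, fun y hy => ⟨rfl, (mem_accStates (by omega)).1 hy⟩,
      fun y hy => (mem_accStates (by omega)).1 hy⟩

/-- To accept `a` annotated by `ann` on `s` from a state of order `1`, it is enough to derive one
transition by a saturation step. -/
theorem accepts_sym_of_symStep {a j : ℕ} {hj : j ≤ A.order} {ann : AnnStack A.order j}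
    {s : AnnStack A.order 1} {x : ℕ} (hx : x ∈ (A.layer (A.order - 1)).states)
    (ha : a ∈ A.alphabet) (h : A.symStep A.saturate.symTrans
      (x, a, (j, A.accStates (A.order - j) ann), A.accStates (A.order - 1) s) = true) :
    A.saturate.AcceptsStack (.sym a hj ann s) x := by
  have hj1 := AnnStack.one_le_of_stack ann
  exact accepts_sym_iff.2 (mem_symTrans ((mem_symCands (d := A.order - j) (by omega) hj1).2
    ⟨hx, ha, accStates_mem_subs _, accStates_mem_subs _⟩) h)

/-- For the empty stack and at order `1` this is a step of the saturation. On `top : s` the rule is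
passed on to `top`, divided by the set of all states that accept `s`. -/
theorem epsClosed (hA : A.WF) {k : ℕ} (u : AnnStack A.order k) (hu : u.Over A.alphabet) :
    A.EpsClosed u := by
  induction u with
  | empty k =>
    intro d hd x Y he hY
    have hx := (heads_mem hA d).1 _ he
    rw [StackTreeAutomaton.AcceptsStack]
    refine mem_stackFinals ((mem_satStates hd (by omega)).2 hx) ?_
    simp only [finStep, Bool.or_eq_true, List.any_eq_true, Bool.and_eq_true, List.all_eq_true,
      List.contains_iff_mem, List.mem_range, beq_iff_eq]
    refine .inr ⟨d, by omega, by omega, _, he, rfl, fun y hy => ?_⟩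
    simpa only [StackTreeAutomaton.AcceptsStack] using hY y hy
  | sym a hj ann s _ _ =>
    intro d hd x Y he hY
    obtain rfl : d = A.order - 1 := by omega
    refine accepts_sym_of_symStep ((heads_mem hA _).1 _ he) hu.1 ?_
    simp only [symStep, symLayer, Bool.or_eq_true, List.any_eq_true, Bool.and_eq_true,
      List.all_eq_true, List.contains_iff_mem, beq_iff_eq]
    exact .inl (.inr (.inl (.inl ⟨_, he, rfl, fun y hy => accepts_sym_iff.1 (hY y hy)⟩)))
  | cons top s ih _ =>
    intro d hd x Y he hY
    have ih := ih hu.1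
    refine (accepts_cons_iff hd ih).2 ⟨(heads_mem hA _).1 _ he, ?_⟩
    refine ih (d + 1) (by omega) _ (Y.map fun y => quotCode y (A.accStates d s)) ?_ ?_
    · simp only [layer_succ, Layer.next, List.mem_append, List.mem_flatMap, List.mem_map]
      exact .inl (.inl (.inl (.inl ⟨_, he, _, accStates_mem_subs s, rfl⟩)))
    · simp only [List.mem_map, forall_exists_index, and_imp, forall_apply_eq_imp_iff₂]
      exact fun y hy => ((accepts_cons_iff hd ih).1 (hY y hy)).2

theorem accepts_of_collapses (hA : A.WF) {a K : ℕ} {t : AnnStack A.order K} {k : ℕ}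
    {u : AnnStack A.order k} (htop : AnnStack.TopSym a t u) (hu : u.Over A.alphabet) {d : ℕ}
    (hd : d + k = A.order) {x w : ℕ} (hc : (x, K, w) ∈ (A.layer d).collapses)
    (ht : A.saturate.AcceptsStack t w) : A.saturate.AcceptsStack u x := by
  induction htop generalizing d x with
  | sym hj s =>
    obtain rfl : d = A.order - 1 := by omega
    refine accepts_sym_of_symStep ((heads_mem hA _).2.2.1 _ hc) hu.1 ?_
    simp only [symStep, symLayer, Bool.or_eq_true, List.any_eq_true, Bool.and_eq_true,
      List.contains_iff_mem, beq_iff_eq]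
    exact .inl (.inr (.inl (.inr ⟨_, hc, ⟨rfl, rfl⟩, (mem_accStates (by omega)).2 ht⟩)))
  | cons s h ih =>
    refine (accepts_cons_iff hd (epsClosed hA _ hu.1)).2 ⟨(heads_mem hA _).2.2.1 _ hc, ?_⟩
    refine ih hu.1 (d := d + 1) (by omega) ?_
    simp only [layer_succ, Layer.next, List.mem_append, List.mem_flatMap, List.mem_map]
    exact ⟨_, .inl hc, _, accStates_mem_subs s, rfl⟩

theorem accepts_of_cpushes (hA : A.WF) {a j K : ℕ} {ann : AnnStack A.order j}
    {v : AnnStack A.order K} {k : ℕ} {u u' : AnnStack A.order k}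
    (hp : AnnStack.OnTop (AnnStack.PlaceSym a v) u u') (htop : AnnStack.TopSym a ann u)
    (hu : u.Over A.alphabet) (hu' : u'.Over A.alphabet) {d : ℕ} (hd : d + k = A.order) {x x' : ℕ}
    (hc : (x, (K, A.accStates (A.order - K) v), x') ∈ (A.layer d).cpushes)
    (ht : A.saturate.AcceptsStack u' x') : A.saturate.AcceptsStack u x := by
  induction hp generalizing d x x' with
  | here h =>
    obtain rfl : d = A.order - 1 := by omega
    cases h
    cases htop with
    | sym hj s =>
      refine accepts_sym_of_symStep ((heads_mem hA _).2.2.2 _ hc) hu.1 ?_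
      simp only [symStep, symLayer, Bool.or_eq_true, List.any_eq_true, Bool.and_eq_true,
        List.all_eq_true, List.contains_iff_mem, beq_iff_eq]
      refine .inl (.inr (.inr ⟨_, hc, rfl, _, accepts_sym_iff.1 ht, ⟨⟨rfl, rfl⟩, rfl⟩,
        fun y hy => accepts_sym_iff.1 ((mem_accStates (by omega)).1 hy)⟩))
  | cons s h ih =>
    cases htop with
    | cons _ htop =>
      refine (accepts_cons_iff hd (epsClosed hA _ hu.1)).2 ⟨(heads_mem hA _).2.2.2 _ hc, ?_⟩
      refine ih htop hu.1 hu'.1 (d := d + 1) (by omega) ?_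
        ((accepts_cons_iff hd (epsClosed hA _ hu'.1)).1 ht).2
      simp only [layer_succ, Layer.next, List.mem_append, List.mem_flatMap, List.mem_map]
      exact .inl ⟨_, hc, _, accStates_mem_subs s, rfl⟩

/-- Operations below the top element are passed on from layer to layer, so that closure under an
operation need only be shown at the layer of its own level. -/
theorem accepts_of_onTop (hA : A.WF) {K : ℕ} {R : AnnStack A.order K → AnnStack A.order K → Prop}
    {o : StackOp} (ho : o.level = K)
    (hR : ∀ u u', R u u' → u.Over A.alphabet → u'.Over A.alphabet → ∀ d, d + K = A.order →
      ∀ x x', (x, o, x') ∈ (A.layer d).edges → A.saturate.AcceptsStack u' x' →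
        A.saturate.AcceptsStack u x)
    {k : ℕ} {u u' : AnnStack A.order k} (h : AnnStack.OnTop R u u') (hu : u.Over A.alphabet)
    (hu' : u'.Over A.alphabet) {d : ℕ} (hd : d + k = A.order) {x x' : ℕ}
    (he : (x, o, x') ∈ (A.layer d).edges) (hx' : A.saturate.AcceptsStack u' x') :
    A.saturate.AcceptsStack u x := by
  induction h generalizing d x x' with
  | here h => exact hR _ _ h hu hu' _ hd _ _ he hx'
  | @cons m top top' s h ih =>
    have hK := h.le
    refine (accepts_cons_iff hd (epsClosed hA _ hu.1)).2
      ⟨(heads_mem hA _).2.1 _ he, ih hu.1 hu'.1 (d := d + 1) (by omega) ?_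
        ((accepts_cons_iff hd (epsClosed hA _ hu'.1)).1 hx').2⟩
    simp only [layer_succ, Layer.next, List.mem_flatMap, List.mem_map, List.mem_filter,
      decide_eq_true_eq]
    exact ⟨_, ⟨he, by simp only; omega⟩, _, accStates_mem_subs s, rfl⟩

theorem accepts_of_edge (hA : A.WF) {o : StackOp} {k : ℕ} {u u' : AnnStack A.order k}
    (h : o.StepAt u u') (hu : u.Over A.alphabet) (hu' : u'.Over A.alphabet) {d : ℕ}
    (hd : d + k = A.order) {x x' : ℕ} (he : (x, o, x') ∈ (A.layer d).edges)
    (hx' : A.saturate.AcceptsStack u' x') : A.saturate.AcceptsStack u x := by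
  cases o with
  | rew a b =>
    simp only [StackOp.StepAt] at h
    refine accepts_of_onTop hA (K := 1) rfl ?_ h hu hu' hd he hx'
    intro u u' hR hu hu' d hd x x' he hx'
    obtain rfl : d = A.order - 1 := by omega
    cases hR with
    | sym hj ann s =>
      refine accepts_sym_of_symStep ((heads_mem hA _).2.1 _ he) hu.1 ?_
      simp only [symStep, symEdge, Bool.or_eq_true, List.any_eq_true, Bool.and_eq_true, beq_iff_eq]
      exact .inr ⟨_, he, rfl, .inl (.inr ⟨_, accepts_sym_iff.1 hx', ⟨rfl, rfl⟩, rfl⟩)⟩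
  | cpush j =>
    simp only [StackOp.StepAt] at h
    refine accepts_of_onTop hA (K := j) rfl ?_ h hu hu' hd he hx'
    rintro u u' ⟨a, i, ann, v, htop, hpop, hplace⟩ hu hu' d hd x x' he hx'
    cases hpop with
    | sym b hj ann' s =>
      obtain rfl : d = A.order - 1 := by omega
      cases htop
      cases hplace with
      | here hplace =>
        cases hplace with
        | place h1 _ =>
          refine accepts_sym_of_symStep ((heads_mem hA _).2.1 _ he) hu.1 ?_
          simp only [symStep, symEdge, Bool.or_eq_true, List.any_eq_true, Bool.and_eq_true,
            beq_iff_eq, subsetB_iff, List.all_eq_true, List.contains_iff_mem]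
          refine .inr ⟨_, he, rfl, .inr ⟨rfl, _, accepts_sym_iff.1 hx',
            ⟨⟨⟨rfl, rfl⟩, rfl⟩, fun y hy => hy⟩,
            fun y hy => accepts_sym_iff.1 ((mem_accStates (by omega)).1 hy)⟩⟩
    | @cons k top s =>
      have hk : A.order - d = k + 2 := by omega
      have hk' : A.order - (k + 2) = d := by omega
      cases hplace with
      | cons _ hplace =>
        cases htop with
        | cons _ htop =>
          refine (accepts_cons_iff hd (epsClosed hA _ hu.1)).2 ⟨(heads_mem hA _).2.1 _ he, ?_⟩
          refine accepts_of_cpushes hA hplace htop hu.1 hu'.1 (d := d + 1) (by omega) ?_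
            ((accepts_cons_iff hd (epsClosed hA _ hu'.1)).1 hx').2
          simp only [layer_succ, Layer.next, List.mem_append, List.mem_flatMap, List.mem_map,
            List.mem_filter, beq_iff_eq]
          refine .inr ⟨_, ⟨he, ?_⟩, _, accStates_mem_subs s, ?_⟩
          · simp only [hk]
          · simp only [hk, hk']
  | push j =>
    simp only [StackOp.StepAt] at h
    refine accepts_of_onTop hA (K := j) rfl ?_ h hu hu' hd he hx'
    intro u u' hR hu hu' d hd x x' he hx'
    cases hR with
    | @cons j top s =>
      have hk : A.order - d = j + 2 := by omega
      have htop := epsClosed hA _ hu.1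
      refine (accepts_cons_iff hd htop).2 ⟨(heads_mem hA _).2.1 _ he, ?_⟩
      refine htop (d + 1) (by omega) _
        (quotCode x' (A.accStates d (.cons top s)) :: (A.accStates d (.cons top s)).map fun y =>
          quotCode y (A.accStates d s)) ?_ ?_
      · simp only [layer_succ, Layer.next, List.mem_append, List.mem_flatMap, List.mem_map,
          List.mem_filter, beq_iff_eq]
        refine .inr ⟨_, ⟨he, ?_⟩, _, accStates_mem_subs _, _, accStates_mem_subs _, rfl⟩
        simp only [hk]
      · simp only [List.mem_cons, List.mem_map, forall_eq_or_imp, forall_exists_index, and_imp,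
          forall_apply_eq_imp_iff₂]
        exact ⟨((accepts_cons_iff hd htop).1 hx').2, fun y hy =>
          ((accepts_cons_iff hd htop).1 ((mem_accStates hd).1 hy)).2⟩
  | pop j =>
    simp only [StackOp.StepAt] at h
    refine accepts_of_onTop hA (K := j) rfl ?_ h hu hu' hd he hx'
    intro u u' hR hu hu' d hd x x' he hx'
    cases hR with
    | sym a hj ann s =>
      obtain rfl : d = A.order - 1 := by omega
      refine accepts_sym_of_symStep ((heads_mem hA _).2.1 _ he) hu.1 ?_
      simp only [symStep, symEdge, Bool.or_eq_true, List.any_eq_true, Bool.and_eq_true, beq_iff_eq,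
        List.contains_iff_mem]
      exact .inr ⟨_, he, rfl, .inl (.inl (.inl ⟨rfl, (mem_accStates (by omega)).2 hx'⟩))⟩
    | @cons j top s =>
      have hk : A.order - d = j + 2 := by omega
      have htop := epsClosed hA _ hu.1
      refine (accepts_cons_iff hd htop).2 ⟨(heads_mem hA _).2.1 _ he, ?_⟩
      refine htop (d + 1) (by omega) _ [] ?_ (by simp)
      simp only [layer_succ, Layer.next, List.mem_append, List.mem_flatMap, List.mem_map,
        List.mem_filter, beq_iff_eq, List.contains_iff_mem]
      refine .inl (.inr ⟨_, ⟨he, ?_⟩, _, ⟨accStates_mem_subs s, (mem_accStates hd).2 hx'⟩, rfl⟩)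
      simp only [hk]
  | collapse j =>
    simp only [StackOp.StepAt] at h
    refine accepts_of_onTop hA (K := j) rfl ?_ h hu hu' hd he hx'
    rintro u u' ⟨a, htop⟩ hu hu' d hd x x' he hx'
    cases htop with
    | sym hj s =>
      obtain rfl : d = A.order - 1 := by omega
      refine accepts_sym_of_symStep ((heads_mem hA _).2.1 _ he) hu.1 ?_
      simp only [symStep, symEdge, Bool.or_eq_true, List.any_eq_true, Bool.and_eq_true, beq_iff_eq,
        List.contains_iff_mem]
      exact .inr ⟨_, he, rfl, .inl (.inl (.inr ⟨⟨rfl, trivial⟩, (mem_accStates (by omega)).2 hx'⟩))⟩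
    | @cons j top s htop =>
      have hk : A.order - d = j + 2 := by omega
      refine (accepts_cons_iff hd (epsClosed hA _ hu.1)).2 ⟨(heads_mem hA _).2.1 _ he, ?_⟩
      refine accepts_of_collapses hA htop hu.1 (d := d + 1) (by omega) ?_ hx'
      simp only [layer_succ, Layer.next, List.mem_append, List.mem_flatMap, List.mem_map,
        List.mem_filter, beq_iff_eq]
      refine ⟨_, .inr ⟨_, ⟨he, ?_⟩, rfl⟩, _, accStates_mem_subs s, ?_⟩
      · simp only [hk]
      · simp only [hk]

/-- Acceptance is closed under the transitions of `base` and the rules of `A`. -/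
theorem accepts_of_acc (hA : A.WF) {k : ℕ} (hk : k ≤ A.order) {u : AnnStack A.order k}
    (hu : u.Over A.alphabet) {x : ℕ} (h : A.Acc u x) :
    A.saturate.AcceptsStack u (baseCode x) := by
  obtain ⟨c, hv⟩ := hA.valid
  induction h with
  | @empty k x h =>
    rw [StackTreeAutomaton.AcceptsStack]
    refine mem_stackFinals ((mem_satStates (d := A.order - (k + 1)) (by omega) (by omega)).2
      (baseCode_mem_states (by omega) (hv.stackFinals_subset _ h))) ?_
    simp only [finStep, Bool.or_eq_true, List.any_eq_true, beq_iff_eq]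
    exact .inl ⟨_, h, rfl⟩
  | @cons k top s x x' X h htop hs ih1 ih2 =>
    have hd : A.order - (k + 2) + (k + 2) = A.order := by omega
    have ht := epsClosed hA _ hu.1
    refine (accepts_cons_iff hd ht).2
      ⟨baseCode_mem_states hd (hv.stackTrans_mem _ _ _ _ h).2.2.1, ?_⟩
    refine ht (A.order - (k + 2) + 1) (by omega) _ [baseCode x'] ?_
      (by simpa using ih1 (by omega) hu.1)
    simp only [layer_succ, Layer.next, List.mem_append, List.mem_flatMap, List.mem_map,
      List.mem_filter, beq_iff_eq, subsetB_iff]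
    refine .inl (.inl (.inl (.inr ⟨_, ⟨h, by simp only; omega⟩, _, ⟨accStates_mem_subs s, ?_⟩, rfl⟩)))
    intro y hy
    obtain ⟨z, hz, rfl⟩ := List.mem_map.1 hy
    exact (mem_accStates hd).2 (ih2 z hz hk hu.2)
  | @sym a j k hj ann s x B X h hB hann hs ih1 ih2 =>
    have h1 := hA.one_le_order
    refine accepts_sym_of_symStep
      (baseCode_mem_states (by omega) (hv.symTrans_mem _ _ _ _ _ h).1) hu.1 ?_
    simp only [symStep, Bool.or_eq_true, symWeaken, List.any_eq_true, List.mem_append,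
      Bool.and_eq_true, beq_iff_eq, List.isEmpty_iff, subsetB_iff, List.mem_map]
    refine .inl (.inl ⟨_, .inl ⟨_, h, rfl⟩, ⟨⟨⟨rfl, rfl⟩, ?_⟩, ?_⟩, ?_⟩)
    · rcases B with - | ⟨y, B⟩
      · exact .inl rfl
      · exact .inr (hB y (by simp)).symm
    · intro y hy
      obtain ⟨z, hz, rfl⟩ := List.mem_map.1 hy
      exact (mem_accStates (by omega)).2 (ih1 z hz hj hu.2.1)
    · intro y hy
      obtain ⟨z, hz, rfl⟩ := List.mem_map.1 hy
      exact (mem_accStates (by omega)).2 (ih2 z hz hk hu.2.2)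
  | @eps u x Y h hY ih =>
    refine epsClosed hA u hu 0 (by omega) _ (Y.map baseCode) ?_ ?_
    · simp only [layer_zero, List.mem_map]
      exact ⟨_, h, rfl⟩
    · simp only [List.mem_map, forall_exists_index, and_imp, forall_apply_eq_imp_iff₂]
      exact fun y hy => ih y hy hk hu
  | @edge u u' x x' o h ho _ ih =>
    rw [← StackOp.stepAt_iff_step] at ho
    have hu' := AnnStack.StackOp.StepAt.over (hA.edges_valid _ h) ho hu
    refine accepts_of_edge hA ho hu hu' (d := 0) (by omega) ?_ (ih hk hu')
    simp only [layer_zero, List.mem_map]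
    exact ⟨_, h, rfl⟩

end AltSystem

/-! ### Every accepted stack is a consequence of the rules -/

/-- The relation `w = u : s` between a stack `u` of order `k` and stacks `s`, `w` of order
`k + 1`. -/
inductive AnnStack.IsCons {n : ℕ} : {k : ℕ} → AnnStack n k → AnnStack n (k + 1) →
    AnnStack n (k + 1) → Prop
  | mk {k : ℕ} (top : AnnStack n (k + 1)) (s : AnnStack n (k + 2)) : IsCons top s (.cons top s)

namespace AltSystem

variable {A : AltSystem}

/-- The intended meaning of the states in the layer `d`: base states mean derivability, and the
quotient state `y / X` holds of `u` if `y` holds of `u : s` for all `s` that satisfy `X`. -/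
def Sem (A : AltSystem) : ℕ → {k : ℕ} → AnnStack A.order k → ℕ → Prop
  | 0, _, u, x => ∃ b, x = baseCode b ∧ A.Acc u b
  | d + 1, _, u, x => (∃ b, x = baseCode b ∧ A.Acc u b) ∨
      ∃ y X, x = quotCode y X ∧ ∀ s w, AnnStack.IsCons u s w → (∀ z ∈ X, Sem A d s z) →
        Sem A d w y

@[simp]
theorem sem_baseCode {d k b : ℕ} {u : AnnStack A.order k} :
    A.Sem d u (baseCode b) ↔ A.Acc u b := by
  cases d <;> simp [Sem]

theorem sem_quotCode {d k x : ℕ} {X : List ℕ} {u : AnnStack A.order (k + 1)} :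
    A.Sem (d + 1) u (quotCode x X) ↔
      ∀ s : AnnStack A.order (k + 2), (∀ z ∈ X, A.Sem d s z) → A.Sem d (.cons u s) x := by
  simp only [Sem, quotCode_ne_baseCode, false_and, exists_false, quotCode_inj, false_or]
  constructor
  · rintro ⟨y, Y, ⟨rfl, rfl⟩, h⟩ s hs
    exact h s _ (.mk _ _) hs
  · intro h
    refine ⟨x, X, ⟨rfl, rfl⟩, fun s w hw hs => ?_⟩
    cases hw
    exact h s hs

/-- The rules of the layer `d`, for stacks of order `k`, are true of the intended meaning. -/
structure LayerSound (A : AltSystem) (d k : ℕ) : Prop where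
  eps : ∀ x Y, (x, Y) ∈ (A.layer d).eps → ∀ u : AnnStack A.order k,
    (∀ y ∈ Y, A.Sem d u y) → A.Sem d u x
  edges : ∀ x o x', (x, o, x') ∈ (A.layer d).edges → ∀ u u' : AnnStack A.order k,
    o.StepAt u u' → A.Sem d u' x' → A.Sem d u x
  collapses : ∀ x K w, (x, K, w) ∈ (A.layer d).collapses → ∀ a (t : AnnStack A.order K)
    (u : AnnStack A.order k), AnnStack.TopSym a t u → A.Sem (A.order - K) t w → A.Sem d u x
  cpushes : ∀ x K V x', (x, (K, V), x') ∈ (A.layer d).cpushes → ∀ a j (ann : AnnStack A.order j)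
    (u : AnnStack A.order k), AnnStack.TopSym a ann u →
    (∀ v : AnnStack A.order K, (∀ y ∈ V, A.Sem (A.order - K) v y) →
      ∃ u', AnnStack.OnTop (AnnStack.PlaceSym a v) u u' ∧ A.Sem d u' x') → A.Sem d u x

theorem layerSound_zero : A.LayerSound 0 A.order := by
  constructor
  · intro x Y h u hY
    simp only [layer_zero, List.mem_map, Prod.mk.injEq] at h
    obtain ⟨e, he, rfl, rfl⟩ := h
    simp only [List.mem_map, forall_exists_index, and_imp, forall_apply_eq_imp_iff₂,
      sem_baseCode] at hY ⊢
    exact .eps he hY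
  · intro x o x' h u u' hs hu'
    simp only [layer_zero, List.mem_map, Prod.mk.injEq] at h
    obtain ⟨e, he, rfl, rfl, rfl⟩ := h
    rw [sem_baseCode] at hu' ⊢
    exact .edge he (StackOp.stepAt_iff_step.1 hs) hu'
  · intro x K w h
    simp [layer_zero] at h
  · intro x K V x' h
    simp [layer_zero] at h

theorem stepAt_cons {n k : ℕ} {o : StackOp} {u u' : AnnStack n (k + 1)} (h : o.StepAt u u')
    (s : AnnStack n (k + 2)) : o.StepAt (.cons u s) (.cons u' s) := by
  cases o <;> exact .cons s h

theorem layerSound_succ {d k : ℕ} (hd : d + (k + 2) = A.order) (h : A.LayerSound d (k + 2)) :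
    A.LayerSound (d + 1) (k + 1) := by
  have hk : A.order - d = k + 2 := by omega
  constructor
  · intro x Y he u hY
    simp only [layer_succ, Layer.next, List.mem_append, List.mem_flatMap, List.mem_map,
      List.mem_filter, beq_iff_eq, Prod.mk.injEq, subsetB_iff, List.contains_iff_mem, hk] at he
    rcases he with (((⟨e, he, X, hX, rfl, rfl⟩ | ⟨t, ⟨ht, hk⟩, X, ⟨-, hX⟩, rfl, rfl⟩) |
      ⟨x, hx, X, hX, X', ⟨-, hX'⟩, rfl, rfl⟩) | ⟨e, ⟨he, hop⟩, X, ⟨-, hX⟩, rfl, rfl⟩) |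
      ⟨e, ⟨he, hop⟩, X', -, X, -, rfl, rfl⟩
    · simp only [List.mem_map, forall_exists_index, and_imp, forall_apply_eq_imp_iff₂,
        sem_quotCode] at hY ⊢
      exact fun s hs => h.eps _ _ he _ fun y hy => hY y hy s hs
    · obtain ⟨k', x, x', Y⟩ := t
      obtain rfl : k' = k + 2 := hk
      simp only [List.mem_singleton, forall_eq, sem_baseCode, sem_quotCode] at hY ⊢
      refine fun s hs => .cons ht hY fun y hy => ?_
      simpa using hs _ (hX (List.mem_map_of_mem hy))
    · simp only [List.mem_singleton, forall_eq, sem_quotCode] at hY ⊢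
      exact fun s hs => hY s fun z hz => hs z (hX' hz)
    · obtain ⟨x, o, x'⟩ := e
      obtain rfl : o = _ := hop
      rw [sem_quotCode]
      exact fun s hs => h.edges _ _ _ he _ _ (.here (.cons _ _)) (hs _ hX)
    · obtain ⟨x, o, x'⟩ := e
      obtain rfl : o = _ := hop
      simp only [List.mem_cons, List.mem_map, forall_eq_or_imp, forall_exists_index, and_imp,
        forall_apply_eq_imp_iff₂, sem_quotCode] at hY ⊢
      exact fun s hs => h.edges _ _ _ he _ _ (.here (.cons _ _))
        (hY.1 _ fun z hz => hY.2 z hz s hs)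
  · intro x o x' he u u' hs hu'
    simp only [layer_succ, Layer.next, List.mem_flatMap, List.mem_map, List.mem_filter,
      Prod.mk.injEq] at he
    obtain ⟨e, ⟨he, -⟩, X, hX, rfl, rfl, rfl⟩ := he
    rw [sem_quotCode] at hu' ⊢
    exact fun s hX => h.edges _ _ _ he _ _ (stepAt_cons hs s) (hu' s hX)
  · intro x K w he a t u htop ht
    simp only [layer_succ, Layer.next, List.mem_append, List.mem_flatMap, List.mem_map,
      List.mem_filter, beq_iff_eq, Prod.mk.injEq, hk] at he
    obtain ⟨c, hc, X, hX, rfl, hc2⟩ := he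
    rw [sem_quotCode]
    intro s _
    rcases hc with hc | ⟨⟨x, o, x'⟩, ⟨he, hop⟩, rfl⟩
    · obtain ⟨x, K', w'⟩ := c
      obtain ⟨rfl, rfl⟩ : K' = K ∧ w' = w := by simpa using hc2
      exact h.collapses _ _ _ hc _ _ _ (.cons s htop) ht
    · obtain rfl : o = _ := hop
      obtain ⟨rfl, rfl⟩ : k + 2 = K ∧ x' = w := by simpa using hc2
      rw [show A.order - (k + 2) = d by omega] at ht
      exact h.edges _ _ _ he _ _ (.here ⟨a, .cons s htop⟩) ht
  · intro x K V x' he a j ann u htop hv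
    simp only [layer_succ, Layer.next, List.mem_append, List.mem_flatMap, List.mem_map,
      List.mem_filter, beq_iff_eq, Prod.mk.injEq, hk] at he
    rcases he with ⟨⟨x, KV, x'⟩, hc, X, hX, rfl, rfl, rfl⟩ |
      ⟨⟨x, o, x'⟩, ⟨he, hop⟩, X, hX, rfl, ⟨rfl, rfl⟩, rfl⟩
    · rw [sem_quotCode]
      intro s hs
      refine h.cpushes _ _ _ _ hc _ _ _ _ (.cons s htop) fun v hV => ?_
      obtain ⟨u', hu, hu'⟩ := hv v hV
      rw [sem_quotCode] at hu'
      exact ⟨_, .cons s hu, hu' s hs⟩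
    · obtain rfl : o = _ := hop
      rw [sem_quotCode]
      intro s hs
      rw [show A.order - (k + 2) = d by omega] at hv
      -- The new symbol is annotated by the remainder `s` itself.
      obtain ⟨u', hu, hu'⟩ := hv s hs
      rw [sem_quotCode] at hu'
      exact h.edges _ _ _ he _ _
        (.here ⟨a, j, ann, s, .cons s htop, .cons _ _, .cons s hu⟩) (hu' s hs)

theorem layerSound (d k : ℕ) (hd : d + (k + 1) = A.order) : A.LayerSound d (k + 1) := by
  induction d generalizing k with
  | zero =>
    obtain h : k + 1 = A.order := by omega
    rw [h]
    exact layerSound_zero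
  | succ d ih => exact layerSound_succ (by omega) (ih (k + 1) (by omega))

/-- The derived transitions of order `1` are true of the intended meaning, by induction on their
derivation. -/
theorem sem_sym_of_mem_symTrans (hn : 1 ≤ A.order) {t : ℕ × ℕ × (ℕ × List ℕ) × List ℕ}
    (ht : t ∈ A.saturate.symTrans) (j : ℕ) (hj : j ≤ A.order) (ann : AnnStack A.order j)
    (s : AnnStack A.order 1)
    (hB : ∀ y ∈ t.2.2.1.2, j = t.2.2.1.1 ∧ A.Sem (A.order - j) ann y)
    (hX : ∀ y ∈ t.2.2.2, A.Sem (A.order - 1) s y) :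
    A.Sem (A.order - 1) (.sym t.2.1 hj ann s) t.1 := by
  have hl : A.LayerSound (A.order - 1) 1 := layerSound _ 0 (by omega)
  revert j
  refine lfp_induction (P := fun t : ℕ × ℕ × (ℕ × List ℕ) × List ℕ =>
    ∀ j (hj : j ≤ A.order) (ann : AnnStack A.order j) (s : AnnStack A.order 1),
    (∀ y ∈ t.2.2.1.2, j = t.2.2.1.1 ∧ A.Sem (A.order - j) ann y) →
    (∀ y ∈ t.2.2.2, A.Sem (A.order - 1) s y) → A.Sem (A.order - 1) (.sym t.2.1 hj ann s) t.1)
    ?_ t ht |> fun h j hj ann hB => h j hj ann s hB hX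
  clear ht hX s t
  rintro T hT ⟨x, a, ⟨k, B⟩, X⟩ - ih hstep j hj ann s hB hX
  simp only [symStep, Bool.or_eq_true] at hstep
  simp only at hB hX ⊢
  rcases hstep with (hstep | hstep) | hstep
  · simp only [symWeaken, List.any_append, Bool.or_eq_true, List.any_eq_true, Bool.and_eq_true,
      beq_iff_eq, List.isEmpty_iff, subsetB_iff, List.mem_map] at hstep
    rcases hstep with ⟨_, ⟨⟨x, a, ⟨k', B'⟩, X'⟩, hu, rfl⟩, ⟨⟨⟨rfl, rfl⟩, hk⟩, hBB⟩, hXX⟩ |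
      ⟨⟨x, a, ⟨k', B'⟩, X'⟩, hu, ⟨⟨⟨rfl, rfl⟩, hk⟩, hBB⟩, hXX⟩
    · simp only [List.map_eq_nil_iff] at hk hBB hXX ⊢
      rw [sem_baseCode]
      refine .sym hu (fun y hy => ?_) (fun y hy => ?_) fun y hy => ?_
      · rcases hk with rfl | rfl
        · simp at hy
        · exact (hB _ (hBB (List.mem_map_of_mem hy))).1
      · simpa using (hB _ (hBB (List.mem_map_of_mem hy))).2
      · simpa using hX _ (hXX (List.mem_map_of_mem hy))
    · simp only at hk hBB hXX ⊢
      refine ih _ hu j hj ann s (fun y hy => ?_) fun y hy => hX y (hXX hy)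
      rcases hk with rfl | rfl
      · simp at hy
      · exact hB y (hBB hy)
  · simp only [symLayer, Bool.or_eq_true, List.any_eq_true, Bool.and_eq_true, List.all_eq_true,
      List.contains_iff_mem, beq_iff_eq] at hstep
    rcases hstep with (⟨⟨x, Y⟩, he, rfl, hY⟩ | ⟨⟨x, K, w⟩, hc, ⟨rfl, rfl⟩, hw⟩) |
      ⟨⟨x, ⟨K, V⟩, x'⟩, hc, rfl, ⟨y, b, ⟨K', V'⟩, X'⟩, hu, ⟨⟨rfl, rfl⟩, hKV⟩, hall⟩
    · exact hl.eps _ _ he _ fun y hy => ih _ (hY y hy) j hj ann s hB hX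
    · obtain ⟨rfl, h⟩ := hB _ hw
      exact hl.collapses _ _ _ hc a ann _ (.sym hj s) h
    · obtain ⟨rfl, rfl⟩ : K' = K ∧ V' = V := by simpa using hKV
      refine hl.cpushes _ _ _ _ hc b _ ann _ (.sym hj s) fun v hv => ?_
      have hK : K' ≤ A.order := (order_of_mem_symCands (hT hu)).2
      refine ⟨_, .here (.place hK _), ih _ hu _ hK v _ (fun y hy => ⟨rfl, hv y hy⟩) ?_⟩
      exact fun y hy => ih _ (hall y hy) j hj ann s hB hX
  · simp only [symEdge, Bool.or_eq_true, List.any_eq_true, Bool.and_eq_true, List.all_eq_true,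
      List.contains_iff_mem, beq_iff_eq, subsetB_iff] at hstep
    obtain ⟨⟨x, o, x'⟩, he, rfl, h⟩ := hstep
    simp only at h
    rcases h with ((⟨rfl, h⟩ | ⟨⟨rfl, rfl⟩, h⟩) | ⟨⟨y, b, B', X'⟩, hu, ⟨rfl, rfl⟩, h⟩) |
      ⟨rfl, ⟨y, b, ⟨K', V'⟩, X'⟩, hu, ⟨⟨⟨rfl, rfl⟩, hK⟩, hV⟩, hall⟩
    · exact hl.edges _ _ _ he _ _ (.here (.sym a hj ann s)) (hX _ h)
    · obtain ⟨rfl, h⟩ := hB _ h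
      exact hl.edges _ _ _ he _ _ (.here ⟨a, .sym hj s⟩) h
    · obtain ⟨rfl, rfl⟩ : B' = (k, B) ∧ X' = X := by simpa using h
      exact hl.edges _ _ _ he _ _ (.here (.sym hj ann s)) (ih _ hu j hj ann s hB hX)
    · obtain rfl : K' = 1 := hK
      refine hl.edges _ _ _ he _ _
        (.here ⟨b, j, ann, s, .sym hj s, .sym b hj ann s, .here (.place hn _)⟩) ?_
      refine ih _ hu 1 hn s _ (fun y hy => ⟨rfl, hX _ (hV hy)⟩) ?_
      exact fun y hy => ih _ (hall y hy) j hj ann s hB hX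

theorem sem_of_accepts {k d : ℕ} (hd : d + k = A.order) {u : AnnStack A.order k} {x : ℕ}
    (h : A.saturate.AcceptsStack u x) : A.Sem d u x := by
  induction u generalizing d x with
  | empty k =>
    rw [StackTreeAutomaton.AcceptsStack] at h
    refine lfp_induction (P := fun t : ℕ × ℕ => ∀ k d, d + (k + 1) = A.order → t.1 = k + 1 →
      A.Sem d (.empty k) t.2) ?_ _ h k d hd rfl
    rintro T - ⟨j, x⟩ - ih hstep k d hd rfl
    simp only [finStep, Bool.or_eq_true, List.any_eq_true, Bool.and_eq_true, List.all_eq_true,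
      List.contains_iff_mem, List.mem_range, beq_iff_eq, Prod.mk.injEq] at hstep
    rcases hstep with ⟨⟨j, b⟩, hf, rfl, rfl⟩ | ⟨d', hd', h1, ⟨x, Y⟩, he, rfl, hY⟩
    · exact sem_baseCode.2 (.empty hf)
    · obtain rfl : d' = d := by omega
      exact (layerSound _ _ hd).eps _ _ he _ fun y hy => ih _ (hY y hy) k _ hd rfl
  | sym a hj ann s ih1 ih2 =>
    obtain rfl : d = A.order - 1 := by omega
    rw [StackTreeAutomaton.AcceptsStack] at h
    obtain ⟨k, B, X, h, hB, hX⟩ := h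
    exact sem_sym_of_mem_symTrans (by omega) h _ hj ann s
      (fun y hy => ⟨(hB y hy).1, ih1 (by omega) (hB y hy).2⟩) fun y hy => ih2 hd (hX y hy)
  | cons top s ih1 ih2 =>
    rw [StackTreeAutomaton.AcceptsStack] at h
    obtain ⟨x', X, h, h1, h2⟩ := h
    obtain ⟨hx, hX, rfl⟩ := (mem_stackTrans hd).1 h
    exact sem_quotCode.1 (ih1 (d := d + 1) (by omega) h1) s fun z hz => ih2 hd (h2 z hz)

/-- The constructed automaton accepts from the base states exactly the consequences of the
rules. -/
theorem saturate_accepts_iff (hA : A.WF) {u : AnnStack A.order A.order} (hu : u.Over A.alphabet)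
    {x : ℕ} : A.saturate.AcceptsStack u (baseCode x) ↔ A.Acc u x :=
  ⟨fun h => sem_baseCode.1 (sem_of_accepts (d := 0) (by omega) h),
    accepts_of_acc hA le_rfl hu⟩

theorem saturate_valid (hA : A.WF) {controls : List ℕ}
    (hv : A.base.Valid A.order A.alphabet controls) :
    A.saturate.Valid A.order A.alphabet controls where
  controls_subset := hv.controls_subset
  treeFinals_subset := hv.treeFinals_subset
  treeTrans_mem := by
    intro q i m q' x h
    simp only [saturate, List.mem_map, Prod.mk.injEq] at h
    obtain ⟨⟨q, i, m, q', x⟩, h, rfl, rfl, rfl, rfl, rfl⟩ := h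
    obtain ⟨h1, h2, h3, h4, h5, h6⟩ := hv.treeTrans_mem _ _ _ _ _ h
    exact ⟨h1, h2, h3, h4, h5, (mem_satStates (d := 0) (by omega) hA.one_le_order).2
      (baseCode_mem_states (by omega) h6)⟩
  stackStates_order := by
    intro k x h
    simp only [saturate, satStates, List.mem_flatMap, List.mem_range, List.mem_map,
      Prod.mk.injEq] at h
    obtain ⟨d, hd, x, hx, rfl, rfl⟩ := h
    omega
  stackFinals_subset := fun y hy => lfp_subset hy
  stackTrans_mem := by
    intro k x x' X h
    have h' := h
    simp only [saturate, List.mem_flatMap, List.mem_range, List.mem_map, Prod.mk.injEq] at h'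
    obtain ⟨d, hd, -, -, -, -, rfl, -, -, -⟩ := h'
    obtain ⟨k, hk⟩ : ∃ k, A.order - d = k + 2 := ⟨A.order - d - 2, by omega⟩
    rw [hk] at h ⊢
    have hd : d + (k + 2) = A.order := by omega
    obtain ⟨hx, hX, rfl⟩ := (mem_stackTrans hd).1 h
    refine ⟨by omega, by omega, (mem_satStates hd (by omega)).2 hx, ?_, fun y hy => ?_⟩
    · exact (mem_satStates (d := d + 1) (by omega) (by omega)).2 (quotCode_mem_states hx hX)
    · exact (mem_satStates hd (by omega)).2 (subset_of_mem_subs hX hy)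
  symTrans_mem := by
    intro x a k B X h
    have hc := lfp_subset h
    have ho := order_of_mem_symCands hc
    have hd : A.order - k + k = A.order := by omega
    have h1 : A.order - 1 + 1 = A.order := by have := hA.one_le_order; omega
    obtain ⟨hx, ha, hB, hX⟩ := (mem_symCands hd ho.1).1 hc
    exact ⟨(mem_satStates h1 le_rfl).2 hx, ha, ho.1, ho.2,
      fun y hy => (mem_satStates hd ho.1).2 (subset_of_mem_subs hB hy),
      fun y hy => (mem_satStates h1 le_rfl).2 (subset_of_mem_subs hX hy)⟩

end AltSystem

/-! ### One round of context-bounded reachability: the construction -/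

/-- Labels of tree nodes in the automaton for one round, that is, for runs of local rules that
may be followed by one switching rule.
* `orig W q`: as `q` in the automaton `W`.
* `sat W q`: as `q` in `W`, after some local rules.
* `shot r W q d i`: as `q` in `W`, for a node with `d` children, after some local rules and one
  application of `r` inside the `i`-th child.
* `forest ps`: for a node whose children can be turned into leaves with the control states `ps`
  by local rules. -/
inductive Label
  | orig (W : StackTreeAutomaton) (q : ℕ)
  | sat (W : StackTreeAutomaton) (q : ℕ)
  | shot (r : TreeOp) (W : StackTreeAutomaton) (q d i : ℕ)
  | forest (ps : List ℕ)

namespace Label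

/-- The labels as a sum type, which provides their encoding by numbers. -/
def equivSum : Label ≃ (StackTreeAutomaton × ℕ) ⊕ (StackTreeAutomaton × ℕ) ⊕
    (TreeOp × StackTreeAutomaton × ℕ × ℕ × ℕ) ⊕ List ℕ where
  toFun
    | orig W q => .inl (W, q)
    | sat W q => .inr (.inl (W, q))
    | shot r W q d i => .inr (.inr (.inl (r, W, q, d, i)))
    | forest ps => .inr (.inr (.inr ps))
  invFun
    | .inl (W, q) => orig W q
    | .inr (.inl (W, q)) => sat W q
    | .inr (.inr (.inl (r, W, q, d, i))) => shot r W q d i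
    | .inr (.inr (.inr ps)) => forest ps
  left_inv x := by cases x <;> rfl
  right_inv x := by rcases x with ⟨W, q⟩ | ⟨W, q⟩ | ⟨r, W, q, d, i⟩ | ps <;> rfl

instance : Primcodable Label := Primcodable.ofEquiv _ equivSum

variable {α : Type*} [Primcodable α]

@[fun_prop]
theorem primrec_orig {f : α → StackTreeAutomaton} {g : α → ℕ} (hf : Primrec f) (hg : Primrec g) :
    Primrec fun a => orig (f a) (g a) :=
  (Primrec.of_equiv_symm (e := equivSum)).comp (Primrec.sumInl.comp (hf.pair hg))

@[fun_prop]
theorem primrec_sat {f : α → StackTreeAutomaton} {g : α → ℕ} (hf : Primrec f) (hg : Primrec g) :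
    Primrec fun a => sat (f a) (g a) :=
  (Primrec.of_equiv_symm (e := equivSum)).comp
    (Primrec.sumInr.comp (Primrec.sumInl.comp (hf.pair hg)))

@[fun_prop]
theorem primrec_shot {e : α → TreeOp} {f : α → StackTreeAutomaton} {g h k : α → ℕ}
    (he : Primrec e) (hf : Primrec f) (hg : Primrec g) (hh : Primrec h) (hk : Primrec k) :
    Primrec fun a => shot (e a) (f a) (g a) (h a) (k a) :=
  (Primrec.of_equiv_symm (e := equivSum)).comp (Primrec.sumInr.comp (Primrec.sumInr.comp
    (Primrec.sumInl.comp (he.pair (hf.pair (hg.pair (hh.pair hk)))))))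

@[fun_prop]
theorem primrec_forest {f : α → List ℕ} (hf : Primrec f) : Primrec fun a => forest (f a) :=
  (Primrec.of_equiv_symm (e := equivSum)).comp
    (Primrec.sumInr.comp (Primrec.sumInr.comp (Primrec.sumInr.comp hf)))

end Label

/-- A context `(ℓ, i, m)` is a position in a tree: that of the `i`-th of `m` children of a node
labelled `ℓ`. -/
abbrev Ctx := Label × ℕ × ℕ

/-- The state of the union automaton for the state `x` of `W`. -/
def autCode (W : StackTreeAutomaton) (x : ℕ) : ℕ :=
  encode (Sum.inl (W, x) : (StackTreeAutomaton × ℕ) ⊕ (Ctx × ℕ))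

/-- The state that holds of the stack `s` if the leaf `(p, s)` is accepted in the context `c`. -/
def leafCode (c : Ctx) (p : ℕ) : ℕ :=
  encode (Sum.inr (c, p) : (StackTreeAutomaton × ℕ) ⊕ (Ctx × ℕ))

@[simp]
theorem autCode_inj {W W' : StackTreeAutomaton} {x x' : ℕ} :
    autCode W x = autCode W' x' ↔ W = W' ∧ x = x' := by
  simp only [autCode, Encodable.encode_inj, Sum.inl.injEq, Prod.mk.injEq]

@[simp]
theorem leafCode_inj {c c' : Ctx} {p p' : ℕ} : leafCode c p = leafCode c' p' ↔ c = c' ∧ p = p' := by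
  simp only [leafCode, Encodable.encode_inj, Sum.inr.injEq, Prod.mk.injEq]

@[simp]
theorem autCode_ne_leafCode {W : StackTreeAutomaton} {x p : ℕ} {c : Ctx} :
    autCode W x ≠ leafCode c p := by
  simp only [autCode, leafCode, ne_eq, Encodable.encode_inj, reduceCtorEq, not_false_eq_true]

@[simp]
theorem leafCode_ne_autCode {W : StackTreeAutomaton} {x p : ℕ} {c : Ctx} :
    leafCode c p ≠ autCode W x := autCode_ne_leafCode.symm

/-- The labels and stack states that the automaton `W` allows for the `i`-th of `m` children of a
node labelled `q`. -/
def StackTreeAutomaton.succs (W : StackTreeAutomaton) (q i m : ℕ) : List (ℕ × ℕ) :=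
  (W.treeTrans.filter fun t => t.1 == q && t.2.1 == i && t.2.2.1 == m).map fun t => t.2.2.2

@[simp]
theorem StackTreeAutomaton.mem_succs {W : StackTreeAutomaton} {q i m : ℕ} {y : ℕ × ℕ} :
    y ∈ W.succs q i m ↔ (q, i, m, y) ∈ W.treeTrans := by
  simp only [succs, List.mem_map, List.mem_filter, Bool.and_eq_true, beq_iff_eq]
  constructor
  · rintro ⟨⟨q, i, m, y⟩, ⟨h, ⟨rfl, rfl⟩, rfl⟩, rfl⟩
    exact h
  · exact fun h => ⟨_, ⟨h, ⟨rfl, rfl⟩, rfl⟩, rfl⟩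

/-- The data of one round: runs use the rules in `locals`; they end either in a tree accepted by
`target`, or with the rule `r` leading into a tree accepted by `W`, where `(r, W) ∈ switches`. -/
structure Round where
  order : ℕ
  alphabet : List ℕ
  controls : List ℕ
  locals : List TreeOp
  target : StackTreeAutomaton
  switches : List (TreeOp × StackTreeAutomaton)

namespace Round

variable (R : Round)

/-- All automata that the construction builds on. -/
def automata : List StackTreeAutomaton := R.target :: R.switches.map Prod.snd

/-- The number of a tree state: a label gets a number greater than all control states. -/
def labelCode (ℓ : Label) : ℕ := R.controls.foldr (fun p m => p + m) 0 + 1 + encode ℓ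

/-- `(c, W, q, i, m)`: the context `c` means the context `(q, i, m)` of `W`, after local rules. -/
def inherits : List (Ctx × StackTreeAutomaton × ℕ × ℕ × ℕ) :=
  (R.automata.flatMap fun W => W.treeTrans.map fun t =>
    ((Label.sat W t.1, t.2.1, t.2.2.1), W, t.1, t.2.1, t.2.2.1)) ++
  (R.switches.flatMap fun w => w.2.treeTrans.flatMap fun t =>
    (w.2.treeTrans.filter fun u => u.1 == t.1 && u.2.2.1 == t.2.2.1 && !(u.2.1 == t.2.1)).map
      fun u => ((Label.shot w.1 w.2 t.1 t.2.2.1 t.2.1, u.2.1, t.2.2.1), w.2, t.1, u.2.1, t.2.2.1))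

/-- `(c, r, W, q, i, m)`: the context `c` means the context `(q, i, m)` of `W`, after local rules
and one application of `r`. -/
def shots : List (Ctx × TreeOp × StackTreeAutomaton × ℕ × ℕ × ℕ) :=
  R.switches.flatMap fun w => w.2.treeTrans.map fun t =>
    ((Label.shot w.1 w.2 t.1 t.2.2.1 t.2.1, t.2.1, t.2.2.1), w.1, w.2, t.1, t.2.1, t.2.2.1)

/-- `(c, p)`: the context `c` requires that local rules lead to a leaf with control state `p`. -/
def forests : List (Ctx × ℕ) :=
  (R.locals ++ R.switches.map Prod.fst).flatMap fun r => r.popData.flatMap fun x =>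
    (List.range x.1.length).map fun k => ((Label.forest x.1, k + 1, x.1.length), x.1.getI k)

/-- The contexts of the constructed automaton. -/
def ctxs : List Ctx :=
  R.inherits.map Prod.fst ++ R.shots.map Prod.fst ++ R.forests.map Prod.fst

/-- `(c, W, q, i, m)`: the context `c` means the context `(q, i, m)` of `W`. -/
def origs : List (Ctx × StackTreeAutomaton × ℕ × ℕ × ℕ) :=
  R.automata.flatMap fun W => W.treeTrans.map fun t =>
    ((Label.orig W t.1, t.2.1, t.2.2.1), W, t.1, t.2.1, t.2.2.1)

/-- `(c, ℓ, x)`: the context `c` allows a node labelled `ℓ` with a stack accepted from `x`. A node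
with the stack `s` that local rules turn into a leaf `(p, s)` is allowed if that leaf is. -/
def arrows : List (Ctx × Label × ℕ) :=
  (R.inherits.flatMap fun c => (c.2.1.succs c.2.2.1 c.2.2.2.1 c.2.2.2.2).map fun y =>
    (c.1, Label.sat c.2.1 y.1, autCode c.2.1 y.2)) ++
  (R.shots.flatMap fun c => (c.2.2.1.succs c.2.2.2.1 c.2.2.2.2.1 c.2.2.2.2.2).flatMap fun y =>
    (c.2.2.1.treeTrans.filter fun t => t.1 == y.1).map fun t =>
      (c.1, Label.shot c.2.1 c.2.2.1 y.1 t.2.2.1 t.2.1, autCode c.2.2.1 y.2)) ++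
  (R.shots.flatMap fun c => c.2.1.popData.flatMap fun z =>
    ((c.2.2.1.succs c.2.2.2.1 c.2.2.2.2.1 c.2.2.2.2.2).filter fun y => y.1 == z.2).map fun y =>
      (c.1, Label.forest z.1, autCode c.2.2.1 y.2)) ++
  (R.ctxs.flatMap fun c => R.locals.flatMap fun r => r.popData.map fun z =>
    (c, Label.forest z.1, leafCode c z.2))

/-- The `eps` rules: a leaf is accepted where one of the given automata accepts it, or where the
node resulting from it by a rule creating children is accepted. -/
def eps : List (ℕ × List ℕ) :=
  ((R.inherits ++ R.origs).flatMap fun c =>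
    ((c.2.1.succs c.2.2.1 c.2.2.2.1 c.2.2.2.2).filter fun y => R.controls.contains y.1).map
      fun y => (leafCode c.1 y.1, [autCode c.2.1 y.2])) ++
  (R.forests.map fun c => (leafCode c.1 c.2, [])) ++
  (R.arrows.flatMap fun e => R.locals.flatMap fun r => r.pushData.map fun z =>
    (leafCode e.1 z.1, e.2.2 :: (List.range z.2.length).map fun k =>
      leafCode (e.2.1, k + 1, z.2.length) (z.2.getI k))) ++
  (R.shots.flatMap fun c => c.2.1.pushData.flatMap fun z =>
    (c.2.2.1.succs c.2.2.2.1 c.2.2.2.2.1 c.2.2.2.2.2).map fun y =>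
      (leafCode c.1 z.1, autCode c.2.2.1 y.2 :: (List.range z.2.length).map fun k =>
        leafCode (Label.orig c.2.2.1 y.1, k + 1, z.2.length) (z.2.getI k)))

/-- The stack operations at leaves: local ones, and switching ones, after which no further rule
is applied. -/
def edges : List (ℕ × StackOp × ℕ) :=
  (R.ctxs.flatMap fun c => R.locals.flatMap fun r => r.sopData.map fun z =>
    (leafCode c z.1, z.2.1, leafCode c z.2.2)) ++
  (R.shots.flatMap fun c => c.2.1.sopData.map fun z =>
    (leafCode c.1 z.1, z.2.1,
      leafCode (Label.orig c.2.2.1 c.2.2.2.1, c.2.2.2.2.1, c.2.2.2.2.2) z.2.2))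

/-- The accepting labels: `shot r W q 1 1` regards the root as the only child of a node labelled
by the final state `q` of `W`. -/
def finals : List Label :=
  (R.target.treeFinals.map fun q => Label.sat R.target q) ++
    R.switches.flatMap fun w => w.2.treeFinals.map fun q => Label.shot w.1 w.2 q 1 1

/-- The tree automaton before saturation. Its stack part is the disjoint union of those of the
given automata, with a state without transitions for each leaf condition. -/
def base : StackTreeAutomaton where
  treeStates := R.controls ++ (R.ctxs.map fun c => R.labelCode c.1) ++
    (R.arrows.map fun e => R.labelCode e.2.1) ++ R.finals.map R.labelCode
  treeTrans :=
    (R.arrows.map fun e => (R.labelCode e.1.1, e.1.2.1, e.1.2.2, R.labelCode e.2.1, e.2.2)) ++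
    R.ctxs.flatMap fun c => R.controls.map fun p =>
      (R.labelCode c.1, c.2.1, c.2.2, p, leafCode c p)
  treeFinals := R.finals.map R.labelCode
  stackStates :=
    (R.automata.flatMap fun W => W.stackStates.map fun y => (y.1, autCode W y.2)) ++
    (R.ctxs ++ R.origs.map Prod.fst).flatMap fun c => R.controls.map fun p =>
      (R.order, leafCode c p)
  stackTrans := R.automata.flatMap fun W => W.stackTrans.map fun t =>
    (t.1, autCode W t.2.1, autCode W t.2.2.1, t.2.2.2.map (autCode W))
  symTrans := R.automata.flatMap fun W => W.symTrans.map fun t =>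
    (autCode W t.1, t.2.1, (t.2.2.1.1, t.2.2.1.2.map (autCode W)), t.2.2.2.map (autCode W))
  stackFinals := R.automata.flatMap fun W => W.stackFinals.map fun y => (y.1, autCode W y.2)

/-- The alternating system of a round. -/
abbrev system : AltSystem where
  order := R.order
  alphabet := R.alphabet
  base := R.base
  eps := R.eps
  edges := R.edges

/-- The automaton for one round. -/
def automaton : StackTreeAutomaton := R.system.saturate

end Round

section Primrec

variable {α : Type*} [Primcodable α]

@[fun_prop]
theorem primrec_autCode {f : α → StackTreeAutomaton} {g : α → ℕ} (hf : Primrec f)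
    (hg : Primrec g) : Primrec fun a => autCode (f a) (g a) := by
  unfold autCode; fun_prop

@[fun_prop]
theorem primrec_leafCode {f : α → Ctx} {g : α → ℕ} (hf : Primrec f)
    (hg : Primrec g) : Primrec fun a => leafCode (f a) (g a) := by
  unfold leafCode; fun_prop

@[fun_prop]
theorem StackTreeAutomaton.primrec_succs {f : α → StackTreeAutomaton} {g h k : α → ℕ}
    (hf : Primrec f) (hg : Primrec g) (hh : Primrec h) (hk : Primrec k) :
    Primrec fun a => (f a).succs (g a) (h a) (k a) := by
  unfold succs; fun_prop

namespace Round

/-- The data of a round as a tuple, which provides its encoding by numbers. -/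
def equivProd : Round ≃ ℕ × List ℕ × List ℕ × List TreeOp × StackTreeAutomaton ×
    List (TreeOp × StackTreeAutomaton) where
  toFun R := (R.order, R.alphabet, R.controls, R.locals, R.target, R.switches)
  invFun x := ⟨x.1, x.2.1, x.2.2.1, x.2.2.2.1, x.2.2.2.2.1, x.2.2.2.2.2⟩
  left_inv _ := rfl
  right_inv _ := rfl

instance : Primcodable Round := Primcodable.ofEquiv _ equivProd

theorem primrec_equivProd : Primrec equivProd := Primrec.of_equiv

variable {f : α → Round}

@[fun_prop]
theorem primrec_order (hf : Primrec f) : Primrec fun a => (f a).order :=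
  Primrec.fst.comp (primrec_equivProd.comp hf)

@[fun_prop]
theorem primrec_alphabet (hf : Primrec f) : Primrec fun a => (f a).alphabet :=
  (Primrec.fst.comp Primrec.snd).comp (primrec_equivProd.comp hf)

@[fun_prop]
theorem primrec_controls (hf : Primrec f) : Primrec fun a => (f a).controls :=
  (Primrec.fst.comp (Primrec.snd.comp Primrec.snd)).comp (primrec_equivProd.comp hf)

@[fun_prop]
theorem primrec_locals (hf : Primrec f) : Primrec fun a => (f a).locals :=
  (Primrec.fst.comp (Primrec.snd.comp (Primrec.snd.comp Primrec.snd))).comp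
    (primrec_equivProd.comp hf)

@[fun_prop]
theorem primrec_target (hf : Primrec f) : Primrec fun a => (f a).target :=
  (Primrec.fst.comp (Primrec.snd.comp (Primrec.snd.comp (Primrec.snd.comp Primrec.snd)))).comp
    (primrec_equivProd.comp hf)

@[fun_prop]
theorem primrec_switches (hf : Primrec f) : Primrec fun a => (f a).switches :=
  (Primrec.snd.comp (Primrec.snd.comp (Primrec.snd.comp (Primrec.snd.comp Primrec.snd)))).comp
    (primrec_equivProd.comp hf)

@[fun_prop]
theorem primrec_mk {f₁ : α → ℕ} {f₂ f₃ : α → List ℕ} {f₄ : α → List TreeOp}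
    {f₅ : α → StackTreeAutomaton} {f₆ : α → List (TreeOp × StackTreeAutomaton)} (h₁ : Primrec f₁)
    (h₂ : Primrec f₂) (h₃ : Primrec f₃) (h₄ : Primrec f₄) (h₅ : Primrec f₅) (h₆ : Primrec f₆) :
    Primrec fun a => Round.mk (f₁ a) (f₂ a) (f₃ a) (f₄ a) (f₅ a) (f₆ a) :=
  (Primrec.of_equiv_symm (e := equivProd)).comp
    (by fun_prop : Primrec fun a => (f₁ a, f₂ a, f₃ a, f₄ a, f₅ a, f₆ a))

@[fun_prop]
theorem primrec_automata (hf : Primrec f) : Primrec fun a => (f a).automata := by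
  unfold automata; fun_prop

@[fun_prop]
theorem primrec_labelCode {g : α → Label} (hf : Primrec f) (hg : Primrec g) :
    Primrec fun a => (f a).labelCode (g a) := by
  unfold labelCode; fun_prop

@[fun_prop]
theorem primrec_inherits (hf : Primrec f) : Primrec fun a => (f a).inherits := by
  unfold inherits; fun_prop

@[fun_prop]
theorem primrec_shots (hf : Primrec f) : Primrec fun a => (f a).shots := by
  unfold shots; fun_prop

@[fun_prop]
theorem primrec_forests (hf : Primrec f) : Primrec fun a => (f a).forests := by
  unfold forests; fun_prop

@[fun_prop]
theorem primrec_ctxs (hf : Primrec f) : Primrec fun a => (f a).ctxs := by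
  unfold ctxs; fun_prop

@[fun_prop]
theorem primrec_origs (hf : Primrec f) : Primrec fun a => (f a).origs := by
  unfold origs; fun_prop

@[fun_prop]
theorem primrec_arrows (hf : Primrec f) : Primrec fun a => (f a).arrows := by
  unfold arrows; fun_prop

@[fun_prop]
theorem primrec_eps (hf : Primrec f) : Primrec fun a => (f a).eps := by
  unfold eps; fun_prop

@[fun_prop]
theorem primrec_edges (hf : Primrec f) : Primrec fun a => (f a).edges := by
  unfold edges; fun_prop

@[fun_prop]
theorem primrec_finals (hf : Primrec f) : Primrec fun a => (f a).finals := by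
  unfold finals; fun_prop

@[fun_prop]
theorem primrec_base (hf : Primrec f) : Primrec fun a => (f a).base := by
  unfold base; fun_prop

@[fun_prop]
theorem primrec_automaton (hf : Primrec f) : Primrec fun a => (f a).automaton := by
  unfold automaton system; fun_prop

end Round

end Primrec

/-! ### One round of context-bounded reachability: soundness -/

/-- The tree `t` is allowed as the `i`-th of `m` children of a node labelled `q`. -/
def StackTreeAutomaton.Fits {n : ℕ} (A : StackTreeAutomaton) (q i m : ℕ) (t : StackTree n) :
    Prop :=
  ∃ q' x, (q, i, m, q', x) ∈ A.treeTrans ∧ A.Labels t q' ∧ A.AcceptsStack t.stack x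

theorem StackTreeAutomaton.labels_node {n : ℕ} {A : StackTreeAutomaton} {s : AnnStack n n}
    {m q : ℕ} {ts : Fin (m + 1) → StackTree n} :
    A.Labels (.node s m ts) q ↔ ∀ i : Fin (m + 1), A.Fits q (i.val + 1) (m + 1) (ts i) := by
  rw [StackTreeAutomaton.Labels]
  rfl

theorem StackTreeAutomaton.mem_lang_iff {n : ℕ} {A : StackTreeAutomaton} {Γ P : List ℕ}
    {t : StackTree n} :
    t ∈ A.lang Γ P ↔ t.Over Γ P ∧ ∃ q ∈ A.treeFinals, A.Fits q 1 1 t := by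
  refine and_congr_right fun _ => ⟨?_, ?_⟩
  · rintro ⟨q, q', x, hq, h⟩
    exact ⟨q, hq, q', x, h⟩
  · rintro ⟨q, hq, q', x, h⟩
    exact ⟨q, q', x, hq, h⟩

theorem StackTree.Step.over {n : ℕ} {Γ P : List ℕ} {r : TreeOp} (hr : r.Valid n Γ P)
    {t t' : StackTree n} (h : StackTree.Step r t t') (ht : t.Over Γ P) : t'.Over Γ P := by
  induction h with
  | sop p o p' h =>
    exact ⟨hr.2.2, AnnStack.StackOp.StepAt.over hr.2.1 (StackOp.stepAt_iff_step.2 h) ht.2⟩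
  | push p m ps s =>
    exact ⟨ht.2, fun i => ⟨hr.2.2 _ (List.mem_ofFn.2 ⟨i, rfl⟩), ht.2⟩⟩
  | pop m ps p s ss => exact ⟨hr.2.2, ht.1⟩
  | child s m ts i h ih =>
    refine ⟨ht.1, fun j => ?_⟩
    by_cases hj : j = i
    · subst hj
      simpa using ih hr (ht.2 j)
    · simpa [hj] using ht.2 j

namespace Round

variable {R : Round}

/-- One application of a local rule. -/
def LocalStep (R : Round) (t t' : StackTree R.order) : Prop :=
  ∃ r ∈ R.locals, StackTree.Step r t t'

/-- A sequence of applications of local rules. -/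
def Reach (R : Round) : StackTree R.order → StackTree R.order → Prop :=
  Relation.ReflTransGen R.LocalStep

theorem reach_update {s : AnnStack R.order R.order} {m : ℕ} {ts : Fin (m + 1) → StackTree R.order}
    {i : Fin (m + 1)} {t : StackTree R.order} (h : R.Reach (ts i) t) :
    R.Reach (.node s m ts) (.node s m (Function.update ts i t)) := by
  induction h with
  | refl => rw [Function.update_eq_self]; exact .refl
  | @tail t t' _ h ih =>
    obtain ⟨r, hr, h⟩ := h
    refine ih.tail ⟨r, hr, ?_⟩
    have := StackTree.Step.child (r := r) s m (Function.update ts i t) i (t' := t') (by simpa using h)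
    simpa using this

/-- Runs in the children of a node combine to a run of the whole tree. -/
theorem reach_node {s : AnnStack R.order R.order} {m : ℕ} {ts us : Fin (m + 1) → StackTree R.order}
    (h : ∀ i, R.Reach (ts i) (us i)) : R.Reach (.node s m ts) (.node s m us) := by
  have key (I : Finset (Fin (m + 1))) :
      R.Reach (.node s m ts) (.node s m fun i => if i ∈ I then us i else ts i) := by
    induction I using Finset.induction_on with
    | empty => simp only [Finset.notMem_empty, if_false]; exact .refl
    | insert j I hj ih =>
      refine ih.trans ?_
      have := reach_update (s := s) (i := j) (t := us j)
        (ts := fun i => if i ∈ I then us i else ts i) (by simpa [hj] using h j)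
      have heq : (fun i => if i ∈ insert j I then us i else ts i) =
          Function.update (fun i => if i ∈ I then us i else ts i) j (us j) := by
        funext i
        by_cases hij : i = j
        · subst hij; simp
        · simp [hij]
      rwa [heq]
  simpa using key Finset.univ

/-- The intended meaning of the context `(ℓ, i, m)`. -/
def CtxSem (R : Round) : Label → ℕ → ℕ → StackTree R.order → Prop
  | .orig W q, i, m, t => W.Fits q i m t
  | .sat W q, i, m, t => ∃ t₁, R.Reach t t₁ ∧ W.Fits q i m t₁
  | .shot r W q d j, i, m, t => m = d ∧ 1 ≤ j ∧ j ≤ d ∧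
      if i = j then ∃ t₁ t₂, R.Reach t t₁ ∧ StackTree.Step r t₁ t₂ ∧ W.Fits q i m t₂
      else ∃ t₁, R.Reach t t₁ ∧ W.Fits q i m t₁
  | .forest ps, i, m, t => m = ps.length ∧ ∃ s, R.Reach t (.leaf (ps.getI (i - 1)) s)

/-- The conditions under which the construction for a round is correct. -/
structure WF (R : Round) : Prop where
  one_le_order : 1 ≤ R.order
  automata_valid : ∀ W ∈ R.automata, W.Valid R.order R.alphabet R.controls
  locals_valid : ∀ r ∈ R.locals, r.Valid R.order R.alphabet R.controls
  switches_valid : ∀ w ∈ R.switches, w.1.Valid R.order R.alphabet R.controls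

theorem mem_automata_of_mem_switches {w : TreeOp × StackTreeAutomaton} (h : w ∈ R.switches) :
    w.2 ∈ R.automata :=
  List.mem_cons_of_mem _ (List.mem_map_of_mem h)

/-- The data of an element of `R.inherits`. -/
theorem mem_inherits {c : Ctx} {W : StackTreeAutomaton} {q i m : ℕ} :
    (c, W, q, i, m) ∈ R.inherits ↔
      (W ∈ R.automata ∧ c = (.sat W q, i, m) ∧ ∃ y, (q, i, m, y) ∈ W.treeTrans) ∨
      ∃ r j, (r, W) ∈ R.switches ∧ c = (.shot r W q m j, i, m) ∧ i ≠ j ∧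
        (∃ y, (q, j, m, y) ∈ W.treeTrans) ∧ ∃ y, (q, i, m, y) ∈ W.treeTrans := by
  simp only [inherits, List.mem_append, List.mem_flatMap, List.mem_map, List.mem_filter,
    Bool.and_eq_true, beq_iff_eq, Bool.not_eq_true', beq_eq_false_iff_ne, Prod.mk.injEq]
  constructor
  · rintro (⟨W, hW, ⟨q, i, m, y⟩, h, rfl, rfl, rfl, rfl, rfl⟩ |
      ⟨⟨r, W⟩, hw, ⟨q, j, m, y⟩, h, ⟨q', i, m', y'⟩, ⟨h', ⟨rfl, rfl⟩, hij⟩, rfl, rfl, rfl, rfl, rfl⟩)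
    · exact .inl ⟨hW, rfl, y, h⟩
    · exact .inr ⟨r, j, hw, rfl, hij, ⟨y, h⟩, y', h'⟩
  · rintro (⟨hW, rfl, y, h⟩ | ⟨r, j, hw, rfl, hij, ⟨y, h⟩, y', h'⟩)
    · exact .inl ⟨W, hW, _, h, rfl, rfl, rfl, rfl, rfl⟩
    · exact .inr ⟨_, hw, _, h, _, ⟨h', ⟨rfl, rfl⟩, hij⟩, rfl, rfl, rfl, rfl, rfl⟩

theorem mem_shots {c : Ctx} {r : TreeOp} {W : StackTreeAutomaton} {q i m : ℕ} :
    (c, r, W, q, i, m) ∈ R.shots ↔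
      (r, W) ∈ R.switches ∧ c = (.shot r W q m i, i, m) ∧ ∃ y, (q, i, m, y) ∈ W.treeTrans := by
  simp only [shots, List.mem_flatMap, List.mem_map, Prod.mk.injEq]
  constructor
  · rintro ⟨⟨r, W⟩, hw, ⟨q, i, m, y⟩, h, rfl, rfl, rfl, rfl, rfl, rfl⟩
    exact ⟨hw, rfl, y, h⟩
  · rintro ⟨hw, rfl, y, h⟩
    exact ⟨_, hw, _, h, rfl, rfl, rfl, rfl, rfl, rfl⟩

theorem mem_origs {c : Ctx} {W : StackTreeAutomaton} {q i m : ℕ} :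
    (c, W, q, i, m) ∈ R.origs ↔
      W ∈ R.automata ∧ c = (.orig W q, i, m) ∧ ∃ y, (q, i, m, y) ∈ W.treeTrans := by
  simp only [origs, List.mem_flatMap, List.mem_map, Prod.mk.injEq]
  constructor
  · rintro ⟨W, hW, ⟨q, i, m, y⟩, h, rfl, rfl, rfl, rfl, rfl⟩
    exact ⟨hW, rfl, y, h⟩
  · rintro ⟨hW, rfl, y, h⟩
    exact ⟨W, hW, _, h, rfl, rfl, rfl, rfl, rfl⟩

theorem mem_forests {c : Ctx} {p : ℕ} : (c, p) ∈ R.forests ↔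
    ∃ r ∈ R.locals ++ R.switches.map Prod.fst, ∃ ps p', r = .pop ps p' ∧ ∃ k < ps.length,
      c = (.forest ps, k + 1, ps.length) ∧ p = ps.getI k := by
  simp only [forests, List.mem_flatMap, List.mem_map, List.mem_range, TreeOp.mem_popData,
    Prod.mk.injEq]
  constructor
  · rintro ⟨r, hr, ⟨ps, p'⟩, rfl, k, hk, rfl, rfl⟩
    exact ⟨_, hr, ps, p', rfl, k, hk, rfl, rfl⟩
  · rintro ⟨r, hr, ps, p', rfl, k, hk, rfl, rfl⟩
    exact ⟨_, hr, (ps, p'), rfl, k, hk, rfl, rfl⟩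

theorem mem_arrows {c : Ctx} {ℓ : Label} {x : ℕ} : (c, ℓ, x) ∈ R.arrows ↔
    (∃ W q i m q' b, (c, W, q, i, m) ∈ R.inherits ∧ (q, i, m, q', b) ∈ W.treeTrans ∧
      ℓ = .sat W q' ∧ x = autCode W b) ∨
    (∃ r W q i m q' b d j y, (c, r, W, q, i, m) ∈ R.shots ∧ (q, i, m, q', b) ∈ W.treeTrans ∧
      (q', j, d, y) ∈ W.treeTrans ∧ ℓ = .shot r W q' d j ∧ x = autCode W b) ∨
    (∃ ps p W q i m b, (c, .pop ps p, W, q, i, m) ∈ R.shots ∧ (q, i, m, p, b) ∈ W.treeTrans ∧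
      ℓ = .forest ps ∧ x = autCode W b) ∨
    c ∈ R.ctxs ∧ ∃ ps p, .pop ps p ∈ R.locals ∧ ℓ = .forest ps ∧ x = leafCode c p := by
  simp only [arrows, List.mem_append, List.mem_flatMap, List.mem_map, List.mem_filter,
    StackTreeAutomaton.mem_succs, TreeOp.mem_popData, beq_iff_eq, Prod.mk.injEq]
  constructor
  · rintro (((⟨⟨c, W, q, i, m⟩, hc, ⟨q', b⟩, h, rfl, rfl, rfl⟩ |
      ⟨⟨c, r, W, q, i, m⟩, hc, ⟨q', b⟩, h, ⟨q'', j, d, y⟩, ⟨h', rfl⟩, rfl, rfl, rfl⟩) |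
      ⟨⟨c, r, W, q, i, m⟩, hc, ⟨ps, p⟩, rfl, ⟨q', b⟩, ⟨h, rfl⟩, rfl, rfl, rfl⟩) |
      ⟨c, hc, r, hr, ⟨ps, p⟩, rfl, rfl, rfl, rfl⟩)
    · exact .inl ⟨W, q, i, m, q', b, hc, h, rfl, rfl⟩
    · exact .inr (.inl ⟨r, W, q, i, m, q'', b, d, j, y, hc, h, h', rfl, rfl⟩)
    · exact .inr (.inr (.inl ⟨ps, q', W, q, i, m, b, hc, h, rfl, rfl⟩))
    · exact .inr (.inr (.inr ⟨hc, ps, p, hr, rfl, rfl⟩))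
  · rintro (⟨W, q, i, m, q', b, hc, h, rfl, rfl⟩ |
      ⟨r, W, q, i, m, q', b, d, j, y, hc, h, h', rfl, rfl⟩ |
      ⟨ps, p, W, q, i, m, b, hc, h, rfl, rfl⟩ | ⟨hc, ps, p, hr, rfl, rfl⟩)
    · exact .inl (.inl (.inl ⟨_, hc, (q', b), h, rfl, rfl, rfl⟩))
    · exact .inl (.inl (.inr ⟨_, hc, (q', b), h, _, ⟨h', rfl⟩, rfl, rfl, rfl⟩))
    · exact .inl (.inr ⟨_, hc, (ps, p), rfl, (p, b), ⟨h, rfl⟩, rfl, rfl, rfl⟩)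
    · exact .inr ⟨c, hc, _, hr, (ps, p), rfl, rfl, rfl, rfl⟩

theorem mem_ctxs {c : Ctx} : c ∈ R.ctxs ↔ (∃ W q i m, (c, W, q, i, m) ∈ R.inherits) ∨
    (∃ r W q i m, (c, r, W, q, i, m) ∈ R.shots) ∨ ∃ p, (c, p) ∈ R.forests := by
  simp only [ctxs, List.mem_append, List.mem_map, Prod.exists, exists_and_right, exists_eq_right,
    or_assoc]

theorem ctx_of_arrow {c : Ctx} {ℓ : Label} {x : ℕ} (h : (c, ℓ, x) ∈ R.arrows) : c ∈ R.ctxs := by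
  rw [mem_ctxs]
  rcases mem_arrows.1 h with ⟨W, q, i, m, q', b, hc, -⟩ |
      ⟨r, W, q, i, m, q', b, d, j, y, hc, -⟩ | ⟨ps, p, W, q, i, m, b, hc, -⟩ | ⟨hc, -⟩
  · exact .inl ⟨_, _, _, _, hc⟩
  · exact .inr (.inl ⟨_, _, _, _, _, hc⟩)
  · exact .inr (.inl ⟨_, _, _, _, _, hc⟩)
  · exact mem_ctxs.1 hc

theorem ctxSem_of_inherits (hR : R.WF) {c : Ctx} {W : StackTreeAutomaton} {q i m : ℕ}
    (h : (c, W, q, i, m) ∈ R.inherits) {t t₁ : StackTree R.order} (ht : R.Reach t t₁)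
    (hf : W.Fits q i m t₁) : R.CtxSem c.1 c.2.1 c.2.2 t := by
  rcases mem_inherits.1 h with ⟨hW, rfl, -⟩ | ⟨r, j, hw, rfl, hij, ⟨y, hj⟩, -⟩
  · exact ⟨t₁, ht, hf⟩
  · have := (hR.automata_valid _ (mem_automata_of_mem_switches hw)).treeTrans_mem _ _ _ _ _ hj
    refine ⟨rfl, this.2.1, this.2.2.1, ?_⟩
    rw [if_neg hij]
    exact ⟨t₁, ht, hf⟩

theorem ctxSem_of_shots (hR : R.WF) {c : Ctx} {r : TreeOp} {W : StackTreeAutomaton} {q i m : ℕ}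
    (h : (c, r, W, q, i, m) ∈ R.shots) {t t₁ t₂ : StackTree R.order} (ht : R.Reach t t₁)
    (hs : StackTree.Step r t₁ t₂) (hf : W.Fits q i m t₂) : R.CtxSem c.1 c.2.1 c.2.2 t := by
  obtain ⟨hw, rfl, y, hj⟩ := mem_shots.1 h
  have := (hR.automata_valid _ (mem_automata_of_mem_switches hw)).treeTrans_mem _ _ _ _ _ hj
  refine ⟨rfl, this.2.1, this.2.2.1, ?_⟩
  rw [if_pos rfl]
  exact ⟨t₁, t₂, ht, hs, hf⟩

theorem ctxSem_of_reach {c : Ctx} (hc : c ∈ R.ctxs) {t t' : StackTree R.order}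
    (h : R.Reach t t') (ht : R.CtxSem c.1 c.2.1 c.2.2 t') : R.CtxSem c.1 c.2.1 c.2.2 t := by
  obtain ⟨ℓ, i, m⟩ := c
  cases ℓ with
  | orig W q =>
    exfalso
    rcases mem_ctxs.1 hc with ⟨W, q, i, m, h⟩ | ⟨r, W, q, i, m, h⟩ | ⟨p, h⟩
    · rcases mem_inherits.1 h with ⟨-, h, -⟩ | ⟨r, j, -, h, -⟩ <;> simp at h
    · obtain ⟨-, h, -⟩ := mem_shots.1 h
      simp at h
    · obtain ⟨r, -, ps, p', -, k, -, h, -⟩ := mem_forests.1 h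
      simp at h
  | sat W q =>
    obtain ⟨t₁, h₁, h₂⟩ := ht
    exact ⟨t₁, h.trans h₁, h₂⟩
  | shot r W q d j =>
    obtain ⟨h1, h2, h3, h4⟩ := ht
    refine ⟨h1, h2, h3, ?_⟩
    simp only at h4 ⊢
    split_ifs at h4 ⊢ with hij
    · obtain ⟨t₁, t₂, h₁, h₂⟩ := h4
      exact ⟨t₁, t₂, h.trans h₁, h₂⟩
    · obtain ⟨t₁, h₁, h₂⟩ := h4
      exact ⟨t₁, h.trans h₁, h₂⟩
  | forest ps =>
    obtain ⟨h1, s, h2⟩ := ht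
    exact ⟨h1, s, h.trans h2⟩

theorem ofFn_getI {ps : List ℕ} {m : ℕ} (h : m + 1 = ps.length) :
    List.ofFn (fun k : Fin (m + 1) => ps.getI k) = ps := by
  apply List.ext_getElem (by simp [h])
  intro k h1 h2
  rw [List.getElem_ofFn]
  exact List.getI_eq_getElem _ h2

theorem exists_length_eq_succ {ps : List ℕ} (h : ps ≠ []) : ∃ m, m + 1 = ps.length :=
  ⟨ps.length - 1, by have := List.length_pos_iff.2 h; omega⟩

/-- The intended meaning of the state `x` at a stack `s` of order `R.order`. -/
def StateSem (R : Round) (s : AnnStack R.order R.order) (x : ℕ) : Prop :=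
  (∀ W b, x = autCode W b → W.AcceptsStack s b) ∧
  ∀ (c : Ctx) p, x = leafCode c p → R.CtxSem c.1 c.2.1 c.2.2 (.leaf p s)

/-- The transitions of the tree automaton respect the intended meaning of contexts. -/
theorem ctxSem_node (hR : R.WF) {c : Ctx} {ℓ : Label} {x : ℕ} (h : (c, ℓ, x) ∈ R.arrows)
    {s : AnnStack R.order R.order} (hs : R.StateSem s x) {m : ℕ}
    {ts : Fin (m + 1) → StackTree R.order}
    (hts : ∀ k : Fin (m + 1), R.CtxSem ℓ (k.val + 1) (m + 1) (ts k)) :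
    R.CtxSem c.1 c.2.1 c.2.2 (.node s m ts) := by
  rcases mem_arrows.1 h with ⟨W, q, i, m', q', b, hc, hq, rfl, rfl⟩ |
      ⟨r, W, q, i, m', q', b, d, j, y, hc, hq, hy, rfl, rfl⟩ |
      ⟨ps, p, W, q, i, m', b, hc, hq, rfl, rfl⟩ | ⟨hc, ps, p, hr, rfl, rfl⟩
  · choose us hus hf using hts
    refine ctxSem_of_inherits hR hc (reach_node hus) ⟨q', b, hq, ?_, hs.1 _ _ rfl⟩
    exact StackTreeAutomaton.labels_node.2 hf
  · obtain ⟨rfl, hj1, hj2, -⟩ := hts 0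
    obtain ⟨k₀, hj'⟩ : ∃ k₀ : Fin (m + 1), k₀.val + 1 = j :=
      ⟨⟨j - 1, by omega⟩, Nat.sub_add_cancel hj1⟩
    have hj (k : Fin (m + 1)) : k.val + 1 = j ↔ k = k₀ := by
      rw [Fin.ext_iff]; omega
    obtain ⟨-, -, -, h₀⟩ := hts k₀
    rw [if_pos hj'] at h₀
    obtain ⟨u₁, u₂, hu₁, hu, hu₂⟩ := h₀
    have hex (k : Fin (m + 1)) : ∃ u, R.Reach (ts k) u ∧ (k = k₀ → u = u₁) ∧
        (k ≠ k₀ → W.Fits q' (k.val + 1) (m + 1) u) := by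
      by_cases hk : k = k₀
      · exact ⟨u₁, hk ▸ hu₁, fun _ => rfl, fun h => absurd hk h⟩
      · obtain ⟨-, -, -, h⟩ := hts k
        rw [if_neg fun h => hk ((hj k).1 h)] at h
        obtain ⟨u, h1, h2⟩ := h
        exact ⟨u, h1, fun h => absurd h hk, fun _ => h2⟩
    choose us hus hus₀ hf using hex
    refine ctxSem_of_shots hR hc (reach_node hus)
      (.child s m us k₀ (by rw [hus₀ k₀ rfl]; exact hu)) ⟨q', b, hq, ?_, hs.1 _ _ rfl⟩
    refine StackTreeAutomaton.labels_node.2 fun k => ?_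
    by_cases hk : k = k₀
    · subst hk
      rw [Function.update_self]
      exact hu₂
    · rw [Function.update_of_ne hk]
      exact hf k hk
  · obtain ⟨hlen, -⟩ := hts 0
    choose _ us hus using hts
    refine ctxSem_of_shots hR hc (reach_node hus) (t₂ := .leaf p s) ?_
      ⟨p, b, hq, by rw [StackTreeAutomaton.Labels], hs.1 _ _ rfl⟩
    have := StackTree.Step.pop m (fun k : Fin (m + 1) => ps.getI k) p s us
    rwa [ofFn_getI hlen] at this
  · obtain ⟨hlen, -⟩ := hts 0
    choose _ us hus using hts
    refine ctxSem_of_reach hc ((reach_node hus).tail ⟨_, hr, ?_⟩) (hs.2 c p rfl)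
    have := StackTree.Step.pop m (fun k : Fin (m + 1) => ps.getI k) p s us
    rwa [ofFn_getI hlen] at this

theorem ctxSem_leaf_of_push (hR : R.WF) {c : Ctx} {ℓ : Label} {x : ℕ}
    (h : (c, ℓ, x) ∈ R.arrows) {s : AnnStack R.order R.order} (hs : R.StateSem s x) {p : ℕ}
    {ps : List ℕ} (hr : .push p ps ∈ R.locals)
    (hps : ∀ k < ps.length, R.CtxSem ℓ (k + 1) ps.length (.leaf (ps.getI k) s)) :
    R.CtxSem c.1 c.2.1 c.2.2 (.leaf p s) := by
  obtain ⟨m, hm⟩ := exists_length_eq_succ (hR.locals_valid _ hr).2.1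
  rw [← hm] at hps
  refine ctxSem_of_reach (ctx_of_arrow h) (.single ⟨_, hr, ?_⟩)
    (ctxSem_node hR h hs fun k => hps k k.2)
  have := StackTree.Step.push p m (fun k : Fin (m + 1) => ps.getI k) s
  rwa [ofFn_getI hm] at this

/-- The rules of the alternating system respect the intended meaning of states. -/
theorem stateSem_of_acc (hR : R.WF) {s : AnnStack R.order R.order} {x : ℕ}
    (h : R.system.Acc s x) : R.StateSem s x := by
  -- The induction passes through stacks of all orders, whereas leaf conditions concern order `n`.
  have key {k x : ℕ} {u : AnnStack R.system.order k} (h : R.system.Acc u x) :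
      (∀ W b, x = autCode W b → W.AcceptsStack u b) ∧ ∀ (v : AnnStack R.order R.order), k = R.order →
        HEq u v → ∀ (c : Ctx) p, x = leafCode c p → R.CtxSem c.1 c.2.1 c.2.2 (.leaf p v) := by
    induction h with
    | empty h =>
      simp only [base, List.mem_flatMap, List.mem_map, Prod.mk.injEq] at h
      obtain ⟨W, -, ⟨k, b⟩, h, rfl, rfl⟩ := h
      refine ⟨fun W' b' h' => ?_, fun _ _ _ c p h' => by simp at h'⟩
      obtain ⟨rfl, rfl⟩ := autCode_inj.1 h'
      rwa [StackTreeAutomaton.AcceptsStack]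
    | cons h _ _ ih1 ih2 =>
      simp only [base, List.mem_flatMap, List.mem_map, Prod.mk.injEq] at h
      obtain ⟨W, -, ⟨k, b, b', Y⟩, h, rfl, rfl, rfl, rfl⟩ := h
      refine ⟨fun W' b'' h' => ?_, fun _ _ _ c p h' => by simp at h'⟩
      obtain ⟨rfl, rfl⟩ := autCode_inj.1 h'
      rw [StackTreeAutomaton.AcceptsStack]
      exact ⟨b', Y, h, ih1.1 _ _ rfl, fun y hy => (ih2 _ (List.mem_map_of_mem hy)).1 _ _ rfl⟩
    | sym h hB _ _ ih1 ih2 =>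
      simp only [base, List.mem_flatMap, List.mem_map, Prod.mk.injEq] at h
      obtain ⟨W, -, ⟨b, a, ⟨k, B⟩, Y⟩, h, rfl, rfl, ⟨rfl, rfl⟩, rfl⟩ := h
      refine ⟨fun W' b'' h' => ?_, fun _ _ _ c p h' => by simp at h'⟩
      obtain ⟨rfl, rfl⟩ := autCode_inj.1 h'
      rw [StackTreeAutomaton.AcceptsStack]
      exact ⟨k, B, Y, h, fun y hy => ⟨hB _ (List.mem_map_of_mem hy),
        (ih1 _ (List.mem_map_of_mem hy)).1 _ _ rfl⟩,
        fun y hy => (ih2 _ (List.mem_map_of_mem hy)).1 _ _ rfl⟩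
    | @eps u x Y h _ ih =>
      replace ih : ∀ y ∈ Y, R.StateSem u y := fun y hy => ⟨(ih y hy).1, (ih y hy).2 u rfl .rfl⟩
      suffices ∃ (c : Ctx) (p : ℕ), x = leafCode c p ∧ R.CtxSem c.1 c.2.1 c.2.2 (.leaf p u) by
        obtain ⟨c, p, rfl, hc⟩ := this
        refine ⟨fun W b h => by simp at h, fun v _ hv c' p' h => ?_⟩
        obtain rfl := eq_of_heq hv
        obtain ⟨rfl, rfl⟩ := leafCode_inj.1 h
        exact hc
      change (x, Y) ∈ R.eps at h
      simp only [Round.eps, List.mem_append, List.mem_flatMap, List.mem_map, List.mem_filter,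
        StackTreeAutomaton.mem_succs, TreeOp.mem_pushData, List.contains_iff_mem,
        Prod.mk.injEq] at h
      rcases h with ((⟨⟨c, W, q, i, m⟩, hc, ⟨p, b⟩, ⟨hq, hp⟩, rfl, rfl⟩ |
        ⟨⟨c, p⟩, hc, rfl, rfl⟩) | ⟨⟨c, ℓ, x⟩, hc, r, hr, ⟨p, ps⟩, rfl, rfl, rfl⟩) |
        ⟨⟨c, r, W, q, i, m⟩, hc, ⟨p, ps⟩, rfl, ⟨q', b⟩, hq, rfl, rfl⟩
      · refine ⟨c, p, rfl, ?_⟩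
        have hf : W.Fits q i m (.leaf p u : StackTree R.order) :=
          ⟨p, b, hq, by rw [StackTreeAutomaton.Labels], (ih _ (by simp)).1 _ _ rfl⟩
        rcases hc with hc | hc
        · exact ctxSem_of_inherits hR hc .refl hf
        · obtain ⟨-, rfl, -⟩ := mem_origs.1 hc
          exact hf
      · obtain ⟨r, -, ps, p', rfl, k, hk, rfl, rfl⟩ := mem_forests.1 hc
        exact ⟨_, _, rfl, rfl, u, .refl⟩
      · refine ⟨c, p, rfl, ctxSem_leaf_of_push hR hc (ih _ (by simp)) hr fun k hk => ?_⟩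
        exact (ih _ (List.mem_cons_of_mem _
          (List.mem_map.2 ⟨k, List.mem_range.2 hk, rfl⟩))).2 _ _ rfl
      · refine ⟨c, p, rfl, ?_⟩
        have hw := (mem_shots.1 hc).1
        obtain ⟨m', hm⟩ := exists_length_eq_succ (hR.switches_valid _ hw).2.1
        have hstep := StackTree.Step.push (n := R.order) p m'
          (fun k : Fin (m' + 1) => ps.getI k) u
        rw [ofFn_getI hm] at hstep
        refine ctxSem_of_shots hR hc .refl hstep ⟨q', b, hq, ?_, (ih _ (by simp)).1 _ _ rfl⟩
        refine StackTreeAutomaton.labels_node.2 fun k => ?_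
        have := (ih _ (List.mem_cons_of_mem _
          (List.mem_map.2 ⟨k, List.mem_range.2 (hm ▸ k.2), rfl⟩))).2 _ _ rfl
        simp only [← hm] at this
        exact this
    | @edge u u' x x' o h ho _ ih =>
      suffices ∃ (c : Ctx) (p : ℕ), x = leafCode c p ∧ R.CtxSem c.1 c.2.1 c.2.2 (.leaf p u) by
        obtain ⟨c, p, rfl, hc⟩ := this
        refine ⟨fun W b h => by simp at h, fun v _ hv c' p' h => ?_⟩
        obtain rfl := eq_of_heq hv
        obtain ⟨rfl, rfl⟩ := leafCode_inj.1 h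
        exact hc
      change (x, o, x') ∈ R.edges at h
      simp only [Round.edges, List.mem_append, List.mem_flatMap, List.mem_map, TreeOp.mem_sopData,
        Prod.mk.injEq] at h
      rcases h with ⟨c, hc, r, hr, ⟨p, o, p'⟩, rfl, rfl, rfl, rfl⟩ |
        ⟨⟨c, r, W, q, i, m⟩, hc, ⟨p, o, p'⟩, rfl, rfl, rfl, rfl⟩
      · exact ⟨c, p, rfl, ctxSem_of_reach hc (.single ⟨_, hr, .sop p o p' ho⟩)
          (ih.2 u' rfl .rfl c p' rfl)⟩
      · exact ⟨c, p, rfl, ctxSem_of_shots hR hc .refl (.sop p o p' ho) (ih.2 u' rfl .rfl _ p' rfl)⟩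
  exact ⟨(key h).1, (key h).2 s rfl .rfl⟩

end Round

/-! ### One round of context-bounded reachability: completeness -/

namespace Round

variable {R : Round}

theorem op_valid (hR : R.WF) {r : TreeOp} (hr : r ∈ R.locals ++ R.switches.map Prod.fst) :
    r.Valid R.order R.alphabet R.controls := by
  rcases List.mem_append.1 hr with hr | hr
  · exact hR.locals_valid _ hr
  · obtain ⟨w, hw, rfl⟩ := List.mem_map.1 hr
    exact hR.switches_valid _ hw

theorem ctx_bounds (hR : R.WF) {c : Ctx} (hc : c ∈ R.ctxs) : 1 ≤ c.2.1 ∧ c.2.1 ≤ c.2.2 := by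
  have aux {W : StackTreeAutomaton} (hW : W ∈ R.automata) {q i m : ℕ} {y : ℕ × ℕ}
      (h : (q, i, m, y) ∈ W.treeTrans) : 1 ≤ i ∧ i ≤ m :=
    have := (hR.automata_valid _ hW).treeTrans_mem _ _ _ _ _ h
    ⟨this.2.1, this.2.2.1⟩
  rcases mem_ctxs.1 hc with ⟨W, q, i, m, h⟩ | ⟨r, W, q, i, m, h⟩ | ⟨p, h⟩
  · rcases mem_inherits.1 h with ⟨hW, rfl, y, hy⟩ | ⟨r, j, hw, rfl, -, -, y, hy⟩
    · exact aux hW hy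
    · exact aux (mem_automata_of_mem_switches hw) hy
  · obtain ⟨hw, rfl, y, hy⟩ := mem_shots.1 h
    exact aux (mem_automata_of_mem_switches hw) hy
  · obtain ⟨r, -, ps, p', -, k, hk, rfl, -⟩ := mem_forests.1 h
    exact ⟨by simp, hk⟩

theorem le_of_mem_controls {p : ℕ} (hp : p ∈ R.controls) :
    p ≤ R.controls.foldr (fun p m => p + m) 0 := by
  generalize R.controls = l at hp
  induction l with
  | nil => simp at hp
  | cons a l ih =>
    rw [List.foldr_cons]
    rcases List.mem_cons.1 hp with rfl | hp
    · omega
    · have := ih hp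
      omega

theorem labelCode_ne {p : ℕ} (hp : p ∈ R.controls) (ℓ : Label) : R.labelCode ℓ ≠ p := by
  have := le_of_mem_controls hp
  rw [labelCode]
  omega

theorem labelCode_inj {ℓ ℓ' : Label} : R.labelCode ℓ = R.labelCode ℓ' ↔ ℓ = ℓ' := by
  simp [labelCode, Encodable.encode_inj]

theorem autCode_mem_stackStates {W : StackTreeAutomaton} (hW : W ∈ R.automata) {k x : ℕ}
    (h : (k, x) ∈ W.stackStates) : (k, autCode W x) ∈ R.base.stackStates := by
  simp only [base, List.mem_append, List.mem_flatMap, List.mem_map]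
  exact .inl ⟨W, hW, _, h, rfl⟩

theorem leafCode_mem_stackStates {c : Ctx} (hc : c ∈ R.ctxs ++ R.origs.map Prod.fst) {p : ℕ}
    (hp : p ∈ R.controls) : (R.order, leafCode c p) ∈ R.base.stackStates := by
  simp only [base, List.mem_append, List.mem_flatMap, List.mem_map (l := R.controls)]
  exact .inr ⟨c, List.mem_append.1 hc, p, hp, rfl⟩

theorem labelCode_mem_finals {ℓ : Label} : R.labelCode ℓ ∈ R.base.treeFinals ↔ ℓ ∈ R.finals := by
  simp only [base, List.mem_map, labelCode_inj, exists_eq_right]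

theorem arrow_notMem_finals (hR : R.WF) {c : Ctx} {ℓ : Label} {x : ℕ}
    (h : (c, ℓ, x) ∈ R.arrows) : ℓ ∉ R.finals := by
  have aux {W : StackTreeAutomaton} (hW : W ∈ R.automata) {q i m q' x : ℕ}
      (h : (q, i, m, q', x) ∈ W.treeTrans) : q' ∉ W.treeFinals :=
    ((hR.automata_valid _ hW).treeTrans_mem _ _ _ _ _ h).2.2.2.2.1
  intro hf
  simp only [finals, List.mem_append, List.mem_map, List.mem_flatMap] at hf
  rcases mem_arrows.1 h with ⟨W, q, i, m, q', b, hc, hq, rfl, rfl⟩ |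
      ⟨r, W, q, i, m, q', b, d, j, y, hc, hq, hy, rfl, rfl⟩ |
      ⟨ps, p, W, q, i, m, b, hc, hq, rfl, rfl⟩ | ⟨hc, ps, p, hr, rfl, rfl⟩
  · rcases hf with ⟨q'', hf, heq⟩ | ⟨w, hw, q'', hf, heq⟩
    · obtain ⟨rfl, rfl⟩ := Label.sat.inj heq
      exact aux List.mem_cons_self hq hf
    · simp at heq
  · rcases hf with ⟨q'', hf, heq⟩ | ⟨w, hw, q'', hf, heq⟩
    · simp at heq
    · obtain ⟨rfl, rfl, rfl, -, -⟩ := Label.shot.inj heq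
      exact aux (mem_automata_of_mem_switches hw) hq hf
  · rcases hf with ⟨q'', hf, heq⟩ | ⟨w, hw, q'', hf, heq⟩ <;> simp at heq
  · rcases hf with ⟨q'', hf, heq⟩ | ⟨w, hw, q'', hf, heq⟩ <;> simp at heq

theorem arrow_mem_stackStates (hR : R.WF) {c : Ctx} {ℓ : Label} {x : ℕ}
    (h : (c, ℓ, x) ∈ R.arrows) : (R.order, x) ∈ R.base.stackStates := by
  have aux {W : StackTreeAutomaton} (hW : W ∈ R.automata) {q i m q' x : ℕ}
      (h : (q, i, m, q', x) ∈ W.treeTrans) : (R.order, x) ∈ W.stackStates :=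
    ((hR.automata_valid _ hW).treeTrans_mem _ _ _ _ _ h).2.2.2.2.2
  rcases mem_arrows.1 h with ⟨W, q, i, m, q', b, hc, hq, rfl, rfl⟩ |
      ⟨r, W, q, i, m, q', b, d, j, y, hc, hq, hy, rfl, rfl⟩ |
      ⟨ps, p, W, q, i, m, b, hc, hq, rfl, rfl⟩ | ⟨hc, ps, p, hr, rfl, rfl⟩
  · have hW : W ∈ R.automata := by
      rcases mem_inherits.1 hc with ⟨hW, -⟩ | ⟨r, j, hw, -⟩
      · exact hW
      · exact mem_automata_of_mem_switches hw
    exact autCode_mem_stackStates hW (aux hW hq)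
  · have hW := mem_automata_of_mem_switches (mem_shots.1 hc).1
    exact autCode_mem_stackStates hW (aux hW hq)
  · have hW := mem_automata_of_mem_switches (mem_shots.1 hc).1
    exact autCode_mem_stackStates hW (aux hW hq)
  · exact leafCode_mem_stackStates (List.mem_append_left _ hc) (hR.locals_valid _ hr).2.2

theorem base_valid (hR : R.WF) : R.base.Valid R.order R.alphabet R.controls where
  controls_subset p hp := by
    simp only [base, List.mem_append]
    exact .inl (.inl (.inl hp))
  treeFinals_subset q hq := by
    simp only [base, List.mem_append] at hq ⊢
    exact .inr hq
  treeTrans_mem q i m q' x h := by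
    simp only [base, List.mem_append, List.mem_map, List.mem_flatMap, Prod.mk.injEq] at h
    rcases h with ⟨⟨⟨ℓ, i, m⟩, ℓ', x⟩, h, rfl, rfl, rfl, rfl, rfl⟩ |
      ⟨⟨ℓ, i, m⟩, hc, p, hp, rfl, rfl, rfl, rfl, rfl⟩
    · have hc := ctx_of_arrow h
      have hb := ctx_bounds hR hc
      refine ⟨?_, hb.1, hb.2, ?_, ?_, arrow_mem_stackStates hR h⟩
      · simp only [base, List.mem_append]
        exact .inl (.inl (.inr (List.mem_map.2 ⟨_, hc, rfl⟩)))
      · simp only [base, List.mem_append]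
        exact .inl (.inr (List.mem_map.2 ⟨_, h, rfl⟩))
      · rw [labelCode_mem_finals]
        exact arrow_notMem_finals hR h
    · have hb := ctx_bounds hR hc
      refine ⟨?_, hb.1, hb.2, ?_, ?_, leafCode_mem_stackStates (List.mem_append_left _ hc) hp⟩
      · simp only [base, List.mem_append]
        exact .inl (.inl (.inr (List.mem_map.2 ⟨_, hc, rfl⟩)))
      · simp only [base, List.mem_append]
        exact .inl (.inl (.inl hp))
      · simp only [base, List.mem_map, not_exists, not_and]
        exact fun ℓ _ h => labelCode_ne hp ℓ h
  stackStates_order k x h := by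
    simp only [base, List.mem_append, List.mem_flatMap, List.mem_map (l := R.controls),
      Prod.mk.injEq] at h
    rcases h with ⟨W, hW, h⟩ | ⟨c, hc, p, hp, rfl, rfl⟩
    · obtain ⟨y, hy, h⟩ := List.mem_map.1 h
      obtain ⟨rfl, -⟩ := Prod.mk.inj h
      exact (hR.automata_valid W hW).stackStates_order _ _ hy
    · exact ⟨hR.one_le_order, le_rfl⟩
  stackFinals_subset y hy := by
    simp only [base, List.mem_flatMap, List.mem_map] at hy
    obtain ⟨W, hW, y, hy, rfl⟩ := hy
    exact autCode_mem_stackStates hW ((hR.automata_valid W hW).stackFinals_subset _ hy)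
  stackTrans_mem k x x' X h := by
    simp only [base, List.mem_flatMap, List.mem_map, Prod.mk.injEq] at h
    obtain ⟨W, hW, ⟨k, b, b', Y⟩, h, rfl, rfl, rfl, rfl⟩ := h
    obtain ⟨h1, h2, h3, h4, h5⟩ := (hR.automata_valid W hW).stackTrans_mem _ _ _ _ h
    refine ⟨h1, h2, autCode_mem_stackStates hW h3, autCode_mem_stackStates hW h4, fun y hy => ?_⟩
    obtain ⟨z, hz, rfl⟩ := List.mem_map.1 hy
    exact autCode_mem_stackStates hW (h5 _ hz)
  symTrans_mem x a k B X h := by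
    simp only [base, List.mem_flatMap, List.mem_map, Prod.mk.injEq] at h
    obtain ⟨W, hW, ⟨b, a, ⟨k, B⟩, Y⟩, h, rfl, rfl, ⟨rfl, rfl⟩, rfl⟩ := h
    obtain ⟨h1, h2, h3, h4, h5, h6⟩ := (hR.automata_valid W hW).symTrans_mem _ _ _ _ _ h
    refine ⟨autCode_mem_stackStates hW h1, h2, h3, h4, fun y hy => ?_, fun y hy => ?_⟩
    · obtain ⟨z, hz, rfl⟩ := List.mem_map.1 hy
      exact autCode_mem_stackStates hW (h5 _ hz)
    · obtain ⟨z, hz, rfl⟩ := List.mem_map.1 hy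
      exact autCode_mem_stackStates hW (h6 _ hz)

theorem mem_ctxs_of_shots {c : Ctx} {y : TreeOp × StackTreeAutomaton × ℕ × ℕ × ℕ}
    (h : (c, y) ∈ R.shots) : c ∈ R.ctxs :=
  mem_ctxs.2 (.inr (.inl ⟨_, _, _, _, _, h⟩))

theorem mem_ctxs_of_inherits {c : Ctx} {y : StackTreeAutomaton × ℕ × ℕ × ℕ}
    (h : (c, y) ∈ R.inherits) : c ∈ R.ctxs :=
  mem_ctxs.2 (.inl ⟨_, _, _, _, h⟩)

theorem mem_controls_of_mem_forests (hR : R.WF) {c : Ctx} {p : ℕ} (h : (c, p) ∈ R.forests) :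
    p ∈ R.controls := by
  obtain ⟨r, hr, ps, p', rfl, k, hk, rfl, rfl⟩ := mem_forests.1 h
  refine (op_valid hR hr).2.1 _ ?_
  rw [List.getI_eq_getElem _ hk]
  exact List.getElem_mem hk

theorem system_wf (hR : R.WF) : R.system.WF where
  one_le_order := hR.one_le_order
  valid := ⟨R.controls, base_valid hR⟩
  eps_mem e h := by
    change e ∈ R.eps at h
    simp only [eps, List.mem_append, List.mem_flatMap, List.mem_map, List.mem_filter,
      StackTreeAutomaton.mem_succs, TreeOp.mem_pushData, List.contains_iff_mem] at h
    rcases h with ((⟨⟨c, W, q, i, m⟩, hc, ⟨p, b⟩, ⟨hq, hp⟩, rfl⟩ |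
      ⟨⟨c, p⟩, hc, rfl⟩) | ⟨⟨c, ℓ, x⟩, hc, r, hr, ⟨p, ps⟩, rfl, rfl⟩) |
      ⟨⟨c, r, W, q, i, m⟩, hc, ⟨p, ps⟩, rfl, ⟨q', b⟩, hq, rfl⟩
    · refine leafCode_mem_stackStates (List.mem_append.2 ?_) hp
      exact hc.imp mem_ctxs_of_inherits fun h => List.mem_map.2 ⟨_, h, rfl⟩
    · exact leafCode_mem_stackStates (List.mem_append_left _ (mem_ctxs.2 (.inr (.inr ⟨p, hc⟩))))
        (mem_controls_of_mem_forests hR hc)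
    · exact leafCode_mem_stackStates (List.mem_append_left _ (ctx_of_arrow hc))
        (hR.locals_valid _ hr).1
    · exact leafCode_mem_stackStates (List.mem_append_left _ (mem_ctxs_of_shots hc))
        (hR.switches_valid _ (mem_shots.1 hc).1).1
  edges_mem e h := by
    change e ∈ R.edges at h
    simp only [edges, List.mem_append, List.mem_flatMap, List.mem_map, TreeOp.mem_sopData] at h
    rcases h with ⟨c, hc, r, hr, ⟨p, o, p'⟩, rfl, rfl⟩ |
      ⟨⟨c, r, W, q, i, m⟩, hc, ⟨p, o, p'⟩, rfl, rfl⟩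
    · exact leafCode_mem_stackStates (List.mem_append_left _ hc) (hR.locals_valid _ hr).1
    · exact leafCode_mem_stackStates (List.mem_append_left _ (mem_ctxs_of_shots hc))
        (hR.switches_valid _ (mem_shots.1 hc).1).1
  edges_valid e h := by
    change e ∈ R.edges at h
    simp only [edges, List.mem_append, List.mem_flatMap, List.mem_map, TreeOp.mem_sopData] at h
    rcases h with ⟨c, hc, r, hr, ⟨p, o, p'⟩, rfl, rfl⟩ |
      ⟨⟨c, r, W, q, i, m⟩, hc, ⟨p, o, p'⟩, rfl, rfl⟩
    · exact (hR.locals_valid _ hr).2.1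
    · exact (hR.switches_valid _ (mem_shots.1 hc).1).2.1

theorem automaton_valid (hR : R.WF) : R.automaton.Valid R.order R.alphabet R.controls :=
  AltSystem.saturate_valid (system_wf hR) (base_valid hR)

theorem accepts_iff (hR : R.WF) {s : AnnStack R.order R.order} (hs : s.Over R.alphabet) {x : ℕ} :
    R.automaton.AcceptsStack s (baseCode x) ↔ R.system.Acc s x :=
  AltSystem.saturate_accepts_iff (A := R.system) (system_wf hR) hs

theorem mem_treeTrans {q i m q' x : ℕ} : (q, i, m, q', x) ∈ R.automaton.treeTrans ↔
    (∃ c ℓ y, (c, ℓ, y) ∈ R.arrows ∧ R.labelCode c.1 = q ∧ c.2.1 = i ∧ c.2.2 = m ∧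
      R.labelCode ℓ = q' ∧ baseCode y = x) ∨
    ∃ c p, c ∈ R.ctxs ∧ p ∈ R.controls ∧ R.labelCode c.1 = q ∧ c.2.1 = i ∧ c.2.2 = m ∧
      p = q' ∧ baseCode (leafCode c p) = x := by
  simp only [automaton, AltSystem.saturate, base, List.mem_map, List.mem_append, List.mem_flatMap,
    Prod.mk.injEq]
  constructor
  · rintro ⟨⟨q, i, m, q', y⟩, h | h, rfl, rfl, rfl, rfl, rfl⟩
    · obtain ⟨⟨c, ℓ, z⟩, h, heq⟩ := h
      simp only [Prod.mk.injEq] at heq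
      obtain ⟨rfl, rfl, rfl, rfl, rfl⟩ := heq
      exact .inl ⟨c, ℓ, z, h, rfl, rfl, rfl, rfl, rfl⟩
    · obtain ⟨c, hc, p, hp, heq⟩ := h
      simp only [Prod.mk.injEq] at heq
      obtain ⟨rfl, rfl, rfl, rfl, rfl⟩ := heq
      exact .inr ⟨c, p, hc, hp, rfl, rfl, rfl, rfl, rfl⟩
  · rintro (⟨c, ℓ, z, h, rfl, rfl, rfl, rfl, rfl⟩ | ⟨c, p, hc, hp, rfl, rfl, rfl, rfl, rfl⟩)
    · exact ⟨_, .inl ⟨_, h, rfl⟩, rfl, rfl, rfl, rfl, rfl⟩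
    · exact ⟨_, .inr ⟨c, hc, p, hp, rfl⟩, rfl, rfl, rfl, rfl, rfl⟩

/-- The tree `t` is allowed in the context `(ℓ, i, m)` by the constructed automaton. -/
def FitsCtx (R : Round) (ℓ : Label) (i m : ℕ) (t : StackTree R.order) : Prop :=
  R.automaton.Fits (R.labelCode ℓ) i m t

theorem fitsCtx_leaf (hR : R.WF) {ℓ : Label} {i m p : ℕ} (hp : p ∈ R.controls)
    {s : AnnStack R.order R.order} (hs : s.Over R.alphabet) :
    R.FitsCtx ℓ i m (.leaf p s) ↔
      (ℓ, i, m) ∈ R.ctxs ∧ R.system.Acc s (leafCode (ℓ, i, m) p) := by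
  constructor
  · rintro ⟨q', x, h, hl, hx⟩
    rw [StackTreeAutomaton.Labels] at hl
    subst hl
    rcases mem_treeTrans.1 h with ⟨c, ℓ', y, -, -, -, -, h, -⟩ |
      ⟨⟨ℓ', i, m⟩, p, hc, -, h', rfl, rfl, rfl, rfl⟩
    · exact absurd h (labelCode_ne hp ℓ')
    · obtain rfl := labelCode_inj.1 h'
      exact ⟨hc, (accepts_iff hR hs).1 hx⟩
  · rintro ⟨hc, h⟩
    refine ⟨p, _, mem_treeTrans.2 (.inr ⟨_, p, hc, hp, rfl, rfl, rfl, rfl, rfl⟩), ?_,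
      (accepts_iff hR hs).2 h⟩
    rw [StackTreeAutomaton.Labels]

theorem fitsCtx_node (hR : R.WF) {ℓ : Label} {i m d : ℕ} {s : AnnStack R.order R.order}
    (hs : s.Over R.alphabet) {ts : Fin (d + 1) → StackTree R.order} :
    R.FitsCtx ℓ i m (.node s d ts) ↔ ∃ ℓ' x, ((ℓ, i, m), ℓ', x) ∈ R.arrows ∧
      R.system.Acc s x ∧ ∀ k : Fin (d + 1), R.FitsCtx ℓ' (k.val + 1) (d + 1) (ts k) := by
  constructor
  · rintro ⟨q', x, h, hl, hx⟩
    rw [StackTreeAutomaton.labels_node] at hl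
    rcases mem_treeTrans.1 h with ⟨⟨ℓ₁, i, m⟩, ℓ', y, hc, h', rfl, rfl, rfl, rfl⟩ |
      ⟨c, p, -, hp, -, -, -, rfl, -⟩
    · obtain rfl := labelCode_inj.1 h'
      exact ⟨ℓ', y, hc, (accepts_iff hR hs).1 hx, hl⟩
    · obtain ⟨q₁, x₁, h, -⟩ := hl 0
      rcases mem_treeTrans.1 h with ⟨c, ℓ', y, -, h, -⟩ | ⟨c, p', -, -, h, -⟩ <;>
        exact absurd h (labelCode_ne hp _)
  · rintro ⟨ℓ', x, hc, hx, hts⟩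
    exact ⟨_, _, mem_treeTrans.2 (.inl ⟨_, _, _, hc, rfl, rfl, rfl, rfl, rfl⟩),
      StackTreeAutomaton.labels_node.2 hts, (accepts_iff hR hs).2 hx⟩

theorem ctxSem_of_fitsCtx (hR : R.WF) {ℓ : Label} {i m : ℕ} {t : StackTree R.order}
    (ht : t.Over R.alphabet R.controls) (h : R.FitsCtx ℓ i m t) : R.CtxSem ℓ i m t := by
  induction t generalizing ℓ i m with
  | leaf p s =>
    exact (stateSem_of_acc hR ((fitsCtx_leaf hR ht.1 ht.2).1 h).2).2 _ _ rfl
  | node s d ts ih =>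
    obtain ⟨ℓ', x, hc, hx, hts⟩ := (fitsCtx_node hR ht.1).1 h
    exact ctxSem_node hR hc (stateSem_of_acc hR hx) fun k => ih k (ht.2 k) (hts k)

theorem acc_autCode {W : StackTreeAutomaton} (hW : W ∈ R.automata) {k : ℕ}
    {s : AnnStack R.order k} {x : ℕ} (h : W.AcceptsStack s x) :
    R.system.Acc s (autCode W x) := by
  induction s generalizing x with
  | empty k =>
    rw [StackTreeAutomaton.AcceptsStack] at h
    refine .empty ?_
    simp only [base, List.mem_flatMap, List.mem_map]
    exact ⟨W, hW, _, h, rfl⟩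
  | sym a hj ann s ih1 ih2 =>
    rw [StackTreeAutomaton.AcceptsStack] at h
    obtain ⟨k, B, X, h, hB, hX⟩ := h
    refine .sym (k := k) (B := B.map (autCode W)) (X := X.map (autCode W)) ?_ ?_ ?_ ?_
    · simp only [base, List.mem_flatMap, List.mem_map]
      exact ⟨W, hW, _, h, rfl⟩
    all_goals
      intro y hy
      obtain ⟨z, hz, rfl⟩ := List.mem_map.1 hy
    · exact (hB z hz).1
    · exact ih1 (hB z hz).2
    · exact ih2 (hX z hz)
  | cons top s ih1 ih2 =>
    rw [StackTreeAutomaton.AcceptsStack] at h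
    obtain ⟨x', X, h, h1, h2⟩ := h
    refine .cons (x' := autCode W x') (X := X.map (autCode W)) ?_ (ih1 h1) ?_
    · simp only [base, List.mem_flatMap, List.mem_map]
      exact ⟨W, hW, _, h, rfl⟩
    · intro y hy
      obtain ⟨z, hz, rfl⟩ := List.mem_map.1 hy
      exact ih2 (h2 z hz)

theorem mem_automata_of_inherits {c : Ctx} {W : StackTreeAutomaton} {q i m : ℕ}
    (hc : (c, W, q, i, m) ∈ R.inherits ++ R.origs) : W ∈ R.automata := by
  rcases List.mem_append.1 hc with hc | hc
  · rcases mem_inherits.1 hc with ⟨hW, -⟩ | ⟨r, j, hw, -⟩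
    · exact hW
    · exact mem_automata_of_mem_switches hw
  · exact (mem_origs.1 hc).1

theorem acc_leafCode {c : Ctx} {W : StackTreeAutomaton} {q i m : ℕ}
    (hc : (c, W, q, i, m) ∈ R.inherits ++ R.origs) {p : ℕ} (hp : p ∈ R.controls)
    {s : AnnStack R.order R.order} (h : W.Fits q i m (.leaf p s)) :
    R.system.Acc s (leafCode c p) := by
  obtain ⟨q', x, hq, hl, hx⟩ := h
  rw [StackTreeAutomaton.Labels] at hl
  subst hl
  refine AltSystem.Acc.eps (A := R.system) (Y := [autCode W x]) ?_ fun y hy => by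
    rw [List.mem_singleton.1 hy]; exact acc_autCode (mem_automata_of_inherits hc) hx
  change _ ∈ R.eps
  simp only [eps, List.mem_append (s := R.inherits), List.mem_append, List.mem_flatMap,
    List.mem_map, List.mem_filter, StackTreeAutomaton.mem_succs, List.contains_iff_mem]
  exact .inl (.inl (.inl ⟨_, List.mem_append.1 hc, _, ⟨hq, hp⟩, rfl⟩))

/-- A context that means a context of `W` up to local rules allows the trees that `W` allows. -/
theorem fitsCtx_of_inherits (hR : R.WF) {ℓ : Label} {i' m' : ℕ} {W : StackTreeAutomaton}
    {q i m : ℕ} (hc : ((ℓ, i', m'), W, q, i, m) ∈ R.inherits) {t : StackTree R.order}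
    (ht : t.Over R.alphabet R.controls) (h : W.Fits q i m t) : R.FitsCtx ℓ i' m' t := by
  have hW := mem_automata_of_inherits (List.mem_append_left _ hc)
  induction t generalizing ℓ i' m' q i m with
  | leaf p s =>
    exact (fitsCtx_leaf hR ht.1 ht.2).2 ⟨mem_ctxs_of_inherits hc,
      acc_leafCode (List.mem_append_left _ hc) ht.1 h⟩
  | node s d ts ih =>
    obtain ⟨q', x, hq, hl, hx⟩ := h
    rw [StackTreeAutomaton.labels_node] at hl
    refine (fitsCtx_node hR ht.1).2 ⟨.sat W q', autCode W x,
      mem_arrows.2 (.inl ⟨W, q, i, m, q', x, hc, hq, rfl, rfl⟩), acc_autCode hW hx, fun k => ?_⟩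
    obtain ⟨q₁, x₁, h₁, -⟩ := hl k
    exact ih k (mem_inherits.2 (.inl ⟨hW, rfl, _, h₁⟩)) (ht.2 k) (hl k)

theorem getI_ofFn {m : ℕ} (ps : Fin (m + 1) → ℕ) (k : Fin (m + 1)) :
    (List.ofFn ps).getI k = ps k := by
  rw [List.getI_eq_getElem _ (by rw [List.length_ofFn]; exact k.2), List.getElem_ofFn]

theorem fitsCtx_forest (hR : R.WF) {d : ℕ} {ps : Fin (d + 1) → ℕ} {p : ℕ}
    (hr : .pop (List.ofFn ps) p ∈ R.locals ++ R.switches.map Prod.fst)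
    (ss : Fin (d + 1) → AnnStack R.order R.order)
    (ht : ∀ k, (StackTree.leaf (ps k) (ss k)).Over R.alphabet R.controls) (k : Fin (d + 1)) :
    R.FitsCtx (.forest (List.ofFn ps)) (k + 1) (d + 1) (.leaf (ps k) (ss k)) := by
  have hf : ((Label.forest (List.ofFn ps), k.val + 1, d + 1), ps k) ∈ R.forests :=
    mem_forests.2 ⟨_, hr, _, p, rfl, k, by rw [List.length_ofFn]; exact k.2, by simp, (getI_ofFn ps k).symm⟩
  refine (fitsCtx_leaf hR (ht k).1 (ht k).2).2 ⟨mem_ctxs.2 (.inr (.inr ⟨_, hf⟩)), ?_⟩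
  refine AltSystem.Acc.eps (A := R.system) (Y := []) ?_ (by simp)
  change _ ∈ R.eps
  simp only [eps, List.mem_append]
  exact .inl (.inl (.inr (List.mem_map.2 ⟨_, hf, rfl⟩)))

/-- A context that means a context of `W` after one application of `r` allows the trees that `r`
turns into trees allowed by `W`. -/
theorem fitsCtx_of_shots (hR : R.WF) {r : TreeOp} {t t' : StackTree R.order}
    (hs : StackTree.Step r t t') {ℓ : Label} {i' m' : ℕ} {W : StackTreeAutomaton} {q i m : ℕ}
    (hc : ((ℓ, i', m'), r, W, q, i, m) ∈ R.shots) (ht : t.Over R.alphabet R.controls)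
    (h : W.Fits q i m t') : R.FitsCtx ℓ i' m' t := by
  have hw := (mem_shots.1 hc).1
  have hW := mem_automata_of_mem_switches hw
  have hr := hR.switches_valid _ hw
  induction hs generalizing ℓ i' m' q i m with
  | @sop p o p' s s' hs =>
    refine (fitsCtx_leaf hR ht.1 ht.2).2 ⟨mem_ctxs_of_shots hc, ?_⟩
    have h' := h
    obtain ⟨q', x, hq, -⟩ := h'
    have ho : ((Label.orig W q, i, m), W, q, i, m) ∈ R.origs := mem_origs.2 ⟨hW, rfl, _, hq⟩
    refine AltSystem.Acc.edge (A := R.system) ?_ hs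
      (acc_leafCode (List.mem_append_right _ ho) hr.2.2 h)
    change _ ∈ R.edges
    simp only [edges, List.mem_append, List.mem_flatMap, List.mem_map, TreeOp.mem_sopData]
    exact .inr ⟨_, hc, (p, o, p'), rfl, rfl⟩
  | push p d ps s =>
    refine (fitsCtx_leaf hR ht.1 ht.2).2 ⟨mem_ctxs_of_shots hc, ?_⟩
    obtain ⟨q', x, hq, hl, hx⟩ := h
    rw [StackTreeAutomaton.labels_node] at hl
    refine AltSystem.Acc.eps (A := R.system) (Y := autCode W x ::
      (List.range (List.ofFn ps).length).map fun k =>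
        leafCode (Label.orig W q', k + 1, (List.ofFn ps).length) ((List.ofFn ps).getI k)) ?_ ?_
    · change _ ∈ R.eps
      simp only [eps, List.mem_append, List.mem_flatMap, TreeOp.mem_pushData]
      exact .inr ⟨_, hc, (p, List.ofFn ps), rfl, List.mem_map.2 ⟨(q', x), by simpa using hq, rfl⟩⟩
    · intro y hy
      rcases List.mem_cons.1 hy with rfl | hy
      · exact acc_autCode hW hx
      · obtain ⟨k, hk, rfl⟩ := List.mem_map.1 hy
        rw [List.mem_range, List.length_ofFn] at hk
        have hg := getI_ofFn ps ⟨k, hk⟩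
        simp only at hg
        rw [hg, List.length_ofFn]
        have hlk := hl ⟨k, hk⟩
        have hlk' := hlk
        obtain ⟨q₁, x₁, h₁, -⟩ := hlk'
        exact acc_leafCode (List.mem_append_right _ (mem_origs.2 ⟨hW, rfl, _, h₁⟩))
          (hr.2.2 _ (List.mem_ofFn.2 ⟨_, rfl⟩)) hlk
  | pop d ps p s ss =>
    obtain ⟨q', x, hq, hl, hx⟩ := h
    rw [StackTreeAutomaton.Labels] at hl
    subst hl
    refine (fitsCtx_node hR ht.1).2 ⟨.forest (List.ofFn ps), autCode W x, mem_arrows.2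
      (.inr (.inr (.inl ⟨_, _, W, q, i, m, x, hc, hq, rfl, rfl⟩))), acc_autCode hW hx, fun k => ?_⟩
    exact fitsCtx_forest hR (List.mem_append_right _ (List.mem_map.2 ⟨_, hw, rfl⟩)) ss ht.2 k
  | child s d ts k hs ih =>
    obtain ⟨q', x, hq, hl, hx⟩ := h
    rw [StackTreeAutomaton.labels_node] at hl
    have hlk := hl k
    rw [Function.update_self] at hlk
    have hlk' := hlk
    obtain ⟨q₁, x₁, h₁, -⟩ := hlk'
    refine (fitsCtx_node hR ht.1).2 ⟨.shot _ W q' (d + 1) (k + 1), autCode W x, mem_arrows.2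
      (.inr (.inl ⟨_, W, q, i, m, q', x, d + 1, k + 1, _, hc, hq, h₁, rfl, rfl⟩)),
      acc_autCode hW hx, fun j => ?_⟩
    by_cases hj : j = k
    · subst hj
      exact ih (mem_shots.2 ⟨hw, rfl, _, h₁⟩) (ht.2 j) hlk hw hW hr
    · have hlj := hl j
      rw [Function.update_of_ne hj] at hlj
      have hlj' := hlj
      obtain ⟨q₂, x₂, h₂, -⟩ := hlj'
      refine fitsCtx_of_inherits hR (mem_inherits.2 (.inr ⟨_, k + 1, hw, rfl, ?_, ⟨_, h₁⟩, _, h₂⟩))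
        (ht.2 j) hlj
      intro h
      exact hj (Fin.ext (by omega))

/-- The constructed automaton is closed under backward applications of local rules. -/
theorem fitsCtx_of_local (hR : R.WF) {r : TreeOp} (hr : r ∈ R.locals) {t t' : StackTree R.order}
    (hs : StackTree.Step r t t') {ℓ : Label} {i m : ℕ} (ht : t.Over R.alphabet R.controls)
    (h : R.FitsCtx ℓ i m t') : R.FitsCtx ℓ i m t := by
  have hv := hR.locals_valid _ hr
  have ht' := hs.over hv ht
  induction hs generalizing ℓ i m with
  | @sop p o p' s s' hs =>
    obtain ⟨hc, h⟩ := (fitsCtx_leaf hR ht'.1 ht'.2).1 h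
    refine (fitsCtx_leaf hR ht.1 ht.2).2 ⟨hc, AltSystem.Acc.edge (A := R.system) ?_ hs h⟩
    change _ ∈ R.edges
    simp only [edges, List.mem_append, List.mem_flatMap, List.mem_map, TreeOp.mem_sopData]
    exact .inl ⟨_, hc, _, hr, (p, o, p'), rfl, rfl⟩
  | push p d ps s =>
    obtain ⟨ℓ', x, hc, hx, hl⟩ := (fitsCtx_node hR ht'.1).1 h
    refine (fitsCtx_leaf hR ht.1 ht.2).2 ⟨ctx_of_arrow hc, ?_⟩
    refine AltSystem.Acc.eps (A := R.system) (Y := x ::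
      (List.range (List.ofFn ps).length).map fun k =>
        leafCode (ℓ', k + 1, (List.ofFn ps).length) ((List.ofFn ps).getI k)) ?_ ?_
    · change _ ∈ R.eps
      simp only [eps, List.mem_append, List.mem_flatMap, TreeOp.mem_pushData]
      refine .inl (.inr ⟨_, hc, _, hr, List.mem_map.2 ⟨(p, List.ofFn ps), ?_, rfl⟩⟩)
      exact TreeOp.mem_pushData.2 rfl
    · intro y hy
      rcases List.mem_cons.1 hy with rfl | hy
      · exact hx
      · obtain ⟨k, hk, rfl⟩ := List.mem_map.1 hy
        rw [List.mem_range, List.length_ofFn] at hk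
        have hg := getI_ofFn ps ⟨k, hk⟩
        simp only at hg
        rw [hg, List.length_ofFn]
        have := ht'.2 ⟨k, hk⟩
        exact ((fitsCtx_leaf hR this.1 this.2).1 (hl ⟨k, hk⟩)).2
  | pop d ps p s ss =>
    obtain ⟨hc, h⟩ := (fitsCtx_leaf hR ht'.1 ht'.2).1 h
    refine (fitsCtx_node hR ht.1).2 ⟨.forest (List.ofFn ps), _, mem_arrows.2
      (.inr (.inr (.inr ⟨hc, _, _, hr, rfl, rfl⟩))), h, fun k => ?_⟩
    exact fitsCtx_forest hR (List.mem_append_left _ hr) ss ht.2 k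
  | child s d ts k hs ih =>
    obtain ⟨ℓ', x, hc, hx, hl⟩ := (fitsCtx_node hR ht'.1).1 h
    refine (fitsCtx_node hR ht.1).2 ⟨ℓ', x, hc, hx, fun j => ?_⟩
    by_cases hj : j = k
    · subst hj
      have h1 := hl j
      have h2 := ht'.2 j
      rw [Function.update_self] at h1 h2
      exact ih hr (ht.2 j) h1 hv h2
    · have h1 := hl j
      rwa [Function.update_of_ne hj] at h1

theorem reach_over (hR : R.WF) {t t' : StackTree R.order} (h : R.Reach t t')
    (ht : t.Over R.alphabet R.controls) : t'.Over R.alphabet R.controls := by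
  induction h with
  | refl => exact ht
  | tail _ h ih =>
    obtain ⟨r, hr, h⟩ := h
    exact h.over (hR.locals_valid _ hr) ih

theorem fitsCtx_of_reach (hR : R.WF) {t t' : StackTree R.order} (h : R.Reach t t') {ℓ : Label}
    {i m : ℕ} (ht : t.Over R.alphabet R.controls) (h' : R.FitsCtx ℓ i m t') :
    R.FitsCtx ℓ i m t := by
  induction h using Relation.ReflTransGen.head_induction_on with
  | refl => exact h'
  | head h _ ih =>
    obtain ⟨r, hr, h⟩ := h
    exact fitsCtx_of_local hR hr h ht (ih (h.over (hR.locals_valid _ hr) ht))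

/-- The language of the automaton for one round. -/
theorem mem_lang_automaton (hR : R.WF) {t : StackTree R.order} :
    t ∈ R.automaton.lang R.alphabet R.controls ↔ t.Over R.alphabet R.controls ∧
      ∃ t₁, R.Reach t t₁ ∧ (t₁ ∈ R.target.lang R.alphabet R.controls ∨
        ∃ w ∈ R.switches, ∃ t₂, StackTree.Step w.1 t₁ t₂ ∧
          t₂ ∈ w.2.lang R.alphabet R.controls) := by
  rw [StackTreeAutomaton.mem_lang_iff]
  refine and_congr_right fun ht => ?_
  have hfin : R.automaton.treeFinals = R.finals.map R.labelCode := rfl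
  rw [hfin]
  constructor
  · rintro ⟨_, hq₀, h⟩
    obtain ⟨ℓ, hℓ, rfl⟩ := List.mem_map.1 hq₀
    have hsem := ctxSem_of_fitsCtx hR ht h
    simp only [finals, List.mem_append, List.mem_map, List.mem_flatMap] at hℓ
    rcases hℓ with ⟨q, hq, rfl⟩ | ⟨w, hw, q, hq, rfl⟩
    · obtain ⟨t₁, h₁, h₂⟩ := hsem
      exact ⟨t₁, h₁, .inl (StackTreeAutomaton.mem_lang_iff.2 ⟨reach_over hR h₁ ht, q, hq, h₂⟩)⟩
    · obtain ⟨-, -, -, hsem⟩ := hsem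
      rw [if_pos rfl] at hsem
      obtain ⟨t₁, t₂, h₁, h₂, h₃⟩ := hsem
      exact ⟨t₁, h₁, .inr ⟨w, hw, t₂, h₂, StackTreeAutomaton.mem_lang_iff.2
        ⟨h₂.over (hR.switches_valid _ hw) (reach_over hR h₁ ht), q, hq, h₃⟩⟩⟩
  · rintro ⟨t₁, h₁, h⟩
    have ht₁ := reach_over hR h₁ ht
    rcases h with h | ⟨w, hw, t₂, h₂, h⟩
    · obtain ⟨-, q, hq, hf⟩ := StackTreeAutomaton.mem_lang_iff.1 h
      refine ⟨R.labelCode (.sat R.target q), List.mem_map.2 ⟨_, ?_, rfl⟩, fitsCtx_of_reach hR h₁ ht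
        (fitsCtx_of_inherits hR (W := R.target) (q := q) (i := 1) (m := 1) ?_ ht₁ hf)⟩
      · exact List.mem_append_left _ (List.mem_map.2 ⟨q, hq, rfl⟩)
      · obtain ⟨q', x, hx, -⟩ := hf
        exact mem_inherits.2 (.inl ⟨List.mem_cons_self, rfl, _, hx⟩)
    · obtain ⟨-, q, hq, hf⟩ := StackTreeAutomaton.mem_lang_iff.1 h
      refine ⟨R.labelCode (.shot w.1 w.2 q 1 1), List.mem_map.2 ⟨_, ?_, rfl⟩,
        fitsCtx_of_reach hR h₁ ht
          (fitsCtx_of_shots hR h₂ (W := w.2) (q := q) (i := 1) (m := 1) ?_ ht₁ hf)⟩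
      · exact List.mem_append_right _ (List.mem_flatMap.2 ⟨w, hw, List.mem_map.2 ⟨q, hq, rfl⟩⟩)
      · obtain ⟨q', x, hx, -⟩ := hf
        exact mem_shots.2 ⟨hw, rfl, _, hx⟩

end Round

/-! ### Iteration over the number of changes of global state -/

instance : Inhabited StackTreeAutomaton := ⟨⟨[], [], [], [], [], [], []⟩⟩

namespace GASTRS

/-- The round for a stay in the global state `g`: `A₀` is the target automaton of `g`, and `fam`
lists the automata for what happens after the next change of global state. -/
def round (S : GASTRS) (fam : List (ℕ × StackTreeAutomaton)) (g : ℕ) (A₀ : StackTreeAutomaton) :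
    Round where
  order := S.order
  alphabet := S.alphabet
  controls := S.controls
  locals := (S.rules.filter fun ρ => ρ.1 == g && ρ.2.2 == g).map fun ρ => ρ.2.1
  target := A₀
  switches := (S.rules.filter fun ρ => ρ.1 == g && !(ρ.2.2 == g)).flatMap fun ρ =>
    (fam.filter fun W => W.1 == ρ.2.2).map fun W => (ρ.2.1, W.2)

/-- The automata for `k` stays in a global state, from the automata for one stay fewer. -/
def nextFamily (S : GASTRS) (targets fam : List (ℕ × StackTreeAutomaton)) :
    List (ℕ × StackTreeAutomaton) :=
  targets.map fun T => (T.1, (S.round fam T.1 T.2).automaton)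

/-- For each global state, an automaton for the runs with fewer than `k` changes of global state. -/
def family (S : GASTRS) (targets : List (ℕ × StackTreeAutomaton)) (k : ℕ) :
    List (ℕ × StackTreeAutomaton) :=
  (S.nextFamily targets)^[k] []

/-- The algorithm for context-bounded backwards reachability. -/
def solve (x : GASTRS × List (ℕ × StackTreeAutomaton) × ℕ × ℕ) : StackTreeAutomaton :=
  (((x.1.family x.2.1 (x.2.2.1 + 1)).filter fun W => W.1 == x.2.2.2).map fun W => W.2).headI

theorem primrec_solve : Primrec solve := by
  unfold solve family nextFamily round; fun_prop

variable {S : GASTRS} {targets fam : List (ℕ × StackTreeAutomaton)} {g : ℕ}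

theorem mem_locals_round {A₀ : StackTreeAutomaton} {r : TreeOp} :
    r ∈ (S.round fam g A₀).locals ↔ (g, r, g) ∈ S.rules := by
  simp only [round, List.mem_map, List.mem_filter, Bool.and_eq_true, beq_iff_eq]
  constructor
  · rintro ⟨⟨g₁, r', g₂⟩, ⟨h, h₁, h₂⟩, h₃⟩
    dsimp only at h₁ h₂ h₃
    subst h₁ h₂ h₃
    exact h
  · exact fun h => ⟨_, ⟨h, rfl, rfl⟩, rfl⟩

theorem mem_switches_round {A₀ : StackTreeAutomaton} {w : TreeOp × StackTreeAutomaton} :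
    w ∈ (S.round fam g A₀).switches ↔
      ∃ g', g' ≠ g ∧ (g, w.1, g') ∈ S.rules ∧ (g', w.2) ∈ fam := by
  simp only [round, List.mem_flatMap, List.mem_map, List.mem_filter, Bool.and_eq_true, beq_iff_eq,
    Bool.not_eq_true', beq_eq_false_iff_ne]
  constructor
  · rintro ⟨⟨g₁, r, g₂⟩, ⟨h, rfl, hne⟩, ⟨g₃, W⟩, ⟨hW, rfl⟩, rfl⟩
    exact ⟨_, hne, h, hW⟩
  · rintro ⟨g', hne, h, hW⟩
    exact ⟨_, ⟨h, rfl, hne⟩, (g', w.2), ⟨hW, rfl⟩, rfl⟩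

/-- A run consists of transitions that keep the global state, followed by nothing or by a transition
that changes it and the rest of the run. -/
theorem run_iff {m g' : ℕ} {t t' : StackTree S.order} {A₀ : StackTreeAutomaton} :
    S.Run m (g, t) (g', t') ↔ ∃ t₁, (S.round fam g A₀).Reach t t₁ ∧
      ((m = 0 ∧ g' = g ∧ t' = t₁) ∨ ∃ g₂ r t₂ m', m = m' + 1 ∧ g₂ ≠ g ∧ (g, r, g₂) ∈ S.rules ∧
        StackTree.Step r t₁ t₂ ∧ S.Run m' (g₂, t₂) (g', t')) := by
  constructor
  · intro h
    generalize hc : (g, t) = c at h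
    generalize hc' : (g', t') = c' at h
    induction h generalizing t with
    | refl c =>
      subst hc
      cases hc'
      exact ⟨t', .refl, .inl ⟨rfl, rfl, rfl⟩⟩
    | @step m c c₁ c₂ h hr ih =>
      subst hc hc'
      obtain ⟨g₁, t₁⟩ := c₁
      obtain ⟨r, hr', hs⟩ := h
      by_cases hg : g = g₁
      · subst hg
        obtain ⟨t₂, h₂, h⟩ := ih rfl rfl
        rw [if_pos rfl]
        exact ⟨t₂, .head ⟨r, mem_locals_round.2 hr', hs⟩ h₂, h⟩
      · rw [if_neg hg]
        exact ⟨t, .refl, .inr ⟨g₁, r, t₁, m, rfl, Ne.symm hg, hr', hs, hr⟩⟩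
  · rintro ⟨t₁, h, h'⟩
    have hrun : S.Run m (g, t₁) (g', t') := by
      rcases h' with ⟨rfl, rfl, rfl⟩ | ⟨g₂, r, t₂, m', rfl, hg, hr, hs, h⟩
      · exact .refl _
      · have := Run.step (S := S) (c := (g, t₁)) (c' := (g₂, t₂)) ⟨r, hr, hs⟩ h
        rwa [if_neg (Ne.symm hg)] at this
    clear h'
    induction h using Relation.ReflTransGen.head_induction_on with
    | refl => exact hrun
    | @head t₂ t₃ h _ ih =>
      obtain ⟨r, hr, hs⟩ := h
      have := Run.step (S := S) (c := (g, t₂)) (c' := (g, t₃)) ⟨r, mem_locals_round.1 hr, hs⟩ ih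
      rwa [if_pos rfl] at this

/-- `fam` represents the trees from which fewer than `k` changes of global state suffice. For `k = 0`
there are none, and the empty family represents them. -/
structure Represents (S : GASTRS) (targets fam : List (ℕ × StackTreeAutomaton)) (k : ℕ) : Prop where
  valid : ∀ W ∈ fam, W.2.Valid S.order S.alphabet S.controls
  mem_iff : ∀ g ∈ S.globals, ∀ t : StackTree S.order, t.Over S.alphabet S.controls →
    ((∃ W, (g, W) ∈ fam ∧ t ∈ W.lang S.alphabet S.controls) ↔
      ∃ m g' t' A', m < k ∧ S.Run m (g, t) (g', t') ∧ (g', A') ∈ targets ∧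
        t' ∈ A'.lang S.alphabet S.controls)

theorem wf_round (hS : S.Valid) (ht : S.IsTargetFamily targets)
    (hf : ∀ W ∈ fam, W.2.Valid S.order S.alphabet S.controls) {A₀ : StackTreeAutomaton}
    (hA : (g, A₀) ∈ targets) : (S.round fam g A₀).WF where
  one_le_order := hS.one_le_order
  automata_valid W hW := by
    rcases List.mem_cons.1 hW with rfl | hW
    · exact ht.valid _ _ hA
    · obtain ⟨w, hw, rfl⟩ := List.mem_map.1 hW
      obtain ⟨g', -, -, h⟩ := mem_switches_round.1 hw
      exact hf _ h
  locals_valid r hr := (hS.rules_mem _ _ _ (mem_locals_round.1 hr)).2.1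
  switches_valid w hw := by
    obtain ⟨g', -, h, -⟩ := mem_switches_round.1 hw
    exact (hS.rules_mem _ _ _ h).2.1

/-- One round accounts for one more change of global state. -/
theorem mem_lang_round (hS : S.Valid) (ht : S.IsTargetFamily targets) {k : ℕ}
    (hf : S.Represents targets fam k) {A₀ : StackTreeAutomaton} (hA : (g, A₀) ∈ targets)
    {t : StackTree S.order} (hto : t.Over S.alphabet S.controls) :
    t ∈ (S.round fam g A₀).automaton.lang S.alphabet S.controls ↔
      ∃ m g' t' A', m < k + 1 ∧ S.Run m (g, t) (g', t') ∧ (g', A') ∈ targets ∧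
        t' ∈ A'.lang S.alphabet S.controls := by
  have hR := wf_round hS ht hf.valid hA
  refine (Round.mem_lang_automaton hR).trans ⟨?_, ?_⟩
  · rintro ⟨-, t₁, h₁, h | ⟨w, hw, t₂, h₂, h⟩⟩
    · exact ⟨0, g, t₁, A₀, k.succ_pos, run_iff.2 ⟨t₁, h₁, .inl ⟨rfl, rfl, rfl⟩⟩, hA, h⟩
    · obtain ⟨g₂, hne, hr, hW⟩ := mem_switches_round.1 hw
      obtain ⟨-, hv, hg₂⟩ := hS.rules_mem _ _ _ hr
      obtain ⟨m, g', t', A', hm, hrun, hA', ht'⟩ := (hf.mem_iff _ hg₂ t₂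
        (h₂.over hv (Round.reach_over hR h₁ hto))).1 ⟨_, hW, h⟩
      exact ⟨m + 1, g', t', A', Nat.succ_lt_succ hm,
        run_iff.2 ⟨t₁, h₁, .inr ⟨g₂, _, t₂, m, rfl, hne, hr, h₂, hrun⟩⟩, hA', ht'⟩
  · rintro ⟨m, g', t', A', hm, hrun, hA', ht'⟩
    obtain ⟨t₁, h₁, ⟨rfl, rfl, rfl⟩ | ⟨g₂, r, t₂, m', rfl, hne, hr, h₂, hrun⟩⟩ :=
      (run_iff (fam := fam) (A₀ := A₀)).1 hrun
    · obtain rfl : A' = A₀ :=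
        congrArg Prod.snd (List.inj_on_of_nodup_map ht.nodup hA' hA rfl)
      exact ⟨hto, _, h₁, .inl ht'⟩
    · obtain ⟨-, hv, hg₂⟩ := hS.rules_mem _ _ _ hr
      obtain ⟨W, hW, h⟩ := (hf.mem_iff _ hg₂ t₂ (h₂.over hv (Round.reach_over hR h₁ hto))).2
        ⟨m', g', t', A', Nat.lt_of_succ_lt_succ hm, hrun, hA', ht'⟩
      exact ⟨hto, _, h₁, .inr ⟨(r, W), mem_switches_round.2 ⟨g₂, hne, hr, hW⟩, t₂, h₂, h⟩⟩

theorem mem_nextFamily {A : StackTreeAutomaton} : (g, A) ∈ S.nextFamily targets fam ↔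
    ∃ A₀, (g, A₀) ∈ targets ∧ A = (S.round fam g A₀).automaton := by
  simp only [nextFamily, List.mem_map, Prod.mk.injEq]
  constructor
  · rintro ⟨⟨g', A₀⟩, h, rfl, rfl⟩
    exact ⟨_, h, rfl⟩
  · rintro ⟨A₀, h, rfl⟩
    exact ⟨_, h, rfl, rfl⟩

theorem represents_family (hS : S.Valid) (ht : S.IsTargetFamily targets) (k : ℕ) :
    S.Represents targets (S.family targets k) k := by
  induction k with
  | zero => exact ⟨by simp [family], by simp [family]⟩
  | succ k ih =>
    have heq : S.family targets (k + 1) = S.nextFamily targets (S.family targets k) :=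
      Function.iterate_succ_apply' ..
    rw [heq]
    refine ⟨fun ⟨g, W⟩ hW => ?_, fun g hg t hto => ?_⟩
    · obtain ⟨A₀, hA, rfl⟩ := mem_nextFamily.1 hW
      exact Round.automaton_valid (wf_round hS ht ih.valid hA)
    · constructor
      · rintro ⟨W, hW, h⟩
        obtain ⟨A₀, hA, rfl⟩ := mem_nextFamily.1 hW
        exact (mem_lang_round hS ht ih hA hto).1 h
      · intro h
        obtain ⟨⟨_, A₀⟩, hA, rfl⟩ := List.mem_map.1 ((ht.mem_iff g).2 hg)
        exact ⟨_, mem_nextFamily.2 ⟨A₀, hA, rfl⟩, (mem_lang_round hS ht ih hA hto).2 h⟩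

theorem exists_solve_eq (hg : g ∈ targets.map Prod.fst) (b : ℕ) : ∃ A₀, (g, A₀) ∈ targets ∧
    solve (S, targets, b, g) = (S.round (S.family targets b) g A₀).automaton := by
  have heq : S.family targets (b + 1) = S.nextFamily targets (S.family targets b) :=
    Function.iterate_succ_apply' ..
  obtain ⟨⟨_, A₀⟩, hA, rfl⟩ := List.mem_map.1 hg
  simp only [solve, heq]
  set l := (S.nextFamily targets (S.family targets b)).filter fun W => W.1 == _ with hl
  have hmem : (_, (S.round (S.family targets b) _ A₀).automaton) ∈ l :=
    List.mem_filter.2 ⟨mem_nextFamily.2 ⟨A₀, hA, rfl⟩, beq_self_eq_true _⟩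
  have hsub : ∀ W ∈ l, W ∈ S.nextFamily targets (S.family targets b) ∧ _ :=
    fun W hW => List.mem_filter.1 hW
  cases h : l with
  | nil => simp [h] at hmem
  | cons W l' =>
    obtain ⟨hW, hW'⟩ := hsub W (h ▸ List.mem_cons_self)
    obtain ⟨g', W⟩ := W
    obtain rfl := beq_iff_eq.1 hW'
    obtain ⟨A₁, hA₁, rfl⟩ := mem_nextFamily.1 hW
    exact ⟨A₁, hA₁, rfl⟩

end GASTRS

theorem mainTheorem2 :
    ∃ solve : GASTRS × List (ℕ × StackTreeAutomaton) × ℕ × ℕ → StackTreeAutomaton,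
      Computable solve ∧
        ∀ (S : GASTRS) (targets : List (ℕ × StackTreeAutomaton)) (b g : ℕ),
          S.Valid → S.IsTargetFamily targets → g ∈ S.globals →
            (solve (S, targets, b, g)).Valid S.order S.alphabet S.controls ∧
              (solve (S, targets, b, g)).lang S.alphabet S.controls =
                S.contextBoundedPre targets b g := by
  refine ⟨GASTRS.solve, GASTRS.primrec_solve.to_comp, fun S targets b g hS ht hg => ?_⟩
  obtain ⟨A₀, hA, h⟩ := GASTRS.exists_solve_eq (S := S) ((ht.mem_iff g).2 hg) b
  have hrep := GASTRS.represents_family hS ht b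
  rw [h]
  refine ⟨Round.automaton_valid (GASTRS.wf_round hS ht hrep.valid hA), Set.ext fun t => ?_⟩
  simp only [GASTRS.contextBoundedPre, Set.mem_ofPred_eq, ← Nat.lt_succ_iff]
  constructor
  · intro h
    exact ⟨h.1, (GASTRS.mem_lang_round hS ht hrep hA h.1).1 h⟩
  · exact fun h => (GASTRS.mem_lang_round hS ht hrep hA h.1).2 h.2
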